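/- Let $\sigma_0\ge\sigma_1>0$ be real numbers. The class $\mathcal S^{\sharp\flat}(\sigma_0,\sigma_1)$ consists of the meromorphic functions $F$ on $\mathbb C$ such that: (i') $F(s)=\sum_{n\ge1}a_F(n)n^{-s}$ for $\mathrm{Re}\,s>\sigma_0$, the series being absolutely convergent there; (ii') $F$ has finitely many poles $s_1,\dots,s_N$ (distinct, of orders $m_1,\dots,m_N$), and $\prod_{i=1}^N(s-s_i)^{m_i}F(s)$ is an entire function of finite order; (iii') there are $Q_F>0$, $r\ge0$, $\lambda_j>0$, $\mu_j\in\mathbb C$ $(1\le j\le r)$ and $\omega\in\mathbb C$ with $|\omega|=1$ such that $\xi_F(s)=\omega\,\overline{\xi_F(\sigma_1-\bar s)}$ as meromorphic functions, where $$\xi_F(s)=F(s)\,Q_F^{s}\prod_{j=1}^r\Gamma(\lambda_js+\mu_j)\prod_{i\in P}(s-s_i)^{m_i}\prod_{i\notin P}(s-s_i)^{m_i}(\sigma_1-s-\overline{s_i})^{m_i}$$ and $P\subseteq\{1,\dots,N\}$ is the set of indices of the paired poles: if $i\in P$, then $\sigma_1-\overline{s_i}$ is a pole with index in $P$; all poles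 $s_i$ for which $\sigma_1-\overline{s_i}$ is a pole different from $s_i$ have $i\in P$; and $i\in P$ if $s_i=\sigma_1/2$ (other poles on the line $\mathrm{Re}\,s=\sigma_1/2$ may be put in $P$ or not); (v') $F$ has no zeros in $\mathrm{Re}\,s>\sigma_0$, and there $\frac{F'}{F}(s)=-\sum_{n\ge2}c_F(n)n^{-s}$ with an absolutely convergent series. Let $F\in\mathcal S^{\sharp\flat}(\sigma_0,\sigma_1)$, with a completed function $\xi_F$ as in (iii'), and let $Z(F)$ be the multiset of non-trivial zeros of $F$, that is, of zeros of $\xi_F$ counted with multiplicity. Let $\tau\in[\sigma_1,+\infty)$ be such that $0,\tau\notin Z(F)$. Then for every positive integer $n$: (i) The sum defining the $\tau$-Li coefficient $$\lambda_F(n,\tau)=\sum_{\rho\in Z(F)}^{\ \ \ *}\left(1-\left(\frac{\rho}{\rho-\tau}\right)^n\right):=\lim_{T\to\infty}\ \sum_{\rho\in Z(F),\ |\mathrm{Im}\,\rho|\le T}\left(1-\left(\frac{\rho}{\rho-\tau}\right)^n\right)$$ is $*$-convergent, i.e. for every $T$ only finitely many $\rho\in Z(F)$ satisfy $|\mathrm{Im}\,\rho|\le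 T$, and the limit exists. (ii) $$\mathrm{Re}\,\lambda_F(n,\tau)=\sum_{\rho\in Z(F)}\mathrm{Re}\left(1-\left(\frac{\rho}{\rho-\tau}\right)^n\right),$$ where the series on the right converges absolutely. -/

import Mathlib

open Filter Topology
open scoped ComplexConjugate

noncomputable section

namespace TauLi

/-- A function `g : ℂ → ℂ` has finite order of growth: `g s = O(exp (|s| ^ k))` as `|s| → ∞`,
for some exponent `k`. -/
def FiniteOrder (g : ℂ → ℂ) : Prop :=
  ∃ k : ℝ, g =O[cocompact ℂ] fun s => Real.exp (‖s‖ ^ k)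

/-- The order of the pole of `F` at `w` (it is `0` if `w` is not a pole). -/
def poleOrder (F : ℂ → ℂ) (w : ℂ) : ℕ :=
  (-(meromorphicOrderAt F w).untop₀).toNat

/-- The parameters that enter the completed function: `Q`, `ω`, the gamma factors
`Γ(lam j * s + mu j)`, the finite set of poles of `F`, and the set of those poles
(the first `2M + δ` in the usual enumeration) that are paired off by `z + conj w = σ₁`. -/
structure CompletionData where
  Q : ℝ
  omega : ℂ
  r : ℕ
  lam : Fin r → ℝ
  mu : Fin r → ℂ
  poles : Finset ℂ
  paired : Finset ℂ

/-- The completed function `ξ_F`. -/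
def completed (σ₁ : ℝ) (d : CompletionData) (F : ℂ → ℂ) (s : ℂ) : ℂ :=
  F s * (d.Q : ℂ) ^ s * (∏ j, Complex.Gamma (d.lam j * s + d.mu j))
    * (∏ w ∈ d.paired, (s - w) ^ poleOrder F w)
    * ∏ w ∈ d.poles \ d.paired, (s - w) ^ poleOrder F w * (σ₁ - s - conj w) ^ poleOrder F w

/-- `F` belongs to the class `S^{♯♭}(σ₀, σ₁)`, with parameters `d` in its functional equation.

`F` is a meromorphic function on `ℂ`; its values at its poles are irrelevant. -/
structure IsSharpFlat (σ₀ σ₁ : ℝ) (F : ℂ → ℂ) (d : CompletionData) : Prop where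
  /-- `F` is an absolutely convergent Dirichlet series for `Re s > σ₀`. -/
  dirichlet : ∃ a : ℕ → ℂ, ∀ s : ℂ, σ₀ < s.re → LSeriesHasSum a s (F s)
  /-- The finite set `d.poles` consists of the poles of `F`. -/
  mem_poles : ∀ w : ℂ, w ∈ d.poles ↔ meromorphicOrderAt F w < 0
  /-- `∏ (s - sᵢ) ^ mᵢ * F s` is an entire function of finite order. -/
  continuation : ∃ g : ℂ → ℂ, Differentiable ℂ g ∧ FiniteOrder g ∧
    ∀ s ∉ d.poles, g s = (∏ w ∈ d.poles, (s - w) ^ poleOrder F w) * F s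
  Q_pos : 0 < d.Q
  norm_omega : ‖d.omega‖ = 1
  lam_pos : ∀ j, 0 < d.lam j
  paired_subset : d.paired ⊆ d.poles
  paired_reflect : ∀ w ∈ d.paired, (σ₁ : ℂ) - conj w ∈ d.paired
  /-- All pairs `z ≠ w` of poles with `z + conj w = σ₁` are in `d.paired`, and so is `σ₁ / 2` if it
  is a pole. (Other poles on the line `Re s = σ₁ / 2`, if any, may be put in either class.) -/
  mem_paired : ∀ w ∈ d.poles, (σ₁ : ℂ) - conj w ∈ d.poles →
    ((σ₁ : ℂ) - conj w ≠ w ∨ w = σ₁ / 2) → w ∈ d.paired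
  /-- The functional equation, as an identity of meromorphic functions on `ℂ`. -/
  functional_equation : ∀ᶠ s in codiscrete ℂ,
    completed σ₁ d F s = d.omega * conj (completed σ₁ d F (σ₁ - conj s))
  /-- `F' / F` is a Dirichlet series without constant term, absolutely convergent for
  `Re s > σ₀`; in particular it is defined there. -/
  euler_sum : ∃ c : ℕ → ℂ, c 1 = 0 ∧ ∀ s : ℂ, σ₀ < s.re →
    F s ≠ 0 ∧ LSeriesHasSum c s (-(deriv F s / F s))

/-- `Z(F)`, the set of non-trivial zeros of `F`: the zeros of the completed function. -/
def nontrivialZeros (σ₁ : ℝ) (d : CompletionData) (F : ℂ → ℂ) : Set ℂ :=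
  {ρ | 0 < meromorphicOrderAt (completed σ₁ d F) ρ}

/-- The multiplicity of `ρ` as a zero of the completed function. -/
def zeroMultiplicity (σ₁ : ℝ) (d : CompletionData) (F : ℂ → ℂ) (ρ : ℂ) : ℕ :=
  (meromorphicOrderAt (completed σ₁ d F) ρ).untop₀.toNat

/-- The non-trivial zeros with `|Im ρ| ≤ T`. -/
def zerosUpTo (σ₁ : ℝ) (d : CompletionData) (F : ℂ → ℂ) (T : ℝ) : Set ℂ :=
  {ρ ∈ nontrivialZeros σ₁ d F | |ρ.im| ≤ T}

/-- The sum of `f` over the zeros with `|Im ρ| ≤ T`, counted with multiplicity. -/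
def partialSum (σ₁ : ℝ) (d : CompletionData) (F : ℂ → ℂ) (f : ℂ → ℂ) (T : ℝ) : ℂ :=
  ∑ᶠ ρ ∈ zerosUpTo σ₁ d F T, (zeroMultiplicity σ₁ d F ρ : ℂ) * f ρ

/-- `∗`-convergence of `∑ f ρ` over the non-trivial zeros: the sums over `|Im ρ| ≤ T` are finite
sums, and they have a limit as `T → ∞`. -/
def StarConvergent (σ₁ : ℝ) (d : CompletionData) (F : ℂ → ℂ) (f : ℂ → ℂ) : Prop :=
  (∀ T : ℝ, (zerosUpTo σ₁ d F T).Finite) ∧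
    ∃ L : ℂ, Tendsto (partialSum σ₁ d F f) atTop (𝓝 L)

/-- The `∗`-sum `lim_{T → ∞} ∑_{|Im ρ| ≤ T} f ρ`. -/
def starSum (σ₁ : ℝ) (d : CompletionData) (F : ℂ → ℂ) (f : ℂ → ℂ) : ℂ :=
  limUnder atTop (partialSum σ₁ d F f)

/-- The summand `1 - (ρ / (ρ - τ)) ^ n`. -/
def liTerm (n : ℕ) (τ : ℝ) (ρ : ℂ) : ℂ := 1 - (ρ / (ρ - τ)) ^ n

/-- The `n`-th `τ`-Li coefficient `λ_F(n, τ)`. -/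
def liCoeff (σ₁ : ℝ) (d : CompletionData) (F : ℂ → ℂ) (n : ℕ) (τ : ℝ) : ℂ :=
  starSum σ₁ d F (liTerm n τ)

end TauLi

end

/-!
The idea is to expand the summand `1 - (ρ / (ρ - τ)) ^ n = -n τ / (ρ - τ) + O(|ρ - τ|⁻²)`. The
zeros lie in a vertical strip, so that `1 / (ρ - τ) = -i sgn(γ) / (1 + |γ|) + O((1 + |γ|)⁻²)` with
`γ = Im ρ`. The summand is therefore, up to an absolutely summable error, purely imaginary and odd
in `γ` (`TauLi.norm_liTerm_sub_le`). Two facts about the zeros remain to be shown.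

* A horizontal strip of height one contains `O(log)` zeros (`TauLi.exists_massOn_window_le`), so
  that `∑ (1 + |γ|)⁻²` converges.
* The numbers of zeros with `0 < γ ≤ T` and with `-T ≤ γ < 0` differ by `O(T ^ (3 / 4))`
  (`TauLi.exists_abs_discrepancy_le`), so that `∑ sgn(γ) / (1 + |γ|)` converges by Abel summation
  (`TauLi.FiniteInStrips.exists_tendsto_sum_sign`).

Neither needs an asymptotic formula for the number of zeros, Stirling's formula or a Hadamard
product. The Phragmén–Lindelöf principle and the functional equation show that `F` has polynomial
growth in vertical strips (`TauLi.IsHeight.polyLE_one`). Quotients of Gamma functions are controlled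
by the Beta integral (`TauLi.exists_norm_Gamma_add_le`). Jensen's formula then gives the first fact,
and with the Poisson formula it shows that `log |F|` is the sum of `O(log T)` terms `log |s - ρ|` up
to `O(log T)` near height `T` (`TauLi.exists_abs_log_norm_le_sum_zeros`).

For the second fact Jensen's formula is applied to the completed function `ξ` on two circles of
radii about `T / 2` and `T / 2 - √T`, centred on the critical line at height about `T / 2`. The
difference of the means of `log |ξ|` over these circles determines the number of zeros up to height
`T` with an error `O(√T log T)`. Passing to the complex conjugate circles changes the means only by
`O(log² T)` (`TauLi.IsHeight.exists_abs_circleAverage_sub_le`): to the right of the critical strip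
`log |F|` is bounded and the Gamma factors at `s` and `conj s` are of comparable size, to the left
the functional equation applies, and the short arcs inside the strip are covered by the local
factorization. Hence the two half-planes contain nearly the same number of zeros.
-/

namespace TauLi

/-! ### Gamma quotients and Dirichlet series -/

lemma norm_betaIntegral_le_one {u v : ℂ} (hu : 1 ≤ u.re) (hv : 1 ≤ v.re) :
    ‖Complex.betaIntegral u v‖ ≤ 1 := by
  have h := intervalIntegral.norm_integral_le_of_norm_le_const (a := (0 : ℝ)) (b := 1) (C := 1)
    (f := fun x : ℝ => (x : ℂ) ^ (u - 1) * (1 - (x : ℂ)) ^ (v - 1)) ?_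
  · simpa [Complex.betaIntegral] using h
  · intro x hx
    rw [Set.uIoc_of_le zero_le_one] at hx
    rw [norm_mul, Complex.norm_cpow_eq_rpow_re_of_pos hx.1]
    have h1 : x ^ (u - 1).re ≤ 1 := Real.rpow_le_one hx.1.le hx.2 (by simpa using hu)
    have h2 : ‖(1 - (x : ℂ)) ^ (v - 1)‖ ≤ 1 := by
      rcases eq_or_lt_of_le hx.2 with h | h
      · subst h
        by_cases hv1 : v - 1 = 0
        · simp [hv1]
        · simp [Complex.zero_cpow hv1]
      · have : (1 - (x : ℂ)) = ((1 - x : ℝ) : ℂ) := by push_cast; ring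
        rw [this, Complex.norm_cpow_eq_rpow_re_of_pos (by linarith)]
        exact Real.rpow_le_one (by linarith) (by linarith [hx.1]) (by simpa using hv)
    exact mul_le_one₀ h1 (norm_nonneg _) h2

lemma Gamma_add_natCast {z : ℂ} (n : ℕ) (hz : ∀ k : ℕ, z + k ≠ 0) :
    Complex.Gamma (z + n) = (∏ k ∈ Finset.range n, (z + k)) * Complex.Gamma z := by
  induction n with
  | zero => simp
  | succ n ih =>
    rw [Finset.prod_range_succ, Nat.cast_succ, ← add_assoc, Complex.Gamma_add_one _ (hz n), ih]
    ring

/-- The Beta integral `Γ(u)Γ(w) / Γ(u + w)` is bounded by `1` for `Re u, Re w ≥ 1`, which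
compares `Γ(z + a)` with `Γ(z + n)` for a large integer `n`; the recurrence of the Gamma function
then compares `Γ(z + n)` with `Γ(z)`. -/
lemma exists_norm_Gamma_add_le (X : ℝ) (a : ℂ) : ∃ C : ℝ, 1 ≤ C ∧ ∃ N : ℕ, ∀ z : ℂ, -X ≤ z.re →
    1 + |a.im| ≤ |z.im| →
    ‖Complex.Gamma (z + a)‖ ≤ C * (1 + ‖z‖) ^ N * ‖Complex.Gamma z‖ := by
  obtain ⟨n, hn⟩ := exists_nat_ge (X + 1 + |a.re|)
  obtain ⟨k, hk⟩ := exists_nat_ge (1 + |a.re|)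
  set w : ℂ := k - a with hw
  have hwre : 1 ≤ w.re := by
    have := le_abs_self a.re
    simp only [hw, Complex.sub_re, Complex.natCast_re]; linarith
  have hGw : 0 < ‖Complex.Gamma w‖ :=
    norm_pos_iff.2 (Complex.Gamma_ne_zero_of_re_pos (by linarith))
  refine ⟨1 + ‖Complex.Gamma w‖⁻¹ * (n + k + 1 : ℝ) ^ (n + k), ?_, n + k, fun z hz hzim => ?_⟩
  · have : 0 ≤ ‖Complex.Gamma w‖⁻¹ * (n + k + 1 : ℝ) ^ (n + k) := by positivity
    linarith
  have hzim1 : 1 ≤ |z.im| := by linarith [abs_nonneg a.im]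
  have hne : ∀ j : ℕ, z + j ≠ 0 := by
    intro j h
    have := congrArg Complex.im h
    simp at this
    rw [this] at hzim1; norm_num at hzim1
  have him : ∀ j : ℕ, 1 ≤ ‖z + a + j‖ := by
    intro j
    refine le_trans ?_ (Complex.abs_im_le_norm _)
    simp only [Complex.add_im, Complex.natCast_im, add_zero]
    have := abs_sub_abs_le_abs_sub z.im (-a.im)
    rw [abs_neg, sub_neg_eq_add] at this
    linarith
  have hne' : ∀ j : ℕ, z + a + j ≠ 0 := fun j h => by
    have := him j; rw [h, norm_zero] at this; linarith
  -- the recurrence for `z + a`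
  have h1 : ‖Complex.Gamma (z + a)‖ ≤ ‖Complex.Gamma (z + a + n)‖ := by
    rw [Gamma_add_natCast n hne', norm_mul, norm_prod]
    refine le_mul_of_one_le_left (norm_nonneg _) ?_
    calc (1 : ℝ) = ∏ j ∈ Finset.range n, (1 : ℝ) := by simp
      _ ≤ _ := Finset.prod_le_prod (fun _ _ => zero_le_one) fun j _ => him j
  have hure : 1 ≤ (z + a + n).re := by
    have := neg_abs_le a.re
    simp only [Complex.add_re, Complex.natCast_re]; linarith
  have hsum : z + a + n + w = z + (n + k : ℕ) := by rw [hw]; push_cast; ring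
  -- the Beta integral
  have h2 : ‖Complex.Gamma (z + a + n)‖ * ‖Complex.Gamma w‖ ≤
      ‖Complex.Gamma (z + (n + k : ℕ))‖ := by
    have hb := norm_betaIntegral_le_one hure hwre
    rw [← norm_mul, Complex.Gamma_mul_Gamma_eq_betaIntegral (by linarith) (by linarith), norm_mul,
      hsum]
    exact mul_le_of_le_one_right (norm_nonneg _) hb
  have h3 : ‖Complex.Gamma (z + (n + k : ℕ))‖ ≤
      ((n + k + 1 : ℝ) * (1 + ‖z‖)) ^ (n + k) * ‖Complex.Gamma z‖ := by
    rw [Gamma_add_natCast _ hne, norm_mul, norm_prod]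
    refine mul_le_mul_of_nonneg_right ?_ (norm_nonneg _)
    calc ∏ j ∈ Finset.range (n + k), ‖z + j‖
        ≤ ∏ j ∈ Finset.range (n + k), ((n + k + 1 : ℝ) * (1 + ‖z‖)) := by
          refine Finset.prod_le_prod (fun _ _ => norm_nonneg _) fun j hj => ?_
          have hj' : (j : ℝ) ≤ n + k := by exact_mod_cast (Finset.mem_range.1 hj).le
          have := norm_add_le z (j : ℂ)
          rw [Complex.norm_natCast] at this
          nlinarith [norm_nonneg z, Nat.cast_nonneg (α := ℝ) n, Nat.cast_nonneg (α := ℝ) k]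
      _ = _ := by simp
  rw [← le_div_iff₀ hGw] at h2
  calc ‖Complex.Gamma (z + a)‖ ≤ _ := h1.trans h2
    _ ≤ ((n + k + 1 : ℝ) * (1 + ‖z‖)) ^ (n + k) * ‖Complex.Gamma z‖ / ‖Complex.Gamma w‖ := by gcongr
    _ = ‖Complex.Gamma w‖⁻¹ * (n + k + 1 : ℝ) ^ (n + k) * (1 + ‖z‖) ^ (n + k)
          * ‖Complex.Gamma z‖ := by rw [mul_pow]; field_simp
    _ ≤ _ := by gcongr; linarith

/-- An absolutely convergent Dirichlet series approaches its first coefficient exponentially fast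
to the right. -/
lemma exists_norm_sub_coeff_one_le {b : ℕ → ℂ} {f : ℂ → ℂ} {A : ℝ}
    (hf : ∀ s : ℂ, A ≤ s.re → LSeriesHasSum b s (f s)) :
    ∃ K : ℝ, 0 ≤ K ∧ ∀ s : ℂ, A ≤ s.re → ‖f s - b 1‖ ≤ K * 2 ^ (A - s.re) := by
  have hA : LSeriesHasSum b (A : ℂ) (f A) := hf _ (by simp)
  have hsum : Summable fun n => ‖LSeries.term b (A : ℂ) n‖ := hA.summable.norm
  refine ⟨∑' n, ‖LSeries.term b (A : ℂ) n‖, tsum_nonneg fun _ => norm_nonneg _, fun s hs => ?_⟩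
  have hsA := hf s hs
  have h1 : HasSum (fun n => LSeries.term b s n - if n = 1 then b 1 else 0) (f s - b 1) :=
    HasSum.sub hsA (hasSum_ite_eq 1 (b 1))
  refine h1.norm_le_of_bounded (hsum.hasSum.mul_right _) fun n => ?_
  have hpos : (0 : ℝ) < 2 ^ (A - s.re) := by positivity
  by_cases h1n : n = 1
  · subst h1n
    simp only [LSeries.term_def, one_ne_zero, if_false, Nat.cast_one, Complex.one_cpow, div_one,
      if_true, sub_self, norm_zero]
    positivity
  rcases Nat.eq_zero_or_pos n with h0 | h0
  · subst h0; simp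
  have hn2 : (2 : ℝ) ≤ n := by
    have : 2 ≤ n := by omega
    exact_mod_cast this
  simp only [h1n, if_false, sub_zero]
  rw [LSeries.norm_term_eq, LSeries.norm_term_eq]
  simp only [h0.ne', if_false, Complex.ofReal_re]
  have hnpos : (0 : ℝ) < n := by linarith
  rw [div_mul_eq_mul_div, div_le_div_iff₀ (by positivity) (by positivity)]
  have : (n : ℝ) ^ A ≤ 2 ^ (A - s.re) * (n : ℝ) ^ s.re := by
    have h3 : (n : ℝ) ^ (A - s.re) ≤ 2 ^ (A - s.re) :=
      Real.rpow_le_rpow_of_nonpos (by norm_num) hn2 (by linarith)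
    calc (n : ℝ) ^ A = n ^ (A - s.re) * n ^ s.re := by rw [← Real.rpow_add hnpos]; ring_nf
      _ ≤ _ := by gcongr
  calc ‖b n‖ * (n : ℝ) ^ A ≤ ‖b n‖ * (2 ^ (A - s.re) * (n : ℝ) ^ s.re) := by gcongr
    _ = _ := by ring

/-- If a Dirichlet series `F` has an absolutely convergent logarithmic derivative without constant
term, then `log |F|` is bounded: moving to the right, `log |F|` changes by a bounded amount only,
so the first coefficient of `F` cannot vanish. -/
lemma exists_abs_log_norm_le {F : ℂ → ℂ} {A : ℝ} {a c : ℕ → ℂ} (hc : c 1 = 0)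
    (hF : ∀ s : ℂ, A ≤ s.re → LSeriesHasSum a s (F s))
    (hd : ∀ s : ℂ, A ≤ s.re → DifferentiableAt ℂ F s)
    (hne : ∀ s : ℂ, A ≤ s.re → F s ≠ 0)
    (hlog : ∀ s : ℂ, A ≤ s.re → LSeriesHasSum c s (-(deriv F s / F s))) :
    ∃ K : ℝ, 0 ≤ K ∧ ∀ s : ℂ, A ≤ s.re → |Real.log ‖F s‖| ≤ K := by
  obtain ⟨K₁, hK₁, h₁⟩ := exists_norm_sub_coeff_one_le hF
  obtain ⟨K₂, hK₂, h₂⟩ := exists_norm_sub_coeff_one_le hlog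
  have hl2 : 0 < Real.log 2 := Real.log_pos one_lt_two
  set M := K₂ / Real.log 2 with hM
  have hM0 : 0 ≤ M := by positivity
  -- horizontal variation of `log |F|`
  have hvar : ∀ t x : ℝ, A ≤ x →
      |Real.log ‖F (x + t * Complex.I)‖ - Real.log ‖F (A + t * Complex.I)‖| ≤ M := by
    intro t x hx
    have hre : ∀ y : ℝ, ((y : ℂ) + t * Complex.I).re = y := fun y => by simp
    set h : ℝ → ℝ := fun y => Real.log ‖F (y + t * Complex.I)‖
    have hder : ∀ y : ℝ, A ≤ y → HasDerivAt h
        (deriv F (y + t * Complex.I) / F (y + t * Complex.I)).re y := by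
      intro y hy
      have hy' : A ≤ ((y : ℂ) + t * Complex.I).re := by rw [hre]; exact hy
      have e1 : HasDerivAt (fun y : ℝ => F (y + t * Complex.I))
          (deriv F (y + t * Complex.I)) y := by
        have := (hd _ hy').hasDerivAt.comp (y : ℂ) ((hasDerivAt_id (y : ℂ)).add_const
          (t * Complex.I))
        simpa using this.comp_ofReal
      have e2 : HasDerivAt (fun y : ℝ => ‖F (y + t * Complex.I)‖ ^ 2)
          (2 * inner ℝ (F (y + t * Complex.I)) (deriv F (y + t * Complex.I))) y :=
        HasDerivAt.norm_sq e1
      have hn0 := hne _ hy'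
      have e3 := (e2.log (by positivity)).const_mul (1 / 2 : ℝ)
      refine (e3.congr_of_eventuallyEq ?_).congr_deriv ?_
      · refine Eventually.of_forall fun y => ?_
        simp only [h, Real.log_pow]; push_cast; ring
      · rw [Complex.inner, Complex.div_re, Complex.normSq_eq_norm_sq]
        simp only [Complex.mul_re, Complex.conj_re, Complex.conj_im]
        have : ‖F (y + t * Complex.I)‖ ≠ 0 := norm_ne_zero_iff.2 hn0
        field_simp
        ring
    have hbd : ∀ y : ℝ, A ≤ y →
        |(deriv F (y + t * Complex.I) / F (y + t * Complex.I)).re| ≤ K₂ * 2 ^ (A - y) := by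
      intro y hy
      have := h₂ (y + t * Complex.I) (by rw [hre]; exact hy)
      rw [hc, sub_zero, norm_neg, hre] at this
      exact (Complex.abs_re_le_norm _).trans this
    -- `M - M * 2 ^ (A - y)` has derivative `K₂ * 2 ^ (A - y)`
    have hB : ∀ y : ℝ, HasDerivAt (fun y : ℝ => M - M * 2 ^ (A - y)) (K₂ * 2 ^ (A - y)) y := by
      intro y
      have := (((hasDerivAt_id y).const_sub A).const_rpow (a := 2) (by norm_num)).const_mul M
      refine (this.const_sub M).congr_deriv ?_
      simp only [hM, id]
      field_simp
    have key := image_norm_le_of_norm_deriv_right_le_deriv_boundary (a := A) (b := x)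
      (f := fun y => h y - h A) (f' := fun y =>
        (deriv F (y + t * Complex.I) / F (y + t * Complex.I)).re)
      (B := fun y : ℝ => M - M * 2 ^ (A - y)) (B' := fun y => K₂ * 2 ^ (A - y))
      (fun y hy => ((hder y hy.1).continuousAt.sub continuousAt_const).continuousWithinAt)
      (fun y hy => ((hder y hy.1).sub_const _).hasDerivWithinAt) (by simp) hB
      (fun y hy => hbd y hy.1) (Set.right_mem_Icc.2 hx)
    refine key.trans ?_
    have : 0 ≤ M * (2 : ℝ) ^ (A - x) := by positivity
    linarith
  have hdecomp : ∀ s : ℂ, ((s.re : ℝ) : ℂ) + (s.im : ℝ) * Complex.I = s := Complex.re_add_im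
  have htend : Tendsto (fun x : ℝ => K₁ * (2 : ℝ) ^ (A - x)) atTop (𝓝 0) := by
    have : Tendsto (fun x : ℝ => (2 : ℝ) ^ (A - x)) atTop (𝓝 0) :=
      (tendsto_rpow_atBot_of_base_gt_one (2 : ℝ) one_lt_two).comp
        (tendsto_atBot_add_const_left _ A tendsto_neg_atTop_atBot |>.congr fun x => by ring)
    simpa using this.const_mul K₁
  -- the first coefficient of `F` does not vanish
  have ha1 : a 1 ≠ 0 := by
    intro h0
    have hpos : 0 < Real.exp (Real.log ‖F (A + (0 : ℝ) * Complex.I)‖ - M) := Real.exp_pos _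
    obtain ⟨x, hx⟩ := ((htend.eventually (gt_mem_nhds hpos)).and (eventually_ge_atTop A)).exists
    have e1 := h₁ (x + (0 : ℝ) * Complex.I) (by simpa using hx.2)
    have hne' := hne (x + (0 : ℝ) * Complex.I) (by simpa using hx.2)
    rw [h0, sub_zero] at e1
    have e2 := (abs_le.1 (hvar 0 x hx.2)).1
    have e3 : ‖F (x + (0 : ℝ) * Complex.I)‖ <
        Real.exp (Real.log ‖F (A + (0 : ℝ) * Complex.I)‖ - M) := by
      refine e1.trans_lt ?_
      simpa using hx.1
    rw [← Real.log_lt_iff_lt_exp (norm_pos_iff.2 hne')] at e3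
    linarith
  have ha1' : 0 < ‖a 1‖ / 2 := by positivity
  obtain ⟨x, hx⟩ := ((htend.eventually (gt_mem_nhds ha1')).and (eventually_ge_atTop A)).exists
  refine ⟨2 * M + |Real.log (‖a 1‖ / 2)| + |Real.log (2 * ‖a 1‖)|, by positivity, fun s hs => ?_⟩
  have v1 := hvar s.im s.re hs
  rw [hdecomp] at v1
  have v2 := hvar s.im x hx.2
  have e1 := h₁ (x + s.im * Complex.I) (by simpa using hx.2)
  have hre : ((x : ℂ) + s.im * Complex.I).re = x := by simp
  rw [hre] at e1
  have e2 : ‖F (x + s.im * Complex.I) - a 1‖ ≤ ‖a 1‖ / 2 := e1.trans hx.1.le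
  have e3 : ‖a 1‖ / 2 ≤ ‖F (x + s.im * Complex.I)‖ := by
    have := norm_sub_norm_le (a 1) (F (x + s.im * Complex.I))
    rw [norm_sub_rev] at this
    linarith
  have e4 : ‖F (x + s.im * Complex.I)‖ ≤ 2 * ‖a 1‖ := by
    have := norm_sub_norm_le (F (x + s.im * Complex.I)) (a 1)
    linarith
  have l1 := Real.log_le_log ha1' e3
  have l2 := Real.log_le_log (ha1'.trans_le e3) e4
  have n1 := neg_abs_le (Real.log (‖a 1‖ / 2))
  have n2 := le_abs_self (Real.log (2 * ‖a 1‖))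
  rw [abs_le] at v1 v2 ⊢
  have n3 := abs_nonneg (Real.log (‖a 1‖ / 2))
  have n4 := abs_nonneg (Real.log (2 * ‖a 1‖))
  constructor <;> linarith [v1.1, v1.2, v2.1, v2.2]

/-! ### Local factorization of an analytic function -/

section

open Metric Real MeromorphicOn

lemma untop₀_map_natCast (n : ℕ∞) : (n.map Nat.cast : WithTop ℤ).untop₀ = n.toNat := by
  cases n with
  | top => rfl
  | coe n => simp

lemma circleIntegrable_abs_log_norm_sub (u c : ℂ) (R : ℝ) :
    CircleIntegrable (fun z => |Real.log ‖z - u‖|) c R := by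
  have : CircleIntegrable (fun z => Real.log ‖z - u‖) c R :=
    MeromorphicOn.circleIntegrable_log_norm (f := fun z => z - u) (by intro; fun_prop)
  exact this.abs

/-- The mean of `log ‖z - u‖` is at least `log R ≥ 0`, so that its negative part is controlled by
its positive part. -/
lemma circleAverage_abs_log_norm_sub_le {u c : ℂ} {R B : ℝ} (hR : 1 ≤ R)
    (hB : R + ‖c - u‖ ≤ B) :
    circleAverage (fun z => |Real.log ‖z - u‖|) c R ≤ 2 * Real.log B := by
  have hint : CircleIntegrable (fun z => Real.log ‖z - u‖) c R :=
    MeromorphicOn.circleIntegrable_log_norm (f := fun z => z - u) (by intro; fun_prop)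
  have hB1 : 1 ≤ B := hR.trans ((le_add_of_nonneg_right (norm_nonneg _)).trans hB)
  have h0 : 0 ≤ circleAverage (fun z => Real.log ‖z - u‖) c R := by
    rw [circleAverage_log_norm_sub_const_eq_log_radius_add_posLog (by linarith)]
    have := Real.log_nonneg hR
    have := Real.posLog_nonneg (x := R⁻¹ * ‖c - u‖)
    linarith
  have h1 : ∀ z ∈ sphere c |R|, |Real.log ‖z - u‖| + Real.log ‖z - u‖ ≤ 2 * Real.log B := by
    intro z hz
    rw [abs_of_nonneg (by linarith), mem_sphere_iff_norm] at hz
    have hzu : ‖z - u‖ ≤ B := by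
      calc ‖z - u‖ = ‖(z - c) + (c - u)‖ := by ring_nf
        _ ≤ _ := norm_add_le _ _
        _ ≤ B := by rw [hz]; exact hB
    have hlB := Real.log_nonneg hB1
    rcases le_total 0 (Real.log ‖z - u‖) with h | h
    · rw [abs_of_nonneg h]
      rcases (norm_nonneg (z - u)).eq_or_lt with h' | h'
      · rw [← h', Real.log_zero]; linarith
      · have := Real.log_le_log h' hzu
        linarith
    · rw [abs_of_nonpos h]; linarith
  have h2 := circleAverage_mono_on_of_le_circle
    ((circleIntegrable_abs_log_norm_sub u c R).add hint) h1
  have h3 := circleAverage_add (circleIntegrable_abs_log_norm_sub u c R) hint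
  have h4 : circleAverage ((fun z => |Real.log ‖z - u‖|) + fun z => Real.log ‖z - u‖) c R
    ≤ 2 * Real.log B := h2
  linarith

/-- A quantitative factorization near `c`: the zeros `u` of `f` in a closed ball of radius `R` are
`O(L)` in number, and on the ball of radius `R / 2` the function `log |f|` differs from
`∑ log |· - u|` by `O(L)` only. The quotient of `f` by its zeros has a harmonic logarithm, to which
the Poisson formula applies. -/
lemma exists_abs_log_norm_le_sum_zeros {R : ℝ} (hR : 1 ≤ R) : ∃ C : ℝ, 1 ≤ C ∧
    ∀ (f : ℂ → ℂ) (c : ℂ) (L : ℝ), 1 ≤ L → AnalyticOnNhd ℂ f (closedBall c (2 * R)) →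
      (∀ z ∈ closedBall c (2 * R), ‖f z‖ ≤ Real.exp L) → f c ≠ 0 → |Real.log ‖f c‖| ≤ L →
      ∃ S : Finset ℂ, (∀ u ∈ S, u ∈ closedBall c R) ∧
        (∀ u ∈ closedBall c R, f u = 0 → u ∈ S) ∧
        (∑ u ∈ S, (analyticOrderNatAt f u : ℝ) ≤ C * L) ∧
        ∀ w ∈ closedBall c (R / 2), f w ≠ 0 →
          |Real.log ‖f w‖| ≤ C * L +
            ∑ u ∈ S, (analyticOrderNatAt f u : ℝ) * |Real.log ‖w - u‖| := by
  have hR0 : 0 < R := by linarith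
  have hl2 : 0 < Real.log 2 := Real.log_pos one_lt_two
  have hlR : 0 ≤ Real.log (2 * R) := Real.log_nonneg (by linarith)
  set K : ℝ := 2 / Real.log 2 with hK
  have hK0 : 0 ≤ K := by positivity
  set C : ℝ := 1 + K + 3 * (2 * (1 + K * (2 * Real.log (2 * R))) + (1 + K * Real.log (2 * R)))
    with hC
  have hC1 : 1 ≤ C := by
    rw [hC]
    have : 0 ≤ K * Real.log (2 * R) := by positivity
    nlinarith
  refine ⟨C, hC1, fun f c L hL hf hbd hfc hlfc => ?_⟩
  set U := closedBall c R with hU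
  have hsub : U ⊆ closedBall c (2 * R) := closedBall_subset_closedBall (by linarith)
  have hfU : AnalyticOnNhd ℂ f U := hf.mono hsub
  have hcU : c ∈ U := mem_closedBall_self hR0.le
  have hUc : IsCompact U := isCompact_closedBall c R
  have hordc : meromorphicOrderAt f c ≠ ⊤ := by
    rw [(hfU c hcU).meromorphicOrderAt_eq, (hfU c hcU).analyticOrderAt_eq_zero.2 hfc]; simp
  have hord : ∀ u : U, meromorphicOrderAt f u ≠ ⊤ := by
    refine (hfU.meromorphicOn.exists_meromorphicOrderAt_ne_top_iff_forall
      ⟨⟨c, hcU⟩, (convex_closedBall c R).isPreconnected⟩).1 ⟨⟨c, hcU⟩, hordc⟩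
  set D := divisor f U with hD
  have hfin : D.support.Finite := D.finiteSupport hUc
  set S := hfin.toFinset with hS
  have hDval : ∀ u ∈ U, (D u : ℝ) = analyticOrderNatAt f u := by
    intro u hu
    rw [hD, hfU.divisor_apply hu, untop₀_map_natCast, analyticOrderNatAt, Int.cast_natCast]
  have hSU : ∀ u ∈ S, u ∈ U := fun u hu => D.supportWithinDomain (by simpa [hS] using hu)
  have hDS : ∀ u ∈ S, (D u : ℝ) = analyticOrderNatAt f u := fun u hu => hDval u (hSU u hu)
  have hfne : ∀ u ∈ S, f u = 0 := by
    intro u hu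
    by_contra h
    have h1 : D u ≠ 0 := by simpa [hS] using hu
    apply h1
    rw [hD, hfU.divisor_apply (hSU u hu), (hfU u (hSU u hu)).analyticOrderAt_eq_zero.2 h]; simp
  have hSmem : ∀ u ∈ U, f u = 0 → u ∈ S := by
    intro u hu h0
    have h1 : meromorphicOrderAt f u ≠ 0 := by
      rw [(hfU u hu).meromorphicOrderAt_eq]
      have h2 : analyticOrderAt f u ≠ 0 := by
        rw [Ne, (hfU u hu).analyticOrderAt_eq_zero]; simpa using h0
      intro h3
      cases h4 : analyticOrderAt f u with
      | top => rw [h4] at h3; simp at h3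
      | coe n => rw [h4] at h3 h2; simp at h3; simp [h3] at h2
    have h2 : D u ≠ 0 := by
      rw [hD, MeromorphicOn.divisor_apply hfU.meromorphicOn hu]
      intro h
      rcases WithTop.untop₀_eq_zero.1 h with h | h
      · exact h1 h
      · exact hord ⟨u, hu⟩ h
    simpa [hS] using h2
  -- the number of zeros
  have hN : ∑ u ∈ S, (analyticOrderNatAt f u : ℝ) ≤ K * L := by
    have h1 := AnalyticOnNhd.sum_divisor_le (c := c) (r := R) (R := 2 * R) (M := Real.exp L)
      (f := f) (by rw [abs_of_pos hR0]; exact hR0)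
      (by rw [abs_of_pos hR0, abs_of_pos (by linarith)]; linarith)
      (Real.one_le_exp (by linarith)) (by rw [abs_of_pos (by linarith)]; exact hf) hfc
      (by rw [abs_of_pos (by linarith)]; exact fun z hz => hbd z (sphere_subset_closedBall hz))
    rw [abs_of_pos hR0] at h1
    have h2 : ((∑ᶠ u, divisor f U u : ℤ) : ℝ) = ∑ u ∈ S, (analyticOrderNatAt f u : ℝ) := by
      rw [finsum_eq_sum_of_support_subset (s := S) _ (by simp [hS, hD]), Int.cast_sum]
      exact Finset.sum_congr rfl fun u hu => hDS u hu
    rw [h2] at h1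
    refine h1.trans ?_
    have h3 : 2 * R / R = 2 := by field_simp
    rw [h3, hK, div_mul_eq_mul_div]
    gcongr
    rw [Real.log_div (Real.exp_pos _).ne' (norm_ne_zero_iff.2 hfc), Real.log_exp]
    linarith [(abs_le.1 hlfc).1]
  obtain ⟨g, hg, hgne, hfg⟩ := hfU.meromorphicOn.extract_zeros_poles hord hfin
  have hlog := extract_zeros_poles_log hgne hfg
  set P : ℂ → ℝ := fun z => ∑ u ∈ S, (analyticOrderNatAt f u : ℝ) * Real.log ‖z - u‖ with hP
  have hPeq : (∑ᶠ u, (fun z => (D u : ℝ) * Real.log ‖z - u‖) : ℂ → ℝ) = P := by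
    rw [finsum_eq_sum_of_support_subset (s := S)]
    · ext z
      rw [Finset.sum_apply]
      exact Finset.sum_congr rfl fun u hu => by rw [hDS u hu]
    · intro u hu
      simp only [Function.mem_support, ne_eq] at hu
      simp only [hS, Set.Finite.coe_toFinset, Function.mem_support]
      intro h; apply hu; ext z; simp [h]
  set h : ℂ → ℝ := fun z => Real.log ‖g z‖ with hh
  have hlog' : (fun z => Real.log ‖f z‖) =ᶠ[codiscreteWithin U] P + h := by
    rw [← hPeq]; exact hlog
  -- the identity holds at each interior point that is not a zero
  have hpt : ∀ w ∈ ball c R, f w ≠ 0 → Real.log ‖f w‖ = P w + h w := by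
    intro w hw hfw
    have hwU : w ∈ U := ball_subset_closedBall hw
    have hev : ∀ᶠ z in 𝓝[≠] w, Real.log ‖f z‖ = P z + h z := by
      have h1 := mem_codiscreteWithin_iff_forall_mem_nhdsNE.1 hlog' w hwU
      have h2 : ∀ᶠ z in 𝓝[≠] w, z ∈ U :=
        nhdsWithin_le_nhds (mem_of_superset (isOpen_ball.mem_nhds hw) ball_subset_closedBall)
      filter_upwards [h1, h2] with z hz hzU
      rcases hz with hz | hz
      · exact hz
      · exact absurd hzU hz
    have c1 : ContinuousAt (fun z => Real.log ‖f z‖) w :=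
      (hfU w hwU).continuousAt.norm.log (norm_ne_zero_iff.2 hfw)
    have c2 : ContinuousAt (fun z => P z + h z) w := by
      refine ContinuousAt.add ?_ ((hg w hwU).continuousAt.norm.log
        (norm_ne_zero_iff.2 (hgne ⟨w, hwU⟩)))
      refine tendsto_finsetSum _ fun u hu => ?_
      have : w - u ≠ 0 := by
        intro h0
        rw [sub_eq_zero] at h0
        exact hfw (h0 ▸ hfne u hu)
      exact (continuousAt_const.mul
        ((continuousAt_id.sub continuousAt_const).norm.log (norm_ne_zero_iff.2 this)))
    have t1 := c1.tendsto.mono_left (nhdsWithin_le_nhds (s := {w}ᶜ))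
    have t2 := c2.tendsto.mono_left (nhdsWithin_le_nhds (s := {w}ᶜ))
    exact tendsto_nhds_unique (t1.congr' hev) t2
  -- the harmonic function `h`
  have hharm : InnerProductSpace.HarmonicOnNhd h U :=
    fun x hx => (hg x hx).harmonicAt_log_norm (hgne ⟨x, hx⟩)
  have hRabs : |R| = R := abs_of_pos hR0
  have hcontS : ContinuousOn h (sphere c |R|) := by
    rw [hRabs]
    intro x hx
    have hx' := sphere_subset_closedBall hx
    exact ((hg x hx').continuousAt.norm.log
        (norm_ne_zero_iff.2 (hgne ⟨x, hx'⟩))).continuousWithinAt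
  have hint : CircleIntegrable h c R := hcontS.circleIntegrable'
  have hmean : circleAverage h c R = h c := by
    refine AnalyticOnNhd.circleAverage_log_norm_of_ne_zero (g := g) ?_ ?_
    · rw [hRabs]; exact hg
    · rw [hRabs]; exact fun u hu => hgne ⟨u, hu⟩
  -- a majorant of `2 h⁺`
  set b : ℂ → ℝ := fun z => 2 * (L + ∑ u ∈ S, (analyticOrderNatAt f u : ℝ) * |Real.log ‖z - u‖|)
    with hb
  have hbint0 : ∀ u ∈ S, CircleIntegrable
      (fun z => (analyticOrderNatAt f u : ℝ) * |Real.log ‖z - u‖|) c R :=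
    fun u _ => (circleIntegrable_abs_log_norm_sub u c R).const_mul _
  have hbint1 : CircleIntegrable
      (fun z => ∑ u ∈ S, (analyticOrderNatAt f u : ℝ) * |Real.log ‖z - u‖|) c R :=
    CircleIntegrable.fun_sum S hbint0
  have hbint : CircleIntegrable b c R :=
    ((circleIntegrable_const L c R).add hbint1).const_mul 2
  have hbavg : circleAverage b c R ≤ 2 * (L + K * L * (2 * Real.log (2 * R))) := by
    have e1 : circleAverage b c R = 2 * (L + ∑ u ∈ S, (analyticOrderNatAt f u : ℝ) *
        circleAverage (fun z => |Real.log ‖z - u‖|) c R) := by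
      have := circleAverage_fun_smul (a := (2 : ℝ)) (c := c) (R := R)
        (f := fun z => L + ∑ u ∈ S, (analyticOrderNatAt f u : ℝ) * |Real.log ‖z - u‖|)
      simp only [smul_eq_mul] at this
      rw [hb, this, circleAverage_fun_add (circleIntegrable_const L c R) hbint1,
        circleAverage_const, circleAverage_fun_sum hbint0]
      congr 2
      refine Finset.sum_congr rfl fun u _ => ?_
      exact circleAverage_fun_smul (a := (analyticOrderNatAt f u : ℝ)) (c := c) (R := R)
        (f := fun z => |Real.log ‖z - u‖|)
    rw [e1]
    gcongr
    calc _ ≤ ∑ u ∈ S, (analyticOrderNatAt f u : ℝ) * (2 * Real.log (2 * R)) := by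
          refine Finset.sum_le_sum fun u hu => mul_le_mul_of_nonneg_left ?_ (by positivity)
          refine circleAverage_abs_log_norm_sub_le hR ?_
          have := hSU u hu
          rw [hU, mem_closedBall, dist_comm, dist_eq_norm] at this
          linarith
      _ ≤ _ := by rw [← Finset.sum_mul]; gcongr
  have habs : circleAverage (fun z => |h z|) c R ≤
      2 * (L + K * L * (2 * Real.log (2 * R))) - h c := by
    rw [← hmean]
    have hle : circleAverage (fun z => |h z| + h z) c R ≤ circleAverage b c R := by
      have hcd : (fun z => |h z| + h z) =ᶠ[codiscreteWithin (sphere c |R|)]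
          fun z => min (|h z| + h z) (b z) := by
        have h1 := codiscreteWithin_mono (sphere_subset_closedBall (x := c) (ε := R)) hlog'
        rw [hRabs]
        filter_upwards [h1, self_mem_codiscreteWithin (sphere c R)] with z hz hzS
        refine (min_eq_left ?_).symm
        have hfz : Real.log ‖f z‖ ≤ L := by
          rcases eq_or_ne (f z) 0 with h0 | h0
          · rw [h0, norm_zero, Real.log_zero]; linarith
          · rw [Real.log_le_iff_le_exp (norm_pos_iff.2 h0)]
            exact hbd z (hsub (sphere_subset_closedBall hzS))
        have hPz : -P z ≤ ∑ u ∈ S, (analyticOrderNatAt f u : ℝ) * |Real.log ‖z - u‖| := by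
          rw [hP, ← Finset.sum_neg_distrib]
          refine Finset.sum_le_sum fun u _ => ?_
          rw [← mul_neg]
          exact mul_le_mul_of_nonneg_left (neg_le_abs _) (by positivity)
        have hsum0 : 0 ≤ ∑ u ∈ S, (analyticOrderNatAt f u : ℝ) * |Real.log ‖z - u‖| := by
          positivity
        have hz' : Real.log ‖f z‖ = P z + h z := hz
        simp only [hb]
        rcases le_total 0 (h z) with h0 | h0
        · rw [abs_of_nonneg h0]; linarith
        · rw [abs_of_nonpos h0]; linarith
      rw [circleAverage_congr_codiscreteWithin hcd hR0.ne']
      refine circleAverage_mono ?_ hbint fun z _ => min_le_right _ _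
      exact CircleIntegrable.congr_codiscreteWithin hcd (hint.abs.add hint)
    have hadd : circleAverage (fun z => |h z| + h z) c R =
        circleAverage (fun z => |h z|) c R + circleAverage h c R :=
      circleAverage_fun_add hint.abs hint
    linarith
  have hcb : c ∈ ball c R := mem_ball_self hR0
  have hhc : -(L + K * L * Real.log (2 * R)) ≤ h c := by
    have e1 := hpt c hcb hfc
    have e2 : P c ≤ K * L * Real.log (2 * R) := by
      calc P c ≤ ∑ u ∈ S, (analyticOrderNatAt f u : ℝ) * Real.log (2 * R) := by
            refine Finset.sum_le_sum fun u hu => mul_le_mul_of_nonneg_left ?_ (by positivity)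
            have h1 := hSU u hu
            rw [hU, mem_closedBall, dist_comm, dist_eq_norm] at h1
            rcases (norm_nonneg (c - u)).eq_or_lt with h' | h'
            · rw [← h', Real.log_zero]; exact hlR
            · exact Real.log_le_log h' (by linarith)
        _ ≤ _ := by rw [← Finset.sum_mul]; gcongr
    linarith [(abs_le.1 hlfc).1]
  refine ⟨S, hSU, hSmem, ?_, fun w hw hfw => ?_⟩
  · refine hN.trans ?_
    gcongr
    rw [hC]
    have : 0 ≤ K * Real.log (2 * R) := by positivity
    nlinarith
  have hwb : w ∈ ball c R := closedBall_subset_ball (by linarith) hw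
  have hpoisson := hharm.circleAverage_re_herglotzRieszKernel_smul hwb
  have hhw : |h w| ≤ 3 * circleAverage (fun z => |h z|) c R := by
    rw [← hpoisson]
    refine abs_circleAverage_le_circleAverage_abs.trans ?_
    have e3 : 3 * circleAverage (fun z => |h z|) c R
        = circleAverage (fun z => 3 * |h z|) c R :=
      (circleAverage_fun_smul (a := (3 : ℝ)) (c := c) (R := R) (f := fun z => |h z|)).symm
    rw [e3]
    refine circleAverage_mono ?_ (hint.abs.const_mul 3) ?_
    · refine ContinuousOn.circleIntegrable' ?_
      refine ContinuousOn.abs (ContinuousOn.mul ?_ hcontS)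
      exact Complex.continuous_re.comp_continuousOn (continuousOn_herglotzRieszKernel_sphere hwb)
    · intro z hz
      rw [hRabs] at hz
      have k1 := re_herglotzRieszKernel_le hz hwb
      have k2 := le_re_herglotzRieszKernel hz hwb
      rw [mem_closedBall, dist_eq_norm] at hw
      have k3 : 0 ≤ (R - ‖w - c‖) / (R + ‖w - c‖) := by
        apply div_nonneg <;> linarith [norm_nonneg (w - c)]
      have k4 : (R + ‖w - c‖) / (R - ‖w - c‖) ≤ 3 := by
        rw [div_le_iff₀ (by linarith)]; linarith
      change |(herglotzRieszKernel c w z).re * h z| ≤ 3 * |h z|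
      rw [abs_mul]
      refine mul_le_mul_of_nonneg_right ?_ (abs_nonneg _)
      rw [herglotzRieszKernel_def, abs_of_nonneg (k3.trans k2)]
      exact k1.trans k4
  rw [hpt w hwb hfw]
  have hPw : |P w| ≤ ∑ u ∈ S, (analyticOrderNatAt f u : ℝ) * |Real.log ‖w - u‖| := by
    refine (Finset.abs_sum_le_sum_abs _ _).trans (Finset.sum_le_sum fun u _ => ?_)
    rw [abs_mul, Nat.abs_cast]
  have hfinal : |h w| ≤ C * L := by
    have h1 : |h w| ≤ 3 * (2 * (L + K * L * (2 * Real.log (2 * R))) +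
        (L + K * L * Real.log (2 * R))) := by linarith
    refine h1.trans ?_
    rw [hC]
    nlinarith [mul_nonneg hK0 (zero_le_one.trans hL)]
  calc |P w + h w| ≤ |P w| + |h w| := abs_add_le _ _
    _ ≤ _ := by linarith

end

/-! ### The completed function and its zeros -/

/-- The factor `ξ_F / F`. -/
noncomputable def cofactor (σ₁ : ℝ) (d : CompletionData) (F : ℂ → ℂ) (s : ℂ) : ℂ :=
  (d.Q : ℂ) ^ s * (∏ j, Complex.Gamma (d.lam j * s + d.mu j))
    * (∏ w ∈ d.paired, (s - w) ^ poleOrder F w)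
    * ∏ w ∈ d.poles \ d.paired, (s - w) ^ poleOrder F w * (σ₁ - s - conj w) ^ poleOrder F w

lemma completed_eq (σ₁ : ℝ) (d : CompletionData) (F : ℂ → ℂ) (s : ℂ) :
    completed σ₁ d F s = F s * cofactor σ₁ d F s := by
  simp only [completed, cofactor]; ring

/-- At a regular point, `F` has no pole and all factors of `ξ_F / F` are analytic and nonzero. -/
def Regular (σ₁ : ℝ) (d : CompletionData) (s : ℂ) : Prop :=
  (∀ w ∈ d.poles, s - w ≠ 0 ∧ (σ₁ : ℂ) - s - conj w ≠ 0) ∧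
    ∀ (j : Fin d.r) (m : ℕ), (d.lam j : ℂ) * s + d.mu j ≠ -m

lemma analyticAt_Gamma {z : ℂ} (hz : ∀ m : ℕ, z ≠ -m) : AnalyticAt ℂ Complex.Gamma z := by
  have h1 : AnalyticAt ℂ (fun s => (Complex.Gamma s)⁻¹) z :=
    Complex.differentiable_one_div_Gamma.analyticAt z
  have h2 := h1.inv (inv_ne_zero (Complex.Gamma_ne_zero hz))
  simpa [Pi.inv_def] using h2

section

variable {σ₀ σ₁ : ℝ} {F : ℂ → ℂ} {d : CompletionData}

lemma cofactor_ne_zero (hF : IsSharpFlat σ₀ σ₁ F d) {s : ℂ} (hs : Regular σ₁ d s) :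
    cofactor σ₁ d F s ≠ 0 := by
  have hQ : (d.Q : ℂ) ≠ 0 := by exact_mod_cast hF.Q_pos.ne'
  refine mul_ne_zero (mul_ne_zero (mul_ne_zero ?_ ?_) ?_) ?_
  · simp [Complex.cpow_eq_zero_iff, hQ]
  · exact Finset.prod_ne_zero_iff.2 fun j _ => Complex.Gamma_ne_zero (hs.2 j)
  · exact Finset.prod_ne_zero_iff.2 fun w hw => pow_ne_zero _ (hs.1 w (hF.paired_subset hw)).1
  · refine Finset.prod_ne_zero_iff.2 fun w hw => ?_
    have := hs.1 w (Finset.mem_sdiff.1 hw).1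
    exact mul_ne_zero (pow_ne_zero _ this.1) (pow_ne_zero _ this.2)

lemma analyticAt_cofactor (hF : IsSharpFlat σ₀ σ₁ F d) {s : ℂ} (hs : Regular σ₁ d s) :
    AnalyticAt ℂ (cofactor σ₁ d F) s := by
  have hQ : (d.Q : ℂ) ≠ 0 := by exact_mod_cast hF.Q_pos.ne'
  unfold cofactor
  refine ((AnalyticAt.mul ?_ ?_).mul ?_).mul ?_
  · have : Differentiable ℂ fun s : ℂ => (d.Q : ℂ) ^ s :=
      differentiable_id.const_cpow (Or.inl hQ)
    exact this.analyticAt s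
  · refine Finset.analyticAt_fun_prod _ fun j _ => ?_
    exact AnalyticAt.fun_comp (g := Complex.Gamma) (f := fun s => (d.lam j : ℂ) * s + d.mu j)
      (analyticAt_Gamma (hs.2 j)) (by fun_prop)
  · exact Finset.analyticAt_fun_prod _ fun w _ => by fun_prop
  · exact Finset.analyticAt_fun_prod _ fun w _ => by fun_prop

lemma meromorphic_cofactor (hF : IsSharpFlat σ₀ σ₁ F d) : Meromorphic (cofactor σ₁ d F) := by
  have hQ : (d.Q : ℂ) ≠ 0 := by exact_mod_cast hF.Q_pos.ne'
  intro s
  unfold cofactor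
  refine ((MeromorphicAt.mul ?_ ?_).mul ?_).mul ?_
  · have : Differentiable ℂ fun s : ℂ => (d.Q : ℂ) ^ s :=
      differentiable_id.const_cpow (Or.inl hQ)
    exact (this.analyticAt s).meromorphicAt
  · refine MeromorphicAt.fun_prod fun j _ => ?_
    exact (Meromorphic.Gamma _).comp_analyticAt (f := Complex.Gamma)
      (g := fun s => (d.lam j : ℂ) * s + d.mu j) (by fun_prop)
  · exact MeromorphicAt.fun_prod fun w _ => by fun_prop
  · exact MeromorphicAt.fun_prod fun w _ => by fun_prop

lemma analyticAt_of_notMem_poles (hF : IsSharpFlat σ₀ σ₁ F d) {s : ℂ} (hs : s ∉ d.poles) :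
    AnalyticAt ℂ F s := by
  obtain ⟨g, hg, -, hgF⟩ := hF.continuation
  have hne : ∏ w ∈ d.poles, (s - w) ^ poleOrder F w ≠ 0 :=
    Finset.prod_ne_zero_iff.2 fun w hw => pow_ne_zero _
      (sub_ne_zero.2 fun h => hs (h ▸ hw))
  have h1 : AnalyticAt ℂ (fun z => g z / ∏ w ∈ d.poles, (z - w) ^ poleOrder F w) s :=
    (hg.analyticAt s).fun_div (Finset.analyticAt_fun_prod _ fun w _ => by fun_prop) hne
  refine h1.congr ?_
  have hopen : ∀ᶠ z in 𝓝 s, z ∉ d.poles :=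
    (d.poles.finite_toSet.isClosed.isOpen_compl).mem_nhds hs
  filter_upwards [hopen] with z hz
  rw [hgF z hz, mul_div_cancel_left₀]
  exact Finset.prod_ne_zero_iff.2 fun w hw => pow_ne_zero _
      (sub_ne_zero.2 fun h => hz (h ▸ hw))

lemma meromorphic_of_isSharpFlat (hF : IsSharpFlat σ₀ σ₁ F d) : Meromorphic F := by
  intro s
  by_cases hs : s ∈ d.poles
  · exact meromorphicAt_of_meromorphicOrderAt_ne_zero ((hF.mem_poles s).1 hs).ne
  · exact (analyticAt_of_notMem_poles hF hs).meromorphicAt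

lemma meromorphic_completed (hF : IsSharpFlat σ₀ σ₁ F d) : Meromorphic (completed σ₁ d F) := by
  intro s
  have : completed σ₁ d F = F * cofactor σ₁ d F := funext fun s => completed_eq σ₁ d F s
  rw [this]
  exact (meromorphic_of_isSharpFlat hF s).mul (meromorphic_cofactor hF s)

lemma notMem_poles_of_lt_re (hF : IsSharpFlat σ₀ σ₁ F d) {s : ℂ} (hs : σ₀ < s.re) :
    s ∉ d.poles := by
  obtain ⟨a, ha⟩ := hF.dirichlet
  rw [hF.mem_poles, not_lt]
  have hab : LSeries.abscissaOfAbsConv a ≤ σ₀ :=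
    LSeries.abscissaOfAbsConv_le_of_forall_lt_LSeriesSummable fun y hy =>
      (ha y (by simpa using hy)).LSeriesSummable
  have h1 : AnalyticAt ℂ (LSeries a) s :=
    LSeries_analyticOnNhd a s (lt_of_le_of_lt hab (by exact_mod_cast hs))
  have h2 : LSeries a =ᶠ[𝓝 s] F := by
    have : ∀ᶠ z : ℂ in 𝓝 s, σ₀ < z.re :=
      (isOpen_lt continuous_const Complex.continuous_re).mem_nhds hs
    filter_upwards [this] with z hz
    exact (ha z hz).LSeries_eq
  exact (h1.congr h2).meromorphicOrderAt_nonneg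

lemma Regular.notMem_poles {s : ℂ} (hs : Regular σ₁ d s) : s ∉ d.poles :=
  fun h => (hs.1 s h).1 (sub_self s)

lemma analyticAt_completed (hF : IsSharpFlat σ₀ σ₁ F d) {s : ℂ} (hs : Regular σ₁ d s) :
    AnalyticAt ℂ (completed σ₁ d F) s := by
  have : completed σ₁ d F = F * cofactor σ₁ d F := funext fun s => completed_eq σ₁ d F s
  rw [this]
  exact (analyticAt_of_notMem_poles hF hs.notMem_poles).mul (analyticAt_cofactor hF hs)

/-- Above the height `H`, the functions `ξ_F` and its reflection have no singularities. The bound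
on `λ_j s + μ_j` is the one needed to compare Gamma factors at `s` and `conj s`. -/
def IsHeight (σ₁ : ℝ) (d : CompletionData) (H : ℝ) : Prop :=
  1 ≤ H ∧ ∀ s : ℂ, H ≤ |s.im| →
    (∀ w ∈ d.poles, 1 ≤ ‖s - w‖ ∧ 1 ≤ ‖(σ₁ : ℂ) - s - conj w‖) ∧
    ∀ j, 1 + 2 * |(d.mu j).im| ≤ |((d.lam j : ℂ) * s + d.mu j).im|

lemma exists_height (hF : IsSharpFlat σ₀ σ₁ F d) : ∃ H : ℝ, IsHeight σ₁ d H := by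
  refine ⟨1 + ∑ w ∈ d.poles, |w.im| + ∑ j, (1 + 3 * |(d.mu j).im|) / d.lam j, ?_,
    fun s hs => ⟨fun w hw => ?_, fun j => ?_⟩⟩
  · have h1 : 0 ≤ ∑ w ∈ d.poles, |w.im| := by positivity
    have h2 : 0 ≤ ∑ j, (1 + 3 * |(d.mu j).im|) / d.lam j :=
      Finset.sum_nonneg fun j _ => div_nonneg (by positivity) (hF.lam_pos j).le
    linarith
  · have h1 : |w.im| ≤ ∑ w ∈ d.poles, |w.im| :=
      Finset.single_le_sum (f := fun w : ℂ => |w.im|) (fun _ _ => abs_nonneg _) hw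
    have h2 : 0 ≤ ∑ j, (1 + 3 * |(d.mu j).im|) / d.lam j :=
      Finset.sum_nonneg fun j _ => div_nonneg (by positivity) (hF.lam_pos j).le
    have h3 : 1 ≤ |s.im - w.im| := by
      have := abs_sub_abs_le_abs_sub s.im w.im
      linarith
    refine ⟨h3.trans ?_, h3.trans ?_⟩
    · have := Complex.abs_im_le_norm (s - w)
      simpa using this
    · have := Complex.abs_im_le_norm ((σ₁ : ℂ) - s - conj w)
      have e : ((σ₁ : ℂ) - s - conj w).im = -(s.im - w.im) := by simp; ring
      rwa [e, abs_neg] at this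
  · have h0 := hF.lam_pos j
    have h1 : (1 + 3 * |(d.mu j).im|) / d.lam j ≤ ∑ j, (1 + 3 * |(d.mu j).im|) / d.lam j :=
      Finset.single_le_sum (f := fun j => (1 + 3 * |(d.mu j).im|) / d.lam j)
        (fun j _ => div_nonneg (by positivity) (hF.lam_pos j).le) (Finset.mem_univ j)
    have h2 : 0 ≤ ∑ w ∈ d.poles, |w.im| := by positivity
    have h3 : (1 + 3 * |(d.mu j).im|) / d.lam j ≤ |s.im| := by linarith
    rw [div_le_iff₀ h0] at h3
    have e : ((d.lam j : ℂ) * s + d.mu j).im = d.lam j * s.im - -(d.mu j).im := by simp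
    rw [e]
    have := abs_sub_abs_le_abs_sub (d.lam j * s.im) (-(d.mu j).im)
    rw [abs_mul, abs_of_pos h0, abs_neg] at this
    linarith

lemma IsHeight.regular {H : ℝ} (hH : IsHeight σ₁ d H) {s : ℂ} (hs : H ≤ |s.im|) :
    Regular σ₁ d s := by
  refine ⟨fun w hw => ?_, fun j m h => ?_⟩
  · have := (hH.2 s hs).1 w hw
    exact ⟨fun h => by rw [h, norm_zero] at this; linarith [this.1],
      fun h => by rw [h, norm_zero] at this; linarith [this.2]⟩
  · have := (hH.2 s hs).2 j
    rw [h] at this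
    simp at this
    linarith [abs_nonneg (d.mu j).im]

lemma IsHeight.functional_equation (hF : IsSharpFlat σ₀ σ₁ F d) {H : ℝ} (hH : IsHeight σ₁ d H)
    {s : ℂ} (hs : H ≤ |s.im|) :
    ‖completed σ₁ d F (σ₁ - conj s)‖ = ‖completed σ₁ d F s‖ := by
  have hs' : H ≤ |((σ₁ : ℂ) - conj s).im| := by simpa using hs
  have hev : ∀ᶠ z in 𝓝[≠] s,
      completed σ₁ d F z = d.omega * conj (completed σ₁ d F (σ₁ - conj z)) := by
    have h := mem_codiscreteWithin_iff_forall_mem_nhdsNE.1 hF.functional_equation s (Set.mem_univ s)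
    filter_upwards [h] with z hz
    rcases hz with hz | hz
    · exact hz
    · exact absurd (Set.mem_univ z) hz
  have c1 := (analyticAt_completed hF (hH.regular hs)).continuousAt
  have c2 : ContinuousAt (fun z => d.omega * conj (completed σ₁ d F (σ₁ - conj z))) s := by
    refine continuousAt_const.mul (Complex.continuous_conj.continuousAt.comp ?_)
    refine ContinuousAt.comp (g := completed σ₁ d F)
      (analyticAt_completed hF (hH.regular hs')).continuousAt ?_
    exact continuousAt_const.sub Complex.continuous_conj.continuousAt
  have t1 := c1.tendsto.mono_left (nhdsWithin_le_nhds (s := {s}ᶜ))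
  have t2 := c2.tendsto.mono_left (nhdsWithin_le_nhds (s := {s}ᶜ))
  have := tendsto_nhds_unique (t1.congr' hev) t2
  rw [this, norm_mul, hF.norm_omega, one_mul, RCLike.norm_conj]

lemma exists_forall_lt_re_regular (hF : IsSharpFlat σ₀ σ₁ F d) : ∃ X : ℝ, σ₀ ≤ X ∧ ∀ s : ℂ,
    X < s.re → Regular σ₁ d s := by
  refine ⟨|σ₀| + |σ₁| + ∑ w ∈ d.poles, |w.re| + ∑ j, |(d.mu j).re| / d.lam j, ?_, fun s hs =>
    ⟨fun w hw => ?_, fun j m h => ?_⟩⟩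
  all_goals
    have h1 : 0 ≤ ∑ w ∈ d.poles, |w.re| := by positivity
    have h2 : 0 ≤ ∑ j, |(d.mu j).re| / d.lam j :=
      Finset.sum_nonneg fun j _ => div_nonneg (by positivity) (hF.lam_pos j).le
    have h3 := abs_nonneg σ₀
    have h4 := abs_nonneg σ₁
  · linarith [le_abs_self σ₀]
  · have h5 : |w.re| ≤ ∑ w ∈ d.poles, |w.re| :=
      Finset.single_le_sum (f := fun w : ℂ => |w.re|) (fun _ _ => abs_nonneg _) hw
    refine ⟨fun h => ?_, fun h => ?_⟩
    · have := congrArg Complex.re h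
      simp at this
      linarith [le_abs_self w.re]
    · have := congrArg Complex.re h
      simp at this
      linarith [neg_abs_le w.re, le_abs_self σ₁]
  · have h0 := hF.lam_pos j
    have h5 : |(d.mu j).re| / d.lam j ≤ ∑ j, |(d.mu j).re| / d.lam j :=
      Finset.single_le_sum (f := fun j => |(d.mu j).re| / d.lam j)
        (fun j _ => div_nonneg (by positivity) (hF.lam_pos j).le) (Finset.mem_univ j)
    have h6 : |(d.mu j).re| / d.lam j < s.re := by linarith
    rw [div_lt_iff₀ h0] at h6
    have := congrArg Complex.re h
    simp at this
    have h7 : (0 : ℝ) ≤ m := Nat.cast_nonneg m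
    linarith [neg_abs_le (d.mu j).re]

lemma ne_zero_of_lt_re (hF : IsSharpFlat σ₀ σ₁ F d) {s : ℂ} (hs : σ₀ < s.re) : F s ≠ 0 := by
  obtain ⟨c, -, hc⟩ := hF.euler_sum
  exact (hc s hs).1

lemma completed_ne_zero (hF : IsSharpFlat σ₀ σ₁ F d) {s : ℂ} (hs : σ₀ < s.re)
    (hr : Regular σ₁ d s) : completed σ₁ d F s ≠ 0 := by
  rw [completed_eq]
  exact mul_ne_zero (ne_zero_of_lt_re hF hs) (cofactor_ne_zero hF hr)

/-- The non-trivial zeros lie in a vertical strip: `ξ_F` does not vanish far to the right, and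
by the functional equation it does not vanish far to the left. -/
lemma exists_abs_re_le_of_mem_nontrivialZeros (hF : IsSharpFlat σ₀ σ₁ F d) :
    ∃ X : ℝ, ∀ ρ ∈ nontrivialZeros σ₁ d F, |ρ.re| ≤ X := by
  obtain ⟨X, hX0, hX⟩ := exists_forall_lt_re_regular hF
  refine ⟨|X| + |σ₁|, fun ρ hρ => ?_⟩
  have ht : Tendsto (completed σ₁ d F) (𝓝[≠] ρ) (𝓝 0) := tendsto_zero_of_meromorphicOrderAt_pos hρ
  have h1 : ρ.re ≤ X := by
    by_contra! h
    have c1 := (analyticAt_completed hF (hX ρ h)).continuousAt.tendsto.mono_left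
      (nhdsWithin_le_nhds (s := {ρ}ᶜ))
    exact completed_ne_zero hF (hX0.trans_lt h) (hX ρ h) (tendsto_nhds_unique c1 ht)
  have h2 : σ₁ - ρ.re ≤ X := by
    by_contra! h
    have h' : X < ((σ₁ : ℂ) - conj ρ).re := by simpa using h
    have hev : ∀ᶠ z in 𝓝[≠] ρ,
        completed σ₁ d F z = d.omega * conj (completed σ₁ d F (σ₁ - conj z)) := by
      have h := mem_codiscreteWithin_iff_forall_mem_nhdsNE.1 hF.functional_equation ρ
        (Set.mem_univ ρ)
      filter_upwards [h] with z hz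
      rcases hz with hz | hz
      · exact hz
      · exact absurd (Set.mem_univ z) hz
    have c2 : ContinuousAt (fun z => d.omega * conj (completed σ₁ d F (σ₁ - conj z))) ρ := by
      refine continuousAt_const.mul (Complex.continuous_conj.continuousAt.comp ?_)
      refine ContinuousAt.comp (g := completed σ₁ d F)
        (analyticAt_completed hF (hX _ h')).continuousAt ?_
      exact continuousAt_const.sub Complex.continuous_conj.continuousAt
    have t2 := c2.tendsto.mono_left (nhdsWithin_le_nhds (s := {ρ}ᶜ))
    have h0 := tendsto_nhds_unique t2 (ht.congr' hev)
    have hω : d.omega ≠ 0 := norm_ne_zero_iff.1 (by rw [hF.norm_omega]; exact one_ne_zero)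
    have := (mul_eq_zero.1 h0).resolve_left hω
    rw [map_eq_zero] at this
    exact completed_ne_zero hF (hX0.trans_lt h') (hX _ h') this
  rw [abs_le]
  constructor <;> linarith [le_abs_self X, neg_abs_le σ₁, le_abs_self σ₁, abs_nonneg σ₁]

lemma meromorphicOrderAt_completed_ne_top (hF : IsSharpFlat σ₀ σ₁ F d) (s : ℂ) :
    meromorphicOrderAt (completed σ₁ d F) s ≠ ⊤ := by
  obtain ⟨X, hX0, hX⟩ := exists_forall_lt_re_regular hF
  refine (meromorphic_completed hF).exists_meromorphicOrderAt_ne_top_iff_forall.1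
    ⟨((X + 1 : ℝ) : ℂ), ?_⟩ s
  have hre : X < ((X + 1 : ℝ) : ℂ).re := by rw [Complex.ofReal_re]; linarith
  have ha := analyticAt_completed hF (hX _ hre)
  rw [ha.meromorphicOrderAt_eq,
    ha.analyticOrderAt_eq_zero.2 (completed_ne_zero hF (hX0.trans_lt hre) (hX _ hre))]
  simp

lemma mem_nontrivialZeros_iff (hF : IsSharpFlat σ₀ σ₁ F d) {ρ : ℂ} :
    ρ ∈ nontrivialZeros σ₁ d F ↔ zeroMultiplicity σ₁ d F ρ ≠ 0 := by
  have h := meromorphicOrderAt_completed_ne_top hF ρ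
  unfold nontrivialZeros zeroMultiplicity
  rw [Set.mem_ofPred_eq]
  cases h' : meromorphicOrderAt (completed σ₁ d F) ρ with
  | top => exact absurd h' h
  | coe n =>
    simp only [WithTop.coe_pos, WithTop.untop₀_coe]
    omega

lemma finite_zerosUpTo (hF : IsSharpFlat σ₀ σ₁ F d) (T : ℝ) : (zerosUpTo σ₁ d F T).Finite := by
  obtain ⟨X, hX⟩ := exists_abs_re_le_of_mem_nontrivialZeros hF
  set K : Set ℂ := Set.Icc (-X) X ×ℂ Set.Icc (-T) T with hK
  have hKc : IsCompact K := isCompact_Icc.reProdIm isCompact_Icc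
  have hm : MeromorphicOn (completed σ₁ d F) K := fun s _ => meromorphic_completed hF s
  refine ((MeromorphicOn.divisor (completed σ₁ d F) K).finiteSupport hKc).subset fun ρ hρ => ?_
  have hρK : ρ ∈ K := Complex.mem_reProdIm.2 ⟨abs_le.1 (hX ρ hρ.1), abs_le.1 hρ.2⟩
  rw [Function.mem_support, MeromorphicOn.divisor_apply hm hρK]
  have h1 : 0 < meromorphicOrderAt (completed σ₁ d F) ρ := hρ.1
  intro h
  rcases WithTop.untop₀_eq_zero.1 h with h | h
  · exact h1.ne' h
  · exact meromorphicOrderAt_completed_ne_top hF ρ h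

lemma IsHeight.divisor_eq (hF : IsSharpFlat σ₀ σ₁ F d) {H : ℝ} (hH : IsHeight σ₁ d H) {U : Set ℂ}
    {ρ : ℂ} (hρU : ρ ∈ U) (hρ : H ≤ |ρ.im|) :
    MeromorphicOn.divisor (completed σ₁ d F) U ρ = zeroMultiplicity σ₁ d F ρ := by
  have ha := analyticAt_completed hF (hH.regular hρ)
  rw [MeromorphicOn.divisor_apply (fun s _ => meromorphic_completed hF s) hρU, zeroMultiplicity,
    ha.meromorphicOrderAt_eq, untop₀_map_natCast]
  simp

lemma IsHeight.zeroMultiplicity_eq (hF : IsSharpFlat σ₀ σ₁ F d) {H : ℝ} (hH : IsHeight σ₁ d H)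
    {ρ : ℂ} (hρ : H ≤ |ρ.im|) : zeroMultiplicity σ₁ d F ρ = analyticOrderNatAt F ρ := by
  have hr := hH.regular hρ
  have : completed σ₁ d F = cofactor σ₁ d F * F := funext fun s => by
    rw [completed_eq, mul_comm]; rfl
  rw [zeroMultiplicity, this, meromorphicOrderAt_mul_of_ne_zero (analyticAt_cofactor hF hr)
    (cofactor_ne_zero hF hr), (analyticAt_of_notMem_poles hF hr.notMem_poles).meromorphicOrderAt_eq,
    untop₀_map_natCast, analyticOrderNatAt]
  simp

lemma IsHeight.eq_zero_of_zeroMultiplicity_ne_zero (hF : IsSharpFlat σ₀ σ₁ F d) {H : ℝ}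
    (hH : IsHeight σ₁ d H) {ρ : ℂ} (hρ : H ≤ |ρ.im|) (h : zeroMultiplicity σ₁ d F ρ ≠ 0) :
    F ρ = 0 := by
  rw [hH.zeroMultiplicity_eq hF hρ] at h
  by_contra h0
  apply h
  rw [analyticOrderNatAt, (analyticAt_of_notMem_poles hF
    (hH.regular hρ).notMem_poles).analyticOrderAt_eq_zero.2 h0]
  simp

end

/-! ### Polynomial growth -/

/-- On `S`, the function `f` is bounded by `g` up to a factor of polynomial growth. -/
def PolyLE (S : Set ℂ) (f g : ℂ → ℂ) : Prop :=
  ∃ (C : ℝ) (N : ℕ), 0 ≤ C ∧ ∀ s ∈ S, ‖f s‖ ≤ C * (1 + ‖s‖) ^ N * ‖g s‖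

lemma PolyLE.mul {S : Set ℂ} {f g f' g' : ℂ → ℂ} (h : PolyLE S f g) (h' : PolyLE S f' g') :
    PolyLE S (fun s => f s * f' s) (fun s => g s * g' s) := by
  obtain ⟨C, N, hC, h⟩ := h
  obtain ⟨C', N', hC', h'⟩ := h'
  refine ⟨C * C', N + N', by positivity, fun s hs => ?_⟩
  rw [norm_mul, norm_mul]
  calc ‖f s‖ * ‖f' s‖ ≤ (C * (1 + ‖s‖) ^ N * ‖g s‖) * (C' * (1 + ‖s‖) ^ N' * ‖g' s‖) :=
        mul_le_mul (h s hs) (h' s hs) (norm_nonneg _) (by positivity)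
    _ = _ := by rw [pow_add]; ring

lemma PolyLE.prod {S : Set ℂ} {ι : Type*} (t : Finset ι) {f g : ι → ℂ → ℂ}
    (h : ∀ i ∈ t, PolyLE S (f i) (g i)) :
    PolyLE S (fun s => ∏ i ∈ t, f i s) (fun s => ∏ i ∈ t, g i s) := by
  classical
  induction t using Finset.induction_on with
  | empty => exact ⟨1, 0, zero_le_one, fun s _ => by simp⟩
  | insert i t hi ih =>
    simp only [Finset.prod_insert hi]
    exact (h i (Finset.mem_insert_self _ _)).mul
      (ih fun j hj => h j (Finset.mem_insert_of_mem hj))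

lemma PolyLE.pow {S : Set ℂ} {f g : ℂ → ℂ} (h : PolyLE S f g) (n : ℕ) :
    PolyLE S (fun s => f s ^ n) (fun s => g s ^ n) := by
  simpa using PolyLE.prod (Finset.range n) (f := fun _ => f) (g := fun _ => g) fun _ _ => h

lemma PolyLE.of_union {S S' : Set ℂ} {f g : ℂ → ℂ} (h : PolyLE S f g) (h' : PolyLE S' f g) :
    PolyLE (S ∪ S') f g := by
  obtain ⟨C, N, hC, h⟩ := h
  obtain ⟨C', N', hC', h'⟩ := h'
  refine ⟨C + C', N + N', by positivity, fun s hs => ?_⟩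
  have h1 : 1 ≤ 1 + ‖s‖ := by linarith [norm_nonneg s]
  rcases hs with hs | hs
  · refine (h s hs).trans ?_
    gcongr
    · linarith
    · omega
  · refine (h' s hs).trans ?_
    gcongr
    · linarith
    · omega

lemma PolyLE.mono {S S' : Set ℂ} {f g : ℂ → ℂ} (h : PolyLE S f g) (hS : S' ⊆ S) :
    PolyLE S' f g := by
  obtain ⟨C, N, hC, h⟩ := h
  exact ⟨C, N, hC, fun s hs => h s (hS hs)⟩

lemma polyLE_of_le {S : Set ℂ} {f g : ℂ → ℂ} {B : ℝ} (hB : 0 ≤ B)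
    (hf : ∀ s ∈ S, ‖f s‖ ≤ ‖s‖ + B) (hg : ∀ s ∈ S, 1 ≤ ‖g s‖) : PolyLE S f g := by
  refine ⟨1 + B, 1, by positivity, fun s hs => (hf s hs).trans ?_⟩
  calc ‖s‖ + B ≤ (1 + B) * (1 + ‖s‖) ^ 1 * 1 := by nlinarith [norm_nonneg s]
    _ ≤ _ := by gcongr; exact hg s hs

section

variable {σ₀ σ₁ : ℝ} {F : ℂ → ℂ} {d : CompletionData}

/-- The growth of `ξ_F / F` at `s` and at `φ s` is the same up to a polynomial factor. Both
`φ s = conj s` and, on a vertical line, `φ s = σ₁ - conj s` are covered, since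
`|Γ(conj z)| = |Γ(z)|` turns them into translations of the arguments of the Gamma factors. -/
lemma IsHeight.polyLE_cofactor (hF : IsSharpFlat σ₀ σ₁ F d) {H : ℝ} (hH : IsHeight σ₁ d H)
    {S : Set ℂ} {X B : ℝ} {φ : ℂ → ℂ} (hB : 0 ≤ B) (hS : ∀ s ∈ S, -X ≤ s.re ∧ H ≤ |s.im|)
    (hφ : ∀ s ∈ S, ‖φ s‖ ≤ ‖s‖ + B) (hre : ∀ s ∈ S, (φ s).re ≤ s.re + B ∧ s.re - B ≤ (φ s).re)
    (a : Fin d.r → ℂ) (ha : ∀ j, |(a j).im| ≤ 2 * |(d.mu j).im|)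
    (hΓ : ∀ j, ∀ s ∈ S, ‖Complex.Gamma (d.lam j * φ s + d.mu j)‖ =
      ‖Complex.Gamma (d.lam j * s + d.mu j + a j)‖) :
    PolyLE S (fun s => cofactor σ₁ d F (φ s)) (cofactor σ₁ d F) := by
  unfold cofactor
  refine ((PolyLE.mul ?_ ?_).mul ?_).mul ?_
  · have hQ := hF.Q_pos
    refine ⟨d.Q ^ B + d.Q ^ (-B), 0, by positivity, fun s hs => ?_⟩
    rw [Complex.norm_cpow_eq_rpow_re_of_pos hQ, Complex.norm_cpow_eq_rpow_re_of_pos hQ, pow_zero,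
      mul_one, add_mul, ← Real.rpow_add hQ, ← Real.rpow_add hQ]
    obtain ⟨h1, h2⟩ := hre s hs
    rcases le_total 1 d.Q with h | h
    · have := Real.rpow_le_rpow_of_exponent_le h (show (φ s).re ≤ B + s.re by linarith)
      have : 0 ≤ d.Q ^ (-B + s.re) := by positivity
      linarith
    · have := Real.rpow_le_rpow_of_exponent_ge hQ h (show -B + s.re ≤ (φ s).re by linarith)
      have : 0 ≤ d.Q ^ (B + s.re) := by positivity
      linarith
  · refine PolyLE.prod _ fun j _ => ?_
    obtain ⟨C, hC, N, h⟩ := exists_norm_Gamma_add_le (d.lam j * X + |(d.mu j).re|) (a j)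
    have hl := hF.lam_pos j
    refine ⟨C * (1 + d.lam j + ‖d.mu j‖) ^ N, N, by positivity, fun s hs => ?_⟩
    rw [hΓ j s hs]
    refine (h _ ?_ ?_).trans ?_
    · simp only [Complex.add_re, Complex.re_ofReal_mul]
      have := (hS s hs).1
      nlinarith [neg_abs_le (d.mu j).re]
    · exact (add_le_add_right (ha j) 1).trans ((hH.2 s (hS s hs).2).2 j)
    · have h1 : ‖(d.lam j : ℂ) * s + d.mu j‖ ≤ d.lam j * ‖s‖ + ‖d.mu j‖ := by
        refine (norm_add_le _ _).trans ?_
        rw [norm_mul, Complex.norm_real, Real.norm_of_nonneg hl.le]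
      have h2 : C * (1 + d.lam j + ‖d.mu j‖) ^ N * (1 + ‖s‖) ^ N =
          C * ((1 + d.lam j + ‖d.mu j‖) * (1 + ‖s‖)) ^ N := by rw [mul_pow]; ring
      rw [h2]
      gcongr
      nlinarith [norm_nonneg s, norm_nonneg (d.mu j)]
  · refine PolyLE.prod _ fun w hw => PolyLE.pow ?_ _
    refine polyLE_of_le (B := B + ‖w‖) (by positivity) (fun s hs => ?_) fun s hs =>
      ((hH.2 s (hS s hs).2).1 w (hF.paired_subset hw)).1
    have := norm_sub_le (φ s) w
    linarith [hφ s hs]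
  · refine PolyLE.prod _ fun w hw => (PolyLE.pow ?_ _).mul (PolyLE.pow ?_ _)
    · refine polyLE_of_le (B := B + ‖w‖) (by positivity) (fun s hs => ?_) fun s hs =>
        ((hH.2 s (hS s hs).2).1 w (Finset.mem_sdiff.1 hw).1).1
      have := norm_sub_le (φ s) w
      linarith [hφ s hs]
    · refine polyLE_of_le (B := B + ‖w‖ + |σ₁|) (by positivity) (fun s hs => ?_) fun s hs =>
        ((hH.2 s (hS s hs).2).1 w (Finset.mem_sdiff.1 hw).1).2
      have h1 := norm_sub_le ((σ₁ : ℂ) - φ s) (conj w)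
      have h2 := norm_sub_le (σ₁ : ℂ) (φ s)
      rw [RCLike.norm_conj] at h1
      rw [Complex.norm_real, Real.norm_eq_abs] at h2
      linarith [hφ s hs]

lemma IsHeight.polyLE_cofactor_conj (hF : IsSharpFlat σ₀ σ₁ F d) {H : ℝ} (hH : IsHeight σ₁ d H)
    (X : ℝ) : PolyLE {s | -X ≤ s.re ∧ H ≤ |s.im|} (fun s => cofactor σ₁ d F (conj s))
      (cofactor σ₁ d F) := by
  refine hH.polyLE_cofactor hF (X := X) (B := 0) le_rfl (fun s hs => hs) (fun s _ => by simp)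
    (fun s _ => by simp) (fun j => conj (d.mu j) - d.mu j) (fun j => ?_) fun j s _ => ?_
  · simp only [Complex.sub_im, Complex.conj_im]
    rw [show -(d.mu j).im - (d.mu j).im = (-2) * (d.mu j).im by ring, abs_mul]
    norm_num
  · rw [← RCLike.norm_conj, ← Complex.Gamma_conj]
    congr 2
    simp

lemma IsHeight.polyLE_cofactor_reflect (hF : IsSharpFlat σ₀ σ₁ F d) {H : ℝ} (hH : IsHeight σ₁ d H)
    (b : ℝ) : PolyLE {s | s.re = b ∧ H ≤ |s.im|} (fun s => cofactor σ₁ d F (σ₁ - conj s))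
      (cofactor σ₁ d F) := by
  refine hH.polyLE_cofactor hF (X := -b) (B := |σ₁| + 2 * |b|) (by positivity)
    (fun s hs => ⟨by rw [hs.1, neg_neg], hs.2⟩)
    (fun s _ => ?_) (fun s hs => ?_) (fun j => (d.lam j * (σ₁ - 2 * b) : ℝ)) (fun j => ?_)
    fun j s hs => ?_
  · have := norm_sub_le (σ₁ : ℂ) (conj s)
    rw [RCLike.norm_conj, Complex.norm_real, Real.norm_eq_abs] at this
    linarith [abs_nonneg b]
  · simp only [Complex.sub_re, Complex.ofReal_re, Complex.conj_re, hs.1]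
    constructor <;> linarith [le_abs_self b, neg_abs_le b, le_abs_self σ₁, neg_abs_le σ₁]
  · simp
  · have h1 : conj s = 2 * b - s := by
      rw [← hs.1]
      apply Complex.ext <;> simp
      ring
    rw [h1]
    congr 2
    push_cast
    ring

lemma exists_abs_log_norm_le_of_isSharpFlat (hF : IsSharpFlat σ₀ σ₁ F d) :
    ∃ K : ℝ, 0 ≤ K ∧ ∀ s : ℂ, σ₀ + 1 ≤ s.re → |Real.log ‖F s‖| ≤ K := by
  obtain ⟨a, ha⟩ := hF.dirichlet
  obtain ⟨c, hc1, hc⟩ := hF.euler_sum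
  exact exists_abs_log_norm_le hc1 (fun s hs => ha s (by linarith))
    (fun s hs => (analyticAt_of_notMem_poles hF
      (notMem_poles_of_lt_re hF (by linarith))).differentiableAt)
    (fun s hs => (hc s (by linarith)).1) (fun s hs => (hc s (by linarith)).2)

/-- A function of finite order satisfies the growth hypothesis of the Phragmén–Lindelöf principle
in every vertical strip. -/
lemma FiniteOrder.isBigO_strip {g : ℂ → ℂ} (hg : FiniteOrder g) {a b c : ℝ} (hc : 0 < c) :
    g =O[comap (_root_.abs ∘ Complex.im) atTop ⊓ 𝓟 (Complex.re ⁻¹' Set.Ioo a b)]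
      fun z ↦ Real.exp (1 * Real.exp (c * |z.im|)) := by
  obtain ⟨k, hk⟩ := hg
  set l := comap (_root_.abs ∘ Complex.im) atTop ⊓ 𝓟 (Complex.re ⁻¹' Set.Ioo a b)
  have him : Tendsto (fun z : ℂ => |z.im|) l atTop := tendsto_comap.mono_left inf_le_left
  have hre : ∀ᶠ z in l, z.re ∈ Set.Ioo a b := mem_inf_of_right (mem_principal_self _)
  have hl : l ≤ cocompact ℂ := by
    rw [← Metric.cobounded_eq_cocompact, ← comap_norm_atTop, ← tendsto_iff_comap]
    exact tendsto_atTop_mono (fun z => Complex.abs_im_le_norm z) him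
  refine (hk.mono hl).trans (Asymptotics.IsBigO.of_bound 1 ?_)
  set X := |a| + |b| with hX
  have hlit := (isLittleO_rpow_exp_pos_mul_atTop (max k 0) hc).bound
    (Real.exp_pos (-(c * X)))
  have hshift : Tendsto (fun z : ℂ => |z.im| + X) l atTop :=
    tendsto_atTop_add_const_right _ _ him
  filter_upwards [hshift.eventually hlit, hre, him.eventually_ge_atTop 1] with z h1 h2 h3
  rw [Real.norm_of_nonneg (Real.exp_pos _).le, Real.norm_of_nonneg (Real.exp_pos _).le, one_mul,
    one_mul, Real.exp_le_exp]
  have hX0 : 0 ≤ X := by positivity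
  have hz1 : 1 ≤ ‖z‖ := h3.trans (Complex.abs_im_le_norm z)
  have hz2 : ‖z‖ ≤ |z.im| + X := by
    have := Complex.norm_le_abs_re_add_abs_im z
    have hzre : |z.re| ≤ X := by
      rw [abs_le, hX]
      constructor <;> linarith [h2.1, h2.2, neg_abs_le a, le_abs_self b, abs_nonneg a, abs_nonneg b]
    linarith
  rw [Real.norm_of_nonneg (by positivity), Real.norm_of_nonneg (Real.exp_pos _).le,
    ← Real.exp_add] at h1
  calc ‖z‖ ^ k ≤ ‖z‖ ^ (max k 0) := Real.rpow_le_rpow_of_exponent_le hz1 (le_max_left _ _)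
    _ ≤ (|z.im| + X) ^ (max k 0) :=
        Real.rpow_le_rpow (norm_nonneg _) hz2 (le_max_right _ _)
    _ ≤ _ := h1
    _ = _ := by congr 1; ring

/-- `F` has polynomial growth in half-planes: it is bounded to the right, the functional equation
transfers this to a line to the left, and the Phragmén–Lindelöf principle covers the strip between
them. -/
lemma IsHeight.polyLE_one (hF : IsSharpFlat σ₀ σ₁ F d) {H : ℝ} (hH : IsHeight σ₁ d H) (X : ℝ) :
    PolyLE {s | -X ≤ s.re ∧ H ≤ |s.im|} F 1 := by
  obtain ⟨K, hK, hlog⟩ := exists_abs_log_norm_le_of_isSharpFlat hF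
  have hright : ∀ s : ℂ, σ₀ + 1 ≤ s.re → ‖F s‖ ≤ Real.exp K := by
    intro s hs
    have h0 := norm_pos_iff.2 (ne_zero_of_lt_re hF (s := s) (by linarith))
    rw [← Real.log_le_iff_le_exp h0]
    exact (le_abs_self _).trans (hlog s hs)
  obtain ⟨b, hb⟩ : ∃ b : ℝ, b = min (-X) (min (σ₁ - (σ₀ + 1)) (σ₀ + 1)) - 1 := ⟨_, rfl⟩
  set A := σ₀ + 1
  have hbX : b ≤ -X := by rw [hb]; linarith [min_le_left (-X) (min (σ₁ - A) A)]
  have hbA : b < A := by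
    rw [hb]; linarith [min_le_right (-X) (min (σ₁ - A) A), min_le_right (σ₁ - A) A]
  have hbσ : A ≤ σ₁ - b := by
    rw [hb]; linarith [min_le_right (-X) (min (σ₁ - A) A), min_le_left (σ₁ - A) A]
  -- on the left edge, by the functional equation
  have hleft : PolyLE {s | s.re = b ∧ H ≤ |s.im|} F 1 := by
    obtain ⟨C, N, hC, h⟩ := hH.polyLE_cofactor_reflect hF b
    refine ⟨Real.exp K * C, N, by positivity, fun s hs => ?_⟩
    have hfe := hH.functional_equation hF hs.2
    rw [completed_eq, completed_eq, norm_mul, norm_mul] at hfe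
    have hG := norm_pos_iff.2 (cofactor_ne_zero hF (hH.regular hs.2))
    rw [Pi.one_apply, norm_one, mul_one, ← mul_le_mul_iff_left₀ hG, ← hfe]
    calc ‖F (σ₁ - conj s)‖ * ‖cofactor σ₁ d F (σ₁ - conj s)‖
        ≤ Real.exp K * (C * (1 + ‖s‖) ^ N * ‖cofactor σ₁ d F s‖) := by
          refine mul_le_mul (hright _ ?_) (h s hs) (norm_nonneg _) (Real.exp_pos _).le
          simp [hs.1]; linarith
      _ = _ := by ring
  have hA : PolyLE {s | A ≤ s.re} F 1 :=
    ⟨Real.exp K, 0, (Real.exp_pos _).le, fun s hs => by simpa using hright s hs⟩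
  obtain ⟨g, hg, hgord, hgF⟩ := hF.continuation
  set p : ℂ → ℂ := fun s => ∏ w ∈ d.poles, (s - w) ^ poleOrder F w with hp
  have hp1 : PolyLE Set.univ p 1 := by
    have h0 := PolyLE.prod (S := Set.univ) d.poles (f := fun w s => (s - w) ^ poleOrder F w)
      (g := fun w s => (1 : ℂ) ^ poleOrder F w) fun w _ => PolyLE.pow
        (polyLE_of_le (B := ‖w‖) (norm_nonneg w) (fun s _ => norm_sub_le s w) (by simp)) _
    simpa [Pi.one_def] using h0
  -- on both edges of the strip
  have hedge : PolyLE ({s | s.re = b} ∪ {s | s.re = A}) g 1 := by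
    have hhigh : ∀ {S : Set ℂ}, PolyLE S F 1 → (∀ s ∈ S, H ≤ |s.im|) → PolyLE S g 1 := by
      intro S h hS
      have h1 := (hp1.mono (Set.subset_univ S)).mul h
      obtain ⟨C, N, hC, h1⟩ := h1
      refine ⟨C, N, hC, fun s hs => ?_⟩
      rw [hgF s (hH.regular (hS s hs)).notMem_poles]
      simpa [hp] using h1 s hs
    have hlow : ∀ e : ℝ, PolyLE {s | s.re = e ∧ |s.im| ≤ H} g 1 := by
      intro e
      have hc : IsCompact (({e} : Set ℝ) ×ℂ Set.Icc (-H) H) :=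
        isCompact_singleton.reProdIm isCompact_Icc
      obtain ⟨C, hC⟩ := hc.exists_bound_of_continuousOn hg.continuous.continuousOn
      refine ⟨|C|, 0, abs_nonneg C, fun s hs => ?_⟩
      simpa using (hC s (Complex.mem_reProdIm.2 ⟨hs.1, abs_le.1 hs.2⟩)).trans (le_abs_self C)
    refine (((hhigh hleft fun s hs => hs.2).of_union (hlow b)).of_union
      ((hhigh (hA.mono (S' := {s | s.re = A ∧ H ≤ |s.im|}) fun s hs => hs.1.ge)
        fun s hs => hs.2).of_union (hlow A))).mono ?_
    rintro s (hs | hs)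
    · exact Or.inl ((le_total H |s.im|).imp (fun h => ⟨hs, h⟩) fun h => ⟨hs, h⟩)
    · exact Or.inr ((le_total H |s.im|).imp (fun h => ⟨hs, h⟩) fun h => ⟨hs, h⟩)
  obtain ⟨C, N, hC, hgC⟩ := hedge
  -- dividing by a power of `s - s₁`, with `s₁` to the left of the strip
  set s₁ : ℂ := ((b - 1 : ℝ) : ℂ) with hs₁
  have hdist : ∀ s : ℂ, b ≤ s.re → 1 ≤ ‖s - s₁‖ := by
    intro s hs
    refine le_trans ?_ ((le_abs_self _).trans (Complex.abs_re_le_norm _))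
    simp only [hs₁, Complex.sub_re, Complex.ofReal_re]; linarith
  have hcmp : ∀ s : ℂ, b ≤ s.re → 1 + ‖s‖ ≤ (2 + ‖s₁‖) * ‖s - s₁‖ := by
    intro s hs
    have h1 := hdist s hs
    have h2 := norm_add_le (s - s₁) s₁
    rw [sub_add_cancel] at h2
    nlinarith [norm_nonneg s₁]
  have hstrip : ∀ s : ℂ, b ≤ s.re → s.re ≤ A →
      ‖g s / (s - s₁) ^ N‖ ≤ C * (2 + ‖s₁‖) ^ N := by
    have hedge' : ∀ s : ℂ, s ∈ ({s | s.re = b} ∪ {s | s.re = A} : Set ℂ) → b ≤ s.re →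
        ‖g s / (s - s₁) ^ N‖ ≤ C * (2 + ‖s₁‖) ^ N := by
      intro s hs hbs
      have h1 := hgC s hs
      have h2 := hdist s hbs
      rw [norm_div, norm_pow, div_le_iff₀ (by positivity), mul_assoc, ← mul_pow]
      rw [Pi.one_apply, norm_one, mul_one] at h1
      refine h1.trans ?_
      gcongr
      exact hcmp s hbs
    intro s hs1 hs2
    have hpi : 0 < Real.pi / (A - b) := div_pos Real.pi_pos (by linarith)
    have hne : ∀ s : ℂ, b ≤ s.re → (s - s₁) ^ N ≠ 0 := fun s hs =>
      pow_ne_zero _ (norm_pos_iff.1 (zero_lt_one.trans_le (hdist s hs)))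
    refine PhragmenLindelof.vertical_strip (f := fun s => g s / (s - s₁) ^ N) (a := b) (b := A) ?_
      ⟨Real.pi / (A - b) / 2, by linarith, 1, ?_⟩ (fun z hz => hedge' z (Or.inl hz) hz.ge)
      (fun z hz => hedge' z (Or.inr hz) (hbA.le.trans hz.ge)) hs1 hs2
    · refine DifferentiableOn.diffContOnCl fun z hz => ?_
      have hz' : b ≤ z.re := by
        have : closure (Complex.re ⁻¹' Set.Ioo b A) ⊆ {z : ℂ | b ≤ z.re} :=
          closure_minimal (fun z hz => hz.1.le) (isClosed_le continuous_const Complex.continuous_re)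
        exact this hz
      exact ((hg z).fun_div (by fun_prop) (hne z hz')).differentiableWithinAt
    · refine Asymptotics.IsBigO.trans (Asymptotics.IsBigO.of_bound 1 ?_)
        (hgord.isBigO_strip (by positivity))
      filter_upwards [mem_inf_of_right (mem_principal_self _)] with z hz
      rw [norm_div, norm_pow, one_mul]
      exact div_le_self (norm_nonneg _) (one_le_pow₀ (hdist z hz.1.le))
  have hmid : PolyLE {s | (b ≤ s.re ∧ s.re ≤ A) ∧ H ≤ |s.im|} F 1 := by
    refine ⟨C * (2 + ‖s₁‖) ^ N * (1 + ‖s₁‖) ^ N, N, by positivity, fun s hs => ?_⟩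
    have h1 := hstrip s hs.1.1 hs.1.2
    have h2 := hdist s hs.1.1
    rw [norm_div, norm_pow, div_le_iff₀ (by positivity),
      hgF s (hH.regular hs.2).notMem_poles, norm_mul] at h1
    have h3 : 1 ≤ ‖∏ w ∈ d.poles, (s - w) ^ poleOrder F w‖ := by
      rw [norm_prod]
      calc (1 : ℝ) = ∏ w ∈ d.poles, (1 : ℝ) := by simp
        _ ≤ _ := Finset.prod_le_prod (fun _ _ => zero_le_one) fun w hw => by
          rw [norm_pow]; exact one_le_pow₀ ((hH.2 s hs.2).1 w hw).1
    have h4 : ‖s - s₁‖ ≤ (1 + ‖s₁‖) * (1 + ‖s‖) := by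
      have := norm_sub_le s s₁
      nlinarith [norm_nonneg s, norm_nonneg s₁]
    rw [Pi.one_apply, norm_one, mul_one]
    calc ‖F s‖ ≤ ‖∏ w ∈ d.poles, (s - w) ^ poleOrder F w‖ * ‖F s‖ :=
          le_mul_of_one_le_left (norm_nonneg _) h3
      _ ≤ _ := h1
      _ ≤ C * (2 + ‖s₁‖) ^ N * ((1 + ‖s₁‖) * (1 + ‖s‖)) ^ N := by gcongr
      _ = _ := by rw [mul_pow]; ring
  refine (hmid.of_union hA).mono fun s hs => ?_
  rcases le_total s.re A with h | h
  · exact Or.inl ⟨⟨hbX.trans hs.1, h⟩, hs.2⟩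
  · exact Or.inr h

end

/-! ### Counting points with multiplicities -/

/-- The number of points of `E`, counted with the multiplicities `m`. -/
noncomputable def massOn (m : ℂ → ℕ) (E : Set ℂ) : ℝ := ∑ᶠ ρ ∈ E, (m ρ : ℝ)

section

variable {m : ℂ → ℕ}

lemma massOn_eq_sum {E : Set ℂ} {S : Finset ℂ} (h1 : ∀ ρ ∈ E, m ρ ≠ 0 → ρ ∈ S)
    (h2 : ∀ ρ ∈ S, ρ ∈ E) : massOn m E = ∑ ρ ∈ S, (m ρ : ℝ) := by
  refine finsum_mem_eq_sum_of_inter_support_eq _ ?_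
  ext ρ
  simp only [Set.mem_inter_iff, Function.mem_support, ne_eq, Nat.cast_eq_zero, SetLike.mem_coe]
  exact ⟨fun h => ⟨h1 ρ h.1 h.2, h.2⟩, fun h => ⟨h2 ρ h.1, h.2⟩⟩

lemma massOn_nonneg (E : Set ℂ) : 0 ≤ massOn m E :=
  finsum_nonneg fun _ => finsum_nonneg fun _ => Nat.cast_nonneg _

lemma massOn_le_sum {E : Set ℂ} {S : Finset ℂ} (h1 : ∀ ρ ∈ E, m ρ ≠ 0 → ρ ∈ S) :
    massOn m E ≤ ∑ ρ ∈ S, (m ρ : ℝ) := by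
  classical
  rw [massOn_eq_sum (S := S.filter (· ∈ E)) (fun ρ h h' => Finset.mem_filter.2 ⟨h1 ρ h h', h⟩)
    fun ρ h => (Finset.mem_filter.1 h).2]
  exact Finset.sum_le_sum_of_subset_of_nonneg (Finset.filter_subset _ _)
    fun _ _ _ => Nat.cast_nonneg _

lemma massOn_mono {E E' : Set ℂ} (hfin : {ρ | ρ ∈ E' ∧ m ρ ≠ 0}.Finite)
    (h : ∀ ρ ∈ E, m ρ ≠ 0 → ρ ∈ E') : massOn m E ≤ massOn m E' := by
  rw [massOn_eq_sum (E := E') (S := hfin.toFinset) (fun ρ h1 h2 => by simp [h1, h2])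
    fun ρ h => by simp at h; exact h.1]
  exact massOn_le_sum fun ρ h1 h2 => by simp [h ρ h1 h2, h2]

lemma massOn_le_add {E E₁ E₂ : Set ℂ} (hfin₁ : {ρ | ρ ∈ E₁ ∧ m ρ ≠ 0}.Finite)
    (hfin₂ : {ρ | ρ ∈ E₂ ∧ m ρ ≠ 0}.Finite) (h : ∀ ρ ∈ E, m ρ ≠ 0 → ρ ∈ E₁ ∨ ρ ∈ E₂) :
    massOn m E ≤ massOn m E₁ + massOn m E₂ := by
  classical
  rw [massOn_eq_sum (E := E₁) (S := hfin₁.toFinset) (fun ρ h1 h2 => by simp [h1, h2])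
    fun ρ h => by simp at h; exact h.1, massOn_eq_sum (E := E₂) (S := hfin₂.toFinset)
    (fun ρ h1 h2 => by simp [h1, h2]) fun ρ h => by simp at h; exact h.1]
  have h1 : massOn m E ≤ ∑ ρ ∈ hfin₁.toFinset ∪ hfin₂.toFinset, (m ρ : ℝ) :=
    massOn_le_sum fun ρ h1 h2 => by simpa [h2] using h ρ h1 h2
  refine h1.trans ?_
  rw [← Finset.sum_union_inter]
  exact le_add_of_nonneg_right (Finset.sum_nonneg fun _ _ => Nat.cast_nonneg _)

/-- The multiplicities `m` are those of a set of points which is finite in every horizontal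
strip. -/
def FiniteInStrips (m : ℂ → ℕ) : Prop := ∀ T : ℝ, {ρ : ℂ | m ρ ≠ 0 ∧ |ρ.im| ≤ T}.Finite

lemma FiniteInStrips.finite (hm : FiniteInStrips m) {E : Set ℂ} (T : ℝ)
    (hE : ∀ ρ ∈ E, |ρ.im| ≤ T) : {ρ | ρ ∈ E ∧ m ρ ≠ 0}.Finite :=
  (hm T).subset fun ρ hρ => ⟨hρ.2, hE ρ hρ.1⟩

lemma FiniteInStrips.finite_Icc (hm : FiniteInStrips m) (a b : ℝ) :
    {ρ : ℂ | ρ ∈ {ρ : ℂ | a ≤ ρ.im ∧ ρ.im ≤ b} ∧ m ρ ≠ 0}.Finite :=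
  hm.finite (|a| + |b|) fun ρ hρ => by
    rw [abs_le]
    constructor <;>
      linarith [hρ.1, hρ.2, neg_abs_le a, le_abs_self b, abs_nonneg a, abs_nonneg b]

/-- The difference between the numbers of points with `0 < Im ρ ≤ T` and with
`-T ≤ Im ρ < 0`. -/
noncomputable def discrepancy (m : ℂ → ℕ) (T : ℝ) : ℝ :=
  massOn m {ρ | 0 < ρ.im ∧ ρ.im ≤ T} - massOn m {ρ | -T ≤ ρ.im ∧ ρ.im < 0}

lemma FiniteInStrips.discrepancy_eq (hm : FiniteInStrips m) {t T : ℝ} (ht : t ≤ T) :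
    discrepancy m t = ∑ ρ ∈ (hm T).toFinset,
      (m ρ : ℝ) * (SignType.sign ρ.im : ℝ) * if |ρ.im| ≤ t then 1 else 0 := by
  classical
  set Z := (hm T).toFinset with hZ
  have hmem : ∀ ρ : ℂ, ρ ∈ Z ↔ m ρ ≠ 0 ∧ |ρ.im| ≤ T := by simp [hZ]
  rw [discrepancy, massOn_eq_sum (S := Z.filter (fun ρ => 0 < ρ.im ∧ ρ.im ≤ t)),
    massOn_eq_sum (S := Z.filter (fun ρ => -t ≤ ρ.im ∧ ρ.im < 0)), Finset.sum_filter,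
    Finset.sum_filter, ← Finset.sum_sub_distrib]
  · refine Finset.sum_congr rfl fun ρ _ => ?_
    rcases lt_trichotomy ρ.im 0 with h | h | h
    · simp only [h, not_lt.2 h.le, sign_neg, abs_of_neg, neg_le]
      by_cases h' : -t ≤ ρ.im <;> simp [h']
    · simp [h]
    · simp only [h, not_lt.2 h.le, sign_pos, abs_of_pos]
      simp
  · intro ρ h h0
    rw [Finset.mem_filter, hmem]
    exact ⟨⟨h0, by rw [abs_of_neg h.2]; linarith [h.1]⟩, h⟩
  · exact fun ρ h => (Finset.mem_filter.1 h).2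
  · intro ρ h h0
    rw [Finset.mem_filter, hmem]
    exact ⟨⟨h0, by rw [abs_of_pos h.1]; linarith [h.2]⟩, h⟩
  · exact fun ρ h => (Finset.mem_filter.1 h).2

/-- If every horizontal strip of height one contains `O(log)` points, then `∑ (1 + |Im ρ|)⁻²`
converges. -/
lemma FiniteInStrips.summable_inv_sq (hm : FiniteInStrips m) {C : ℝ}
    (hwin : ∀ a : ℝ, massOn m {ρ | a ≤ ρ.im ∧ ρ.im ≤ a + 1} ≤ C * Real.log (|a| + 2)) :
    Summable fun ρ : ℂ => (m ρ : ℝ) * ((1 + |ρ.im|) ^ 2)⁻¹ := by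
  classical
  have hC : 0 ≤ C := by
    have h1 := (massOn_nonneg _).trans (hwin 0)
    have : 0 < Real.log (|(0 : ℝ)| + 2) := Real.log_pos (by simp)
    exact nonneg_of_mul_nonneg_left h1 this
  -- a majorant for the contribution of `k ≤ |Im ρ| < k + 1`
  set B : ℕ → ℝ := fun k => 2 * C * 4 * ((k + 1 : ℝ) ^ (3 / 2 : ℝ))⁻¹ with hB
  have hBs : Summable B := by
    have h1 : Summable fun k : ℕ => ((k : ℝ) ^ (3 / 2 : ℝ))⁻¹ :=
      Real.summable_nat_rpow_inv.2 (by norm_num)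
    have h2 := ((summable_nat_add_iff 1).2 h1).mul_left (2 * C * 4)
    simpa [hB] using h2
  refine summable_of_sum_le (c := ∑' k, B k) (fun ρ => by positivity) fun s => ?_
  set κ : ℂ → ℕ := fun ρ => ⌊|ρ.im|⌋₊ with hκ
  have hfib : ∀ k : ℕ, ∑ ρ ∈ s with κ ρ = k, (m ρ : ℝ) * ((1 + |ρ.im|) ^ 2)⁻¹ ≤ B k := by
    intro k
    have hk : ∀ ρ ∈ s.filter (fun ρ => κ ρ = k), (k : ℝ) ≤ |ρ.im| ∧ |ρ.im| ≤ k + 1 := by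
      intro ρ hρ
      have h := (Finset.mem_filter.1 hρ).2
      exact ⟨h ▸ Nat.floor_le (abs_nonneg _), by
        rw [← h]; exact (Nat.lt_floor_add_one |ρ.im|).le⟩
    have h1 : ∑ ρ ∈ s with κ ρ = k, (m ρ : ℝ) ≤ 2 * (C * Real.log (k + 3)) := by
      have e1 : ∑ ρ ∈ s with κ ρ = k, (m ρ : ℝ) =
          massOn m ((s.filter (fun ρ => κ ρ = k) : Finset ℂ) : Set ℂ) :=
        (massOn_eq_sum (fun ρ h _ => h) fun ρ h => h).symm
      rw [e1]
      refine (massOn_le_add (hm.finite_Icc k (k + 1)) (hm.finite_Icc (-(k + 1)) (-(k + 1) + 1))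
        fun ρ h _ => ?_).trans ?_
      · obtain ⟨h2, h3⟩ := hk ρ h
        rcases abs_cases ρ.im with ⟨h4, -⟩ | ⟨h4, -⟩ <;> rw [h4] at h2 h3
        · exact Or.inl ⟨h2, h3⟩
        · exact Or.inr ⟨by linarith, by linarith⟩
      · have k0 : (0 : ℝ) ≤ k := Nat.cast_nonneg k
        have w1 := hwin k
        have w2 := hwin (-(k + 1))
        rw [abs_of_nonneg k0] at w1
        rw [abs_neg, abs_of_nonneg (by positivity), show (k : ℝ) + 1 + 2 = k + 3 by ring] at w2
        have : Real.log (k + 2) ≤ Real.log (k + 3) :=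
          Real.log_le_log (by positivity) (by linarith)
        nlinarith
    have h2 : Real.log (k + 3) ≤ 4 * (k + 1 : ℝ) ^ (1 / 2 : ℝ) := by
      have k0 : (0 : ℝ) ≤ k := Nat.cast_nonneg k
      have h3 := Real.log_le_rpow_div (x := (k : ℝ) + 3) (ε := 1 / 2) (by positivity) (by norm_num)
      have h4 : ((k : ℝ) + 3) ^ (1 / 2 : ℝ) ≤ (4 * (k + 1 : ℝ)) ^ (1 / 2 : ℝ) := by
        gcongr; linarith
      have h5 : (4 : ℝ) ^ (1 / 2 : ℝ) = 2 := by
        rw [← Real.sqrt_eq_rpow, show (4 : ℝ) = 2 ^ 2 by norm_num]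
        exact Real.sqrt_sq (by norm_num)
      rw [Real.mul_rpow (by norm_num) (by positivity), h5] at h4
      linarith
    have hk1 : (0 : ℝ) < k + 1 := by positivity
    calc ∑ ρ ∈ s with κ ρ = k, (m ρ : ℝ) * ((1 + |ρ.im|) ^ 2)⁻¹
        ≤ ∑ ρ ∈ s with κ ρ = k, (m ρ : ℝ) * ((k + 1 : ℝ) ^ 2)⁻¹ := by
          refine Finset.sum_le_sum fun ρ hρ => ?_
          have := (hk ρ hρ).1
          gcongr ?_ * (?_ ^ 2)⁻¹
          linarith
      _ = (∑ ρ ∈ s with κ ρ = k, (m ρ : ℝ)) * ((k + 1 : ℝ) ^ 2)⁻¹ := by rw [Finset.sum_mul]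
      _ ≤ 2 * (C * (4 * (k + 1 : ℝ) ^ (1 / 2 : ℝ))) * ((k + 1 : ℝ) ^ 2)⁻¹ := by
          gcongr
          exact h1.trans (by gcongr)
      _ = B k := by
          have e : ((k : ℝ) + 1) ^ 2 = (k + 1 : ℝ) ^ (3 / 2 : ℝ) * (k + 1 : ℝ) ^ (1 / 2 : ℝ) := by
            rw [← Real.rpow_add hk1, ← Real.rpow_natCast]; norm_num
          have : (0 : ℝ) < (k + 1 : ℝ) ^ (1 / 2 : ℝ) := by positivity
          rw [hB, e]; field_simp
  rw [← Finset.sum_fiberwise_of_maps_to (t := s.image κ) (g := κ)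
    fun ρ hρ => Finset.mem_image_of_mem _ hρ]
  exact (Finset.sum_le_sum fun k _ => hfib k).trans
    (hBs.sum_le_tsum _ fun k _ => by rw [hB]; positivity)

/-- Abel summation: if the discrepancy is `O(T ^ (3 / 4))`, then the symmetric partial sums of
`∑ sign (Im ρ) / (1 + |Im ρ|)` converge. -/
lemma FiniteInStrips.exists_tendsto_sum_sign (hm : FiniteInStrips m) {C : ℝ}
    (hD : ∀ T : ℝ, 0 ≤ T → |discrepancy m T| ≤ C * (1 + T) ^ (3 / 4 : ℝ)) :
    ∃ l : ℝ, Tendsto (fun T : ℝ => ∑ ρ ∈ (hm T).toFinset,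
      (m ρ : ℝ) * (SignType.sign ρ.im : ℝ) * (1 + |ρ.im|)⁻¹) atTop (𝓝 l) := by
  set f : ℝ → ℝ := fun t => discrepancy m t * ((1 + t) ^ 2)⁻¹ with hf
  have hC : 0 ≤ C := by simpa using (abs_nonneg _).trans (hD 0 le_rfl)
  have hterm : ∀ T : ℝ, ∀ ρ : ℂ, |ρ.im| ≤ T → 0 ≤ T →
      IntervalIntegrable (fun t : ℝ => (if |ρ.im| ≤ t then (1 : ℝ) else 0) * ((1 + t) ^ 2)⁻¹)
        MeasureTheory.volume 0 T ∧
      ∫ t in (0 : ℝ)..T, (if |ρ.im| ≤ t then (1 : ℝ) else 0) * ((1 + t) ^ 2)⁻¹ =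
        (1 + |ρ.im|)⁻¹ - (1 + T)⁻¹ := by
    intro T ρ hρ hT
    have h0 := abs_nonneg ρ.im
    have hcont : ContinuousOn (fun t : ℝ => ((1 + t) ^ 2)⁻¹) (Set.Icc 0 T) := by
      refine ContinuousOn.inv₀ (by fun_prop) fun t ht => ?_
      have := ht.1
      positivity
    have i1 : IntervalIntegrable (fun t : ℝ => (if |ρ.im| ≤ t then (1 : ℝ) else 0) *
        ((1 + t) ^ 2)⁻¹) MeasureTheory.volume 0 |ρ.im| := by
      refine IntervalIntegrable.congr_ae (f := fun _ => (0 : ℝ)) (by simp) ?_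
      rw [Set.uIoc_of_le h0, ← MeasureTheory.restrict_Ioo_eq_restrict_Ioc]
      filter_upwards [MeasureTheory.ae_restrict_mem measurableSet_Ioo] with t ht
      simp [not_le.2 ht.2]
    have e1 : ∫ t in (0 : ℝ)..|ρ.im|, (if |ρ.im| ≤ t then (1 : ℝ) else 0) * ((1 + t) ^ 2)⁻¹
        = 0 := by
      rw [intervalIntegral.integral_of_le h0, MeasureTheory.integral_Ioc_eq_integral_Ioo,
        MeasureTheory.setIntegral_congr_fun (g := fun _ => (0 : ℝ)) measurableSet_Ioo]
      · simp
      · intro t ht; simp [not_le.2 ht.2]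
    have hc2 : Set.EqOn (fun t : ℝ => ((1 + t) ^ 2)⁻¹)
        (fun t : ℝ => (if |ρ.im| ≤ t then (1 : ℝ) else 0) * ((1 + t) ^ 2)⁻¹)
        (Set.uIcc |ρ.im| T) := by
      intro t ht
      rw [Set.uIcc_of_le hρ] at ht
      simp [ht.1]
    have hsub : Set.uIcc |ρ.im| T ⊆ Set.Icc 0 T := by
      rw [Set.uIcc_of_le hρ]; exact Set.Icc_subset_Icc_left h0
    have i2' : IntervalIntegrable (fun t : ℝ => ((1 + t) ^ 2)⁻¹) MeasureTheory.volume |ρ.im| T :=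
      (hcont.mono hsub).intervalIntegrable
    have i2 := i2'.congr (hc2.mono Set.uIoc_subset_uIcc)
    have e2 : ∫ t in |ρ.im|..T, (if |ρ.im| ≤ t then (1 : ℝ) else 0) * ((1 + t) ^ 2)⁻¹
        = (1 + |ρ.im|)⁻¹ - (1 + T)⁻¹ := by
      rw [← intervalIntegral.integral_congr hc2,
        intervalIntegral.integral_eq_sub_of_hasDerivAt (f := fun t => -(1 + t)⁻¹) ?_ i2']
      · ring
      · intro t ht
        have ht0 : 0 ≤ t := (hsub ht).1
        have h1 : HasDerivAt (fun t : ℝ => 1 + t) 1 t := (hasDerivAt_id t).const_add 1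
        have h2 := (h1.inv (by positivity)).neg
        refine (h2.congr_deriv ?_)
        rw [neg_div, neg_neg, one_div]
    exact ⟨i1.trans i2, by rw [← intervalIntegral.integral_add_adjacent_intervals i1 i2, e1, e2,
      zero_add]⟩
  -- the integral of the discrepancy
  have hint : ∀ T : ℝ, 0 ≤ T → IntervalIntegrable f MeasureTheory.volume 0 T ∧
      ∑ ρ ∈ (hm T).toFinset, (m ρ : ℝ) * (SignType.sign ρ.im : ℝ) * (1 + |ρ.im|)⁻¹ =
        discrepancy m T * (1 + T)⁻¹ + ∫ t in (0 : ℝ)..T, f t := by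
    intro T hT
    have hmem : ∀ ρ ∈ (hm T).toFinset, |ρ.im| ≤ T := fun ρ hρ => by simp at hρ; exact hρ.2
    set f' : ℝ → ℝ := fun t => ∑ ρ ∈ (hm T).toFinset, (m ρ : ℝ) * (SignType.sign ρ.im : ℝ) *
      ((if |ρ.im| ≤ t then (1 : ℝ) else 0) * ((1 + t) ^ 2)⁻¹) with hf'
    have heq : Set.EqOn f' f (Set.uIcc 0 T) := by
      intro t ht
      rw [Set.uIcc_of_le hT] at ht
      simp only [hf, hf']
      rw [hm.discrepancy_eq ht.2, Finset.sum_mul]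
      exact Finset.sum_congr rfl fun ρ _ => by ring
    have hi : ∀ ρ ∈ (hm T).toFinset, IntervalIntegrable (fun t : ℝ =>
        (m ρ : ℝ) * (SignType.sign ρ.im : ℝ) *
        ((if |ρ.im| ≤ t then (1 : ℝ) else 0) * ((1 + t) ^ 2)⁻¹)) MeasureTheory.volume 0 T :=
      fun ρ hρ => (hterm T ρ (hmem ρ hρ) hT).1.const_mul _
    have hsum : IntervalIntegrable f' MeasureTheory.volume 0 T := by
      have h1 := IntervalIntegrable.sum (hm T).toFinset hi
      rwa [Finset.sum_fn] at h1
    refine ⟨hsum.congr (heq.mono Set.uIoc_subset_uIcc), ?_⟩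
    rw [← intervalIntegral.integral_congr heq, intervalIntegral.integral_finsetSum hi,
      hm.discrepancy_eq le_rfl, Finset.sum_mul, ← Finset.sum_add_distrib]
    refine Finset.sum_congr rfl fun ρ hρ => ?_
    rw [intervalIntegral.integral_const_mul, (hterm T ρ (hmem ρ hρ) hT).2, if_pos (hmem ρ hρ)]
    ring
  have hbound : ∀ t : ℝ, 0 ≤ t → |f t| ≤ C * (1 + t) ^ (-(5 / 4) : ℝ) := by
    intro t ht
    have h1 : (0 : ℝ) < 1 + t := by linarith
    rw [hf, abs_mul, abs_of_nonneg (a := ((1 + t) ^ 2)⁻¹) (by positivity)]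
    calc |discrepancy m t| * ((1 + t) ^ 2)⁻¹
        ≤ C * (1 + t) ^ (3 / 4 : ℝ) * ((1 + t) ^ 2)⁻¹ := by gcongr; exact hD t ht
      _ = _ := by
        rw [← Real.rpow_natCast, ← Real.rpow_neg h1.le, mul_assoc, ← Real.rpow_add h1]
        norm_num
  have hmaj : MeasureTheory.IntegrableOn (fun t : ℝ => C * (1 + t) ^ (-(5 / 4) : ℝ))
      (Set.Ioi 0) := by
    have h1 := integrableOn_add_rpow_Ioi_of_lt (a := -(5 / 4)) (c := 0) (m := 1) (by norm_num)
      (by norm_num)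
    exact MeasureTheory.IntegrableOn.congr_fun (h1.const_mul C)
      (fun t _ => by simp only [add_comm]) measurableSet_Ioi
  have hfint : MeasureTheory.IntegrableOn f (Set.Ioi 0) := by
    refine hmaj.mono' ?_ ?_
    · have hcov : Set.Ioi (0 : ℝ) = ⋃ n : ℕ, Set.Ioc (0 : ℝ) n := by
        ext t
        simp only [Set.mem_Ioi, Set.mem_iUnion, Set.mem_Ioc]
        refine ⟨fun h => ?_, fun ⟨n, h⟩ => h.1⟩
        obtain ⟨n, hn⟩ := exists_nat_ge t
        exact ⟨n, h, hn⟩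
      rw [hcov, aestronglyMeasurable_iUnion_iff]
      intro n
      have := (hint n (Nat.cast_nonneg n)).1
      rw [intervalIntegrable_iff_integrableOn_Ioc_of_le (Nat.cast_nonneg n)] at this
      exact this.aestronglyMeasurable
    · filter_upwards [MeasureTheory.ae_restrict_mem measurableSet_Ioi] with t ht
      exact hbound t (le_of_lt ht)
  have ht1 := MeasureTheory.intervalIntegral_tendsto_integral_Ioi 0 hfint tendsto_id
  have ht2 : Tendsto (fun T : ℝ => discrepancy m T * (1 + T)⁻¹) atTop (𝓝 0) := by
    have h1 : Tendsto (fun T : ℝ => C * (1 + T) ^ (-(1 / 4) : ℝ)) atTop (𝓝 0) := by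
      have h2 := (tendsto_rpow_neg_atTop (y := 1 / 4) (by norm_num)).comp
        (tendsto_atTop_add_const_left atTop (1 : ℝ) tendsto_id)
      simpa using h2.const_mul C
    refine squeeze_zero_norm' ?_ h1
    filter_upwards [eventually_ge_atTop 0] with T hT
    have h1 : (0 : ℝ) < 1 + T := by linarith
    rw [Real.norm_eq_abs, abs_mul, abs_of_nonneg (a := (1 + T)⁻¹) (by positivity)]
    calc |discrepancy m T| * (1 + T)⁻¹ ≤ C * (1 + T) ^ (3 / 4 : ℝ) * (1 + T)⁻¹ := by
          gcongr; exact hD T hT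
      _ = _ := by
        rw [← Real.rpow_neg_one (1 + T), mul_assoc, ← Real.rpow_add h1]
        norm_num
  refine ⟨0 + ∫ t in Set.Ioi 0, f t, (ht2.add ht1).congr' ?_⟩
  filter_upwards [eventually_ge_atTop 0] with T hT
  exact (hint T hT).2.symm

end

/-! ### Jensen's formula and the density of zeros -/

section

open Metric Real MeromorphicOn

/-- Comparing Jensen's formula on two concentric circles: the increase of the mean of `log |f|`
is, up to the factor `log (R₂ / R₁)`, a number of zeros between those of the two discs. -/
lemma circleAverage_sub_circleAverage_bounds {f : ℂ → ℂ} {m : ℂ → ℕ} {z : ℂ} {R₁ R₂ : ℝ}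
    (hR₁ : 0 < R₁) (hR : R₁ ≤ R₂) (hf : MeromorphicOn f (closedBall z R₂))
    (hdiv : ∀ R ≤ R₂, ∀ u ∈ closedBall z R, divisor f (closedBall z R) u = m u)
    (hfin : {ρ | ρ ∈ closedBall z R₂ ∧ m ρ ≠ 0}.Finite) :
    Real.log (R₂ / R₁) * massOn m (closedBall z R₁) ≤
        circleAverage (fun s => Real.log ‖f s‖) z R₂ - circleAverage (fun s => Real.log ‖f s‖) z R₁
      ∧ circleAverage (fun s => Real.log ‖f s‖) z R₂ - circleAverage (fun s => Real.log ‖f s‖) z R₁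
        ≤ Real.log (R₂ / R₁) * massOn m (closedBall z R₂) := by
  classical
  have hR₂ : 0 < R₂ := hR₁.trans_le hR
  set S := hfin.toFinset with hS
  have hmemS : ∀ u, u ∈ S ↔ u ∈ closedBall z R₂ ∧ m u ≠ 0 := by simp [hS]
  have key : ∀ R, 0 < R → R ≤ R₂ → circleAverage (fun s => Real.log ‖f s‖) z R =
      ∑ u ∈ S, (if u ∈ closedBall z R then (m u : ℝ) * (Real.log R - Real.log ‖z - u‖) else 0)
        + Real.log ‖meromorphicTrailingCoeffAt f z‖ := by
    intro R hR0 hRle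
    have hsub : closedBall z R ⊆ closedBall z R₂ := closedBall_subset_closedBall hRle
    have habs : |R| = R := abs_of_pos hR0
    have h1 := MeromorphicOn.circleAverage_log_norm (c := z) (R := R) (f := f) hR0.ne'
      (by rw [habs]; exact hf.mono_set hsub)
    rw [habs] at h1
    rw [h1, ← countingFunction_finsum_eq_finsum_add hR0.ne'
      ((divisor f (closedBall z R)).finiteSupport (isCompact_closedBall z R))]
    congr 1
    rw [finsum_eq_sum_of_support_subset (s := S)]
    · refine Finset.sum_congr rfl fun u _ => ?_
      split_ifs with h
      · rw [hdiv R hRle u h, Int.cast_natCast]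
      · simp [h]
    · intro u hu
      by_cases h : u ∈ closedBall z R
      · rw [Function.mem_support, hdiv R hRle u h] at hu
        rw [Finset.mem_coe, hmemS]
        refine ⟨hsub h, fun h0 => hu ?_⟩
        simp [h0]
      · rw [Function.mem_support] at hu
        simp [h] at hu
  have hlog : 0 ≤ Real.log (R₂ / R₁) := Real.log_nonneg ((one_le_div hR₁).2 hR)
  have hdivlog : Real.log (R₂ / R₁) = Real.log R₂ - Real.log R₁ := Real.log_div hR₂.ne' hR₁.ne'
  rw [key R₂ hR₂ le_rfl, key R₁ hR₁ hR, add_sub_add_right_eq_sub, ← Finset.sum_sub_distrib,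
    massOn_eq_sum (S := S.filter (· ∈ closedBall z R₁)), massOn_eq_sum (S := S), Finset.sum_filter,
    Finset.mul_sum, Finset.mul_sum]
  rotate_left
  · exact fun u h h0 => (hmemS u).2 ⟨h, h0⟩
  · exact fun u h => ((hmemS u).1 h).1
  · exact fun u h h0 => Finset.mem_filter.2
      ⟨(hmemS u).2 ⟨closedBall_subset_closedBall hR h, h0⟩, h⟩
  · exact fun u h => (Finset.mem_filter.1 h).2
  constructor
  · refine Finset.sum_le_sum fun u hu => ?_
    have hu2 := ((hmemS u).1 hu).1
    rw [if_pos hu2]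
    split_ifs with h1
    · rw [hdivlog]; linarith
    · rw [mul_zero, sub_zero]
      refine mul_nonneg (Nat.cast_nonneg _) (sub_nonneg.2 ?_)
      rw [mem_closedBall, dist_comm, dist_eq_norm] at h1 hu2
      exact Real.log_le_log (by linarith) hu2
  · refine Finset.sum_le_sum fun u hu => ?_
    have hu2 := ((hmemS u).1 hu).1
    rw [if_pos hu2]
    split_ifs with h1
    · rw [hdivlog]; linarith
    · rw [sub_zero, mul_comm]
      refine mul_le_mul_of_nonneg_right ?_ (Nat.cast_nonneg _)
      rw [mem_closedBall, dist_comm, dist_eq_norm, not_le] at h1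
      rw [hdivlog]
      have := Real.log_le_log hR₁ h1.le
      linarith

lemma circleAverage_conj (f : ℂ → ℝ) (z : ℂ) (R : ℝ) :
    circleAverage f (conj z) R = circleAverage (fun s => f (conj s)) z R := by
  rw [circleAverage_eq_circleAverage_zero_one, circleAverage_eq_circleAverage_zero_one (c := z),
    ← circleAverage_zero_one_congr_inv]
  refine circleAverage_congr_sphere fun w hw => ?_
  have hw1 : ‖w‖ = 1 := by simpa using hw
  have : w⁻¹ = conj w := Complex.inv_eq_conj hw1
  simp [this]

section

variable {σ₀ σ₁ : ℝ} {F : ℂ → ℂ} {d : CompletionData}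

/-- The local factorization of `F` near the points `σ₀ + 1 + i t`, where `F` has polynomial growth
in `t`. -/
lemma IsHeight.exists_abs_log_norm_le_sum_zeros (hF : IsSharpFlat σ₀ σ₁ F d) {H : ℝ}
    (hH : IsHeight σ₁ d H) {R : ℝ} (hR : 1 ≤ R) : ∃ C T₀ : ℝ, 1 ≤ C ∧ H + 2 * R + 3 ≤ T₀ ∧
    ∀ t : ℝ, T₀ ≤ |t| → ∃ S : Finset ℂ,
      (∀ u ∈ S, u ∈ closedBall (((σ₀ + 1 : ℝ) : ℂ) + t * Complex.I) R) ∧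
      (∀ u ∈ closedBall (((σ₀ + 1 : ℝ) : ℂ) + t * Complex.I) R, F u = 0 → u ∈ S) ∧
      (∑ u ∈ S, (analyticOrderNatAt F u : ℝ) ≤ C * Real.log |t|) ∧
      ∀ w ∈ closedBall (((σ₀ + 1 : ℝ) : ℂ) + t * Complex.I) (R / 2), F w ≠ 0 →
        |Real.log ‖F w‖| ≤ C * Real.log |t| +
          ∑ u ∈ S, (analyticOrderNatAt F u : ℝ) * |Real.log ‖w - u‖| := by
  obtain ⟨C₀, hC₀, hloc⟩ := TauLi.exists_abs_log_norm_le_sum_zeros hR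
  obtain ⟨K, hK, hlog⟩ := exists_abs_log_norm_le_of_isSharpFlat hF
  set A := σ₀ + 1 with hA
  obtain ⟨C₁, N, hC₁, hpoly⟩ := hH.polyLE_one hF (|A| + 2 * R)
  refine ⟨C₀ * (2 * N + 1 + K), H + 2 * R + 3 + |A| + C₁, ?_, ?_, fun t ht => ?_⟩
  · have : (0 : ℝ) ≤ N := Nat.cast_nonneg N
    nlinarith
  · linarith [abs_nonneg A]
  have hH1 := hH.1
  have hA0 := abs_nonneg A
  have ht3 : 3 ≤ |t| := by linarith
  have ht0 : 0 < |t| := by linarith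
  have hlt : 1 ≤ Real.log |t| := by
    rw [Real.le_log_iff_exp_le ht0]
    linarith [Real.exp_one_lt_d9]
  set c : ℂ := (A : ℂ) + t * Complex.I with hc
  have hcre : c.re = A := by simp [hc]
  have hcim : c.im = t := by simp [hc]
  have hball : ∀ z ∈ closedBall c (2 * R), -(|A| + 2 * R) ≤ z.re ∧ H ≤ |z.im| ∧
      1 + ‖z‖ ≤ |t| ^ 2 := by
    intro z hz
    rw [mem_closedBall, dist_eq_norm] at hz
    have h1 := (Complex.abs_re_le_norm (z - c)).trans hz
    have h2 := (Complex.abs_im_le_norm (z - c)).trans hz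
    rw [Complex.sub_re, hcre] at h1
    rw [Complex.sub_im, hcim] at h2
    refine ⟨?_, ?_, ?_⟩
    · linarith [(abs_le.1 h1).1, neg_abs_le A]
    · have := abs_sub_abs_le_abs_sub t z.im
      rw [abs_sub_comm] at this
      linarith
    · have h3 : ‖c‖ ≤ |A| + |t| := by
        have := Complex.norm_le_abs_re_add_abs_im c
        rwa [hcre, hcim] at this
      have h4 : ‖z‖ ≤ ‖z - c‖ + ‖c‖ := by
        have := norm_add_le (z - c) c
        rwa [sub_add_cancel] at this
      nlinarith
  have hexp : |t| = Real.exp (Real.log |t|) := (Real.exp_log ht0).symm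
  have hN0 : (0 : ℝ) ≤ N := Nat.cast_nonneg N
  have hbd : ∀ z ∈ closedBall c (2 * R), ‖F z‖ ≤ Real.exp ((2 * N + 1 + K) * Real.log |t|) := by
    intro z hz
    obtain ⟨b1, b2, b3⟩ := hball z hz
    have h5 := hpoly z ⟨b1, b2⟩
    rw [Pi.one_apply, norm_one, mul_one] at h5
    calc ‖F z‖ ≤ C₁ * (1 + ‖z‖) ^ N := h5
      _ ≤ |t| * (|t| ^ 2) ^ N := by gcongr; linarith
      _ = Real.exp ((2 * N + 1) * Real.log |t|) := by
        rw [← pow_mul, ← pow_succ']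
        conv_lhs => rw [hexp, ← Real.exp_nat_mul]
        push_cast
        ring_nf
      _ ≤ _ := by
        rw [Real.exp_le_exp]
        nlinarith
  obtain ⟨S, h1, h2, h3, h4⟩ := hloc F c ((2 * N + 1 + K) * Real.log |t|) (by nlinarith)
    (fun z hz => analyticAt_of_notMem_poles hF (hH.regular (hball z hz).2.1).notMem_poles) hbd
    (ne_zero_of_lt_re hF (by rw [hcre, hA]; linarith))
    ((hlog c hcre.ge).trans (by nlinarith))
  refine ⟨S, h1, h2, ?_, fun w hw hw0 => ?_⟩
  · rw [mul_assoc]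
    exact h3
  · rw [mul_assoc]
    exact h4 w hw hw0

lemma finiteInStrips_zeroMultiplicity (hF : IsSharpFlat σ₀ σ₁ F d) :
    FiniteInStrips (zeroMultiplicity σ₁ d F) := fun T =>
  (finite_zerosUpTo hF T).subset fun _ hρ => ⟨(mem_nontrivialZeros_iff hF).2 hρ.1, hρ.2⟩

/-- Horizontal strips of height one contain `O(log)` non-trivial zeros. -/
lemma exists_massOn_window_le (hF : IsSharpFlat σ₀ σ₁ F d) : ∃ C : ℝ, 0 ≤ C ∧ ∀ a : ℝ,
    massOn (zeroMultiplicity σ₁ d F) {ρ | a ≤ ρ.im ∧ ρ.im ≤ a + 1} ≤ C * Real.log (|a| + 2) := by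
  obtain ⟨H, hH⟩ := exists_height hF
  obtain ⟨X, hX⟩ := exists_abs_re_le_of_mem_nontrivialZeros hF
  have hm := finiteInStrips_zeroMultiplicity hF
  set m := zeroMultiplicity σ₁ d F with hmdef
  have hl2 : 0 < Real.log 2 := Real.log_pos one_lt_two
  set R := |X| + |σ₀ + 1| + 1 with hR
  obtain ⟨C, T₀, hC, hT₀, hloc⟩ := hH.exists_abs_log_norm_le_sum_zeros hF (R := R)
    (by rw [hR]; linarith [abs_nonneg X, abs_nonneg (σ₀ + 1)])
  have hR1 : 1 ≤ R := by rw [hR]; linarith [abs_nonneg X, abs_nonneg (σ₀ + 1)]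
  have hH1 := hH.1
  set B := massOn m {ρ | -(T₀ + 1) ≤ ρ.im ∧ ρ.im ≤ T₀ + 1} with hB
  have hB0 : 0 ≤ B := massOn_nonneg _
  refine ⟨C + B / Real.log 2, by positivity, fun a => ?_⟩
  have hla : Real.log 2 ≤ Real.log (|a| + 2) :=
    Real.log_le_log two_pos (by linarith [abs_nonneg a])
  have hl0 : 0 ≤ Real.log (|a| + 2) := hl2.le.trans hla
  rcases le_total T₀ |a| with ha | ha
  · obtain ⟨S, hS1, hS2, hS3, -⟩ := hloc a ha
    have hSim : ∀ ρ ∈ S, H ≤ |ρ.im| := by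
      intro ρ hρ
      have h := hS1 ρ hρ
      rw [mem_closedBall, dist_eq_norm] at h
      have h2 := (Complex.abs_im_le_norm _).trans h
      simp only [Complex.sub_im, Complex.add_im, Complex.ofReal_im, Complex.mul_im, Complex.I_im,
        Complex.I_re, Complex.ofReal_re, mul_one, mul_zero, zero_add, add_zero] at h2
      have := abs_sub_abs_le_abs_sub a ρ.im
      rw [abs_sub_comm] at this
      linarith
    have h1 : massOn m {ρ | a ≤ ρ.im ∧ ρ.im ≤ a + 1} ≤ ∑ ρ ∈ S, (m ρ : ℝ) := by
      refine massOn_le_sum fun ρ hρ h0 => ?_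
      have hZ := (mem_nontrivialZeros_iff hF).2 h0
      have him : H ≤ |ρ.im| := by
        have h2 := abs_sub_abs_le_abs_sub a ρ.im
        have h3 : |a - ρ.im| ≤ 1 := by rw [abs_le]; constructor <;> linarith [hρ.1, hρ.2]
        linarith
      refine hS2 ρ ?_ (hH.eq_zero_of_zeroMultiplicity_ne_zero hF him h0)
      rw [mem_closedBall, dist_eq_norm]
      refine (Complex.norm_le_abs_re_add_abs_im _).trans ?_
      simp only [Complex.sub_im, Complex.add_im, Complex.ofReal_im, Complex.mul_im, Complex.I_im,
        Complex.I_re, Complex.ofReal_re, mul_one, mul_zero, zero_add, add_zero, Complex.sub_re,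
        Complex.add_re, Complex.mul_re, sub_zero]
      have h4 := abs_sub ρ.re (σ₀ + 1)
      have h5 : |ρ.im - a| ≤ 1 := by rw [abs_le]; constructor <;> linarith [hρ.1, hρ.2]
      linarith [hX ρ hZ, le_abs_self X]
    have h2 : ∑ ρ ∈ S, (m ρ : ℝ) = ∑ ρ ∈ S, (analyticOrderNatAt F ρ : ℝ) :=
      Finset.sum_congr rfl fun ρ hρ => by rw [hmdef, hH.zeroMultiplicity_eq hF (hSim ρ hρ)]
    have h3 : Real.log |a| ≤ Real.log (|a| + 2) :=
      Real.log_le_log (by linarith) (by linarith)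
    have h4 : 0 ≤ B / Real.log 2 * Real.log (|a| + 2) := mul_nonneg (by positivity) hl0
    rw [h2] at h1
    nlinarith
  · have h1 : massOn m {ρ | a ≤ ρ.im ∧ ρ.im ≤ a + 1} ≤ B := by
      refine massOn_mono (hm.finite_Icc _ _) fun ρ hρ _ => ?_
      have := abs_le.1 ha
      exact ⟨by linarith [hρ.1], by linarith [hρ.2]⟩
    have h2 : B ≤ B / Real.log 2 * Real.log (|a| + 2) := by
      rw [div_mul_eq_mul_div, le_div_iff₀ hl2]
      gcongr
    have h4 : 0 ≤ C * Real.log (|a| + 2) := mul_nonneg (by linarith) hl0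
    linarith

end

/-- Adding up windows of height one. -/
lemma FiniteInStrips.massOn_Icc_le {m : ℂ → ℕ} (hm : FiniteInStrips m) {C : ℝ} (hC : 0 ≤ C)
    (hwin : ∀ a : ℝ, massOn m {ρ | a ≤ ρ.im ∧ ρ.im ≤ a + 1} ≤ C * Real.log (|a| + 2))
    {a b T : ℝ} (hab : a ≤ b) (ha : |a| ≤ T) (hb : |b| ≤ T) :
    massOn m {ρ | a ≤ ρ.im ∧ ρ.im ≤ b} ≤ (b - a + 1) * (C * Real.log (T + 3)) := by
  have h0 : ∀ n : ℕ, a + n ≤ b + 1 →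
      massOn m {ρ | a ≤ ρ.im ∧ ρ.im ≤ a + n} ≤ max (n : ℝ) 1 * (C * Real.log (T + 3)) := by
    have hT : 0 ≤ T := (abs_nonneg a).trans ha
    have hlog : 0 ≤ Real.log (T + 3) := Real.log_nonneg (by linarith)
    have hstep : ∀ x : ℝ, |x| ≤ T + 1 → massOn m {ρ | x ≤ ρ.im ∧ ρ.im ≤ x + 1} ≤
        C * Real.log (T + 3) := by
      intro x hx
      refine (hwin x).trans ?_
      gcongr ?_ * ?_
      exact Real.log_le_log (by positivity) (by linarith)
    intro n
    induction n with
    | zero =>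
      intro _
      refine (massOn_mono (hm.finite_Icc a (a + 1)) fun ρ hρ _ => ?_).trans
        ((hstep a (by linarith)).trans ?_)
      · refine ⟨hρ.1, ?_⟩
        have := hρ.2
        simp at this
        linarith
      · simp
    | succ n ih =>
      intro hn
      push_cast at hn ⊢
      have h1 := ih (by linarith)
      rcases Nat.eq_zero_or_pos n with h | h
      · subst h
        have := hstep a (by linarith)
        simpa using this
      have hn1 : (1 : ℝ) ≤ n := by exact_mod_cast h
      rw [max_eq_left hn1] at h1
      rw [max_eq_left (by linarith)]
      have hax : |a + n| ≤ T + 1 := by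
        rw [abs_le] at ha hb ⊢
        constructor <;> linarith
      refine (massOn_le_add (hm.finite_Icc a (a + n)) (hm.finite_Icc (a + n) (a + n + 1))
        fun ρ hρ _ => ?_).trans ?_
      · rcases le_total ρ.im (a + n) with h2 | h2
        · exact Or.inl ⟨hρ.1, h2⟩
        · exact Or.inr ⟨h2, by linarith [hρ.2]⟩
      · linarith [hstep (a + n) hax]
  have hT : 0 ≤ T := (abs_nonneg a).trans ha
  have hlog : 0 ≤ Real.log (T + 3) := Real.log_nonneg (by linarith)
  have hceil := Nat.ceil_lt_add_one (sub_nonneg.2 hab)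
  have hle := Nat.le_ceil (b - a)
  refine (massOn_mono (hm.finite_Icc a (a + ⌈b - a⌉₊)) fun ρ hρ _ =>
    ⟨hρ.1, by linarith [hρ.2]⟩).trans ((h0 _ (by linarith)).trans ?_)
  refine mul_le_mul_of_nonneg_right ?_ (by positivity)
  exact max_le (by linarith) (by linarith)

end

/-! ### Complex conjugation and the size of the completed function -/

section

open Metric Real MeromorphicOn

section

variable {σ₀ σ₁ : ℝ} {F : ℂ → ℂ} {d : CompletionData}

/-- The cofactor has polynomially comparable sizes at `s` and `conj s`, so that `log |ξ|` and
`log |F|` change by comparable amounts under complex conjugation. -/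
lemma IsHeight.exists_abs_log_completed_sub_conj_le (hF : IsSharpFlat σ₀ σ₁ F d) {H : ℝ}
    (hH : IsHeight σ₁ d H) (X : ℝ) : ∃ C : ℝ, 0 ≤ C ∧ ∀ s : ℂ, -X ≤ s.re → H ≤ |s.im| → F s ≠ 0 →
      F (conj s) ≠ 0 → |Real.log ‖completed σ₁ d F s‖ - Real.log ‖completed σ₁ d F (conj s)‖| ≤
        C * (1 + Real.log (1 + ‖s‖)) + (|Real.log ‖F s‖| + |Real.log ‖F (conj s)‖|) := by
  obtain ⟨C, N, hC, h⟩ := hH.polyLE_cofactor_conj hF X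
  have hlC : 0 ≤ Real.log (C + 1) := Real.log_nonneg (by linarith)
  refine ⟨Real.log (C + 1) + N, by positivity, fun s hX hs h1 h2 => ?_⟩
  have hs' : H ≤ |(conj s).im| := by simpa using hs
  have g1 := cofactor_ne_zero hF (hH.regular hs)
  have g2 := cofactor_ne_zero hF (hH.regular hs')
  have hN0 : (0 : ℝ) ≤ N := Nat.cast_nonneg N
  have hl : 0 ≤ Real.log (1 + ‖s‖) := Real.log_nonneg (by linarith [norm_nonneg s])
  have key : ∀ z w : ℂ, ‖z‖ = ‖s‖ → cofactor σ₁ d F z ≠ 0 → cofactor σ₁ d F w ≠ 0 →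
      ‖cofactor σ₁ d F w‖ ≤ C * (1 + ‖z‖) ^ N * ‖cofactor σ₁ d F z‖ →
      Real.log ‖cofactor σ₁ d F w‖ - Real.log ‖cofactor σ₁ d F z‖ ≤
        (Real.log (C + 1) + N) * (1 + Real.log (1 + ‖s‖)) := by
    intro z w hz gz gw hle
    rw [hz] at hle
    have h3 : ‖cofactor σ₁ d F w‖ ≤ (C + 1) * (1 + ‖s‖) ^ N * ‖cofactor σ₁ d F z‖ := by
      refine hle.trans ?_
      gcongr
      linarith
    have h4 := Real.log_le_log (norm_pos_iff.2 gw) h3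
    have hp : (0 : ℝ) < 1 + ‖s‖ := by positivity
    rw [Real.log_mul (by positivity) (norm_ne_zero_iff.2 gz),
      Real.log_mul (by positivity) (by positivity), Real.log_pow] at h4
    nlinarith
  have k1 := key s (conj s) rfl g1 g2 (h s ⟨hX, hs⟩)
  have k2 := key (conj s) s (RCLike.norm_conj s) g2 g1 (by
    have := h (conj s) ⟨by simpa using hX, hs'⟩
    simpa using this)
  rw [completed_eq, completed_eq, norm_mul, norm_mul,
    Real.log_mul (norm_ne_zero_iff.2 h1) (norm_ne_zero_iff.2 g1),
    Real.log_mul (norm_ne_zero_iff.2 h2) (norm_ne_zero_iff.2 g2)]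
  have a1 := neg_abs_le (Real.log ‖F s‖)
  have a2 := le_abs_self (Real.log ‖F s‖)
  have a3 := neg_abs_le (Real.log ‖F (conj s)‖)
  have a4 := le_abs_self (Real.log ‖F (conj s)‖)
  rw [abs_le]
  constructor <;> linarith

/-- Outside the critical strip `log |ξ|` changes by `O(log |s|)` under complex conjugation: to the
right `log |F|` is bounded, and the functional equation reflects the left into the right. -/
lemma IsHeight.exists_abs_log_completed_sub_conj_le_of_strip_lt (hσ₁ : 0 < σ₁)
    (hF : IsSharpFlat σ₀ σ₁ F d) {H : ℝ}
    (hH : IsHeight σ₁ d H) : ∃ C : ℝ, 0 ≤ C ∧ ∀ s : ℂ, H ≤ |s.im| →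
      σ₀ + 1 - σ₁ / 2 < |s.re - σ₁ / 2| →
      |Real.log ‖completed σ₁ d F s‖ - Real.log ‖completed σ₁ d F (conj s)‖| ≤
        C * (1 + Real.log (1 + ‖s‖)) := by
  obtain ⟨C, hC, h⟩ := hH.exists_abs_log_completed_sub_conj_le hF |σ₀ + 1|
  obtain ⟨K, hK, hlog⟩ := exists_abs_log_norm_le_of_isSharpFlat hF
  have hlσ : 0 ≤ Real.log (1 + σ₁) := Real.log_nonneg (by linarith)
  have right : ∀ s : ℂ, H ≤ |s.im| → σ₀ + 1 ≤ s.re →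
      |Real.log ‖completed σ₁ d F s‖ - Real.log ‖completed σ₁ d F (conj s)‖| ≤
        C * (1 + Real.log (1 + ‖s‖)) + 2 * K := by
    intro s hs hre
    have hre' : σ₀ + 1 ≤ (conj s).re := by simpa using hre
    have h1 := h s (by linarith [neg_abs_le (σ₀ + 1)]) hs (ne_zero_of_lt_re hF (by linarith))
      (ne_zero_of_lt_re hF (by linarith))
    linarith [hlog s hre, hlog (conj s) hre']
  refine ⟨C * (1 + Real.log (1 + σ₁)) + 2 * K, by positivity, fun s hs hre => ?_⟩
  have hl : 0 ≤ Real.log (1 + ‖s‖) := Real.log_nonneg (by linarith [norm_nonneg s])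
  have e1 : C * (1 + Real.log (1 + σ₁) + Real.log (1 + ‖s‖)) + 2 * K ≤
      (C * (1 + Real.log (1 + σ₁)) + 2 * K) * (1 + Real.log (1 + ‖s‖)) := by
    have : 0 ≤ C * (Real.log (1 + σ₁) * Real.log (1 + ‖s‖)) := by positivity
    have : 0 ≤ K * Real.log (1 + ‖s‖) := by positivity
    nlinarith
  refine le_trans ?_ e1
  rcases lt_abs.1 hre with hre | hre
  · refine (right s hs (by linarith)).trans ?_
    gcongr
    linarith
  · have hs' : H ≤ |(conj s).im| := by simpa using hs
    rw [← hH.functional_equation hF hs, ← hH.functional_equation hF hs']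
    have e2 : (σ₁ : ℂ) - conj (conj s) = conj (σ₁ - conj s) := by simp
    rw [e2]
    have h3 := norm_sub_le (σ₁ : ℂ) (conj s)
    rw [RCLike.norm_conj, Complex.norm_of_nonneg hσ₁.le] at h3
    have h4 : Real.log (1 + ‖(σ₁ : ℂ) - conj s‖) ≤ Real.log (1 + σ₁) + Real.log (1 + ‖s‖) := by
      rw [← Real.log_mul (by positivity) (by positivity)]
      gcongr
      nlinarith [norm_nonneg s]
    have h5 := right (σ₁ - conj s) (by simpa using hs) (by simp; linarith)
    nlinarith

/-- A large circle meets the critical strip only near its top and its bottom, where the local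
factorization controls `log |F|`. -/
lemma IsHeight.exists_abs_log_norm_le_of_mem_sphere (hσ : σ₁ ≤ σ₀) (hσ₁ : 0 < σ₁)
    (hF : IsSharpFlat σ₀ σ₁ F d) {H : ℝ} (hH : IsHeight σ₁ d H) :
    ∃ C T₀ : ℝ, 1 ≤ C ∧ H + 1 ≤ T₀ ∧ ∀ h R : ℝ, T₀ ≤ R → T₀ ≤ |h| - R → ∃ S : Finset ℂ,
      (∀ u ∈ S, ‖((σ₁ / 2 : ℝ) : ℂ) + h * Complex.I - u‖ ≤ 2 * R) ∧
      (∑ u ∈ S, (analyticOrderNatAt F u : ℝ) ≤ C * Real.log (|h| + R)) ∧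
      ∀ s ∈ sphere (((σ₁ / 2 : ℝ) : ℂ) + h * Complex.I) R,
        |s.re - σ₁ / 2| ≤ σ₀ + 1 - σ₁ / 2 → F s ≠ 0 →
        |Real.log ‖F s‖| ≤ C * Real.log (|h| + R) +
          ∑ u ∈ S, (analyticOrderNatAt F u : ℝ) * |Real.log ‖s - u‖| := by
  classical
  set B := σ₀ + 1 - σ₁ / 2 with hB
  have hB1 : 1 ≤ B := by linarith
  obtain ⟨C, T₀, hC, hT₀, hloc⟩ := hH.exists_abs_log_norm_le_sum_zeros hF (R := 4 * B + 2)
    (by linarith)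
  -- large enough for the points of the circle inside the strip to lie within height `1` of its
  -- top or its bottom, hence in the discs of the local factorization
  refine ⟨2 * C, T₀ + 5 * B + B ^ 2 + 3, by linarith, by nlinarith, fun h R hR hh => ?_⟩
  have hH1 := hH.1
  have hR0 : 0 < R := by nlinarith
  have t1 : |h| - R ≤ |h + R| := by
    have := abs_sub_abs_le_abs_sub h (-R)
    rw [abs_neg, abs_of_pos hR0, sub_neg_eq_add] at this
    exact this
  have t2 : |h| - R ≤ |h - R| := by
    have := abs_sub_abs_le_abs_sub h R
    rwa [abs_of_pos hR0] at this
  have t3 : |h + R| ≤ |h| + R := by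
    have := abs_add_le h R
    rwa [abs_of_pos hR0] at this
  have t4 : |h - R| ≤ |h| + R := by
    have := abs_sub h R
    rwa [abs_of_pos hR0] at this
  have hT0' : T₀ ≤ |h| - R := by nlinarith
  obtain ⟨S₁, a1, a2, a3, a4⟩ := hloc (h + R) (hT0'.trans t1)
  obtain ⟨S₂, b1, b2, b3, b4⟩ := hloc (h - R) (hT0'.trans t2)
  have hl1 : C * Real.log |h + R| ≤ C * Real.log (|h| + R) := by
    have : 0 < |h + R| := by nlinarith
    gcongr
  have hl2 : C * Real.log |h - R| ≤ C * Real.log (|h| + R) := by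
    have : 0 < |h - R| := by nlinarith
    gcongr
  have hl0 : 0 ≤ C * Real.log (|h| + R) :=
    mul_nonneg (by linarith) (Real.log_nonneg (by nlinarith [abs_nonneg h]))
  have hw : ∀ (f : ℂ → ℝ), (∀ u, 0 ≤ f u) → (∑ u ∈ S₁, f u ≤ ∑ u ∈ S₁ ∪ S₂, f u) ∧
      (∑ u ∈ S₂, f u ≤ ∑ u ∈ S₁ ∪ S₂, f u) := fun f hf =>
    ⟨Finset.sum_le_sum_of_subset_of_nonneg Finset.subset_union_left fun _ _ _ => hf _,
      Finset.sum_le_sum_of_subset_of_nonneg Finset.subset_union_right fun _ _ _ => hf _⟩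
  have hdist : ∀ t : ℝ, |t - h| = R → ∀ u ∈ closedBall (((σ₀ + 1 : ℝ) : ℂ) + t * Complex.I)
      (4 * B + 2), ‖((σ₁ / 2 : ℝ) : ℂ) + h * Complex.I - u‖ ≤ 2 * R := by
    intro t ht u hu
    rw [mem_closedBall, dist_comm, dist_eq_norm] at hu
    have e : ((σ₁ / 2 : ℝ) : ℂ) + h * Complex.I - u =
        (((-B : ℝ) : ℂ) + ((h - t : ℝ) : ℂ) * Complex.I) +
          (((σ₀ + 1 : ℝ) : ℂ) + t * Complex.I - u) := by
      rw [hB]; push_cast; ring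
    have h2 : ‖((-B : ℝ) : ℂ) + ((h - t : ℝ) : ℂ) * Complex.I‖ ≤ B + R := by
      refine (norm_add_le _ _).trans ?_
      rw [norm_mul, Complex.norm_I, mul_one, Complex.norm_real, Complex.norm_real, norm_neg,
        Real.norm_of_nonneg (by linarith), Real.norm_eq_abs, abs_sub_comm, ht]
    rw [e]
    refine (norm_add_le _ _).trans ?_
    nlinarith
  have hp : |h + R - h| = R := by rw [add_sub_cancel_left, abs_of_pos hR0]
  have hq : |h - R - h| = R := by
    rw [show h - R - h = -R by ring, abs_neg, abs_of_pos hR0]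
  refine ⟨S₁ ∪ S₂, fun u hu => ?_, ?_, fun s hs hre hs0 => ?_⟩
  · rcases Finset.mem_union.1 hu with hu | hu
    · exact hdist _ hp u (a1 u hu)
    · exact hdist _ hq u (b1 u hu)
  · have h1 := Finset.sum_union_inter (s₁ := S₁) (s₂ := S₂)
      (f := fun u => (analyticOrderNatAt F u : ℝ))
    have h2 : 0 ≤ ∑ u ∈ S₁ ∩ S₂, (analyticOrderNatAt F u : ℝ) := by positivity
    linarith
  · have hmem : ∀ t : ℝ, |s.im - t| ≤ 1 → s ∈ closedBall (((σ₀ + 1 : ℝ) : ℂ) + t * Complex.I)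
        ((4 * B + 2) / 2) := by
      intro t ht
      rw [mem_closedBall, dist_eq_norm]
      refine (Complex.norm_le_abs_re_add_abs_im _).trans ?_
      have e1 : (s - (((σ₀ + 1 : ℝ) : ℂ) + t * Complex.I)).re = (s.re - σ₁ / 2) - B := by
        simp [hB]
      have e2 : (s - (((σ₀ + 1 : ℝ) : ℂ) + t * Complex.I)).im = s.im - t := by simp
      rw [e1, e2]
      have := abs_sub (s.re - σ₁ / 2) B
      rw [abs_of_nonneg (by linarith : 0 ≤ B)] at this
      linarith
    have hcirc : (s.re - σ₁ / 2) ^ 2 + (s.im - h) ^ 2 = R ^ 2 := by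
      rw [mem_sphere_iff_norm] at hs
      rw [← hs, Complex.sq_norm, Complex.normSq_apply]
      simp
      ring
    have hsq : (s.re - σ₁ / 2) ^ 2 ≤ B ^ 2 :=
      sq_le_sq.2 (by rwa [abs_of_nonneg (by linarith : 0 ≤ B)])
    have hle : |s.im - h| ≤ R :=
      abs_le_of_sq_le_sq (by nlinarith [sq_nonneg (s.re - σ₁ / 2)]) hR0.le
    have hge : R - 1 ≤ |s.im - h| := by
      refine le_of_sq_le_sq ?_ (abs_nonneg _)
      rw [sq_abs]
      nlinarith
    obtain ⟨g1, g2⟩ := hw (fun u => (analyticOrderNatAt F u : ℝ) * |Real.log ‖s - u‖|)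
      fun u => by positivity
    rcases le_total 0 (s.im - h) with h0 | h0
    · rw [abs_of_nonneg h0] at hle hge
      have := a4 s (hmem _ (by rw [abs_le]; constructor <;> linarith)) hs0
      linarith
    · rw [abs_of_nonpos h0] at hle hge
      have := b4 s (hmem _ (by rw [abs_le]; constructor <;> linarith)) hs0
      linarith

end

end

/-! ### Means over conjugate circles -/

section

open Metric Real MeromorphicOn

lemma circleIntegrable_sum_abs_log (S : Finset ℂ) (w : ℂ → ℝ) (g : ℂ → ℂ) (z : ℂ) (R : ℝ) :
    CircleIntegrable (fun s => ∑ u ∈ S, w u * |Real.log ‖s - g u‖|) z R :=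
  CircleIntegrable.fun_sum S fun u _ => (circleIntegrable_abs_log_norm_sub (g u) z R).const_mul _

lemma circleAverage_sum_abs_log_le {S : Finset ℂ} {w : ℂ → ℝ} (hw : ∀ u, 0 ≤ w u) {g : ℂ → ℂ}
    {z : ℂ} {R : ℝ} (hR : 1 ≤ R) (hS : ∀ u ∈ S, ‖z - g u‖ ≤ 2 * R) :
    circleAverage (fun s => ∑ u ∈ S, w u * |Real.log ‖s - g u‖|) z R ≤
      (∑ u ∈ S, w u) * (2 * Real.log (3 * R)) := by
  have hint : ∀ u ∈ S, CircleIntegrable (fun s => w u * |Real.log ‖s - g u‖|) z R :=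
    fun u _ => (circleIntegrable_abs_log_norm_sub (g u) z R).const_mul (w u)
  rw [circleAverage_fun_sum hint, Finset.sum_mul]
  refine Finset.sum_le_sum fun u hu => ?_
  have h1 := circleAverage_fun_smul (a := w u) (c := z) (R := R)
    (f := fun s => |Real.log ‖s - g u‖|)
  simp only [smul_eq_mul] at h1
  rw [h1]
  refine mul_le_mul_of_nonneg_left ?_ (hw u)
  exact circleAverage_abs_log_norm_sub_le hR (by linarith [hS u hu])

section

variable {σ₀ σ₁ : ℝ} {F : ℂ → ℂ} {d : CompletionData}

lemma IsHeight.mem_nontrivialZeros (hF : IsSharpFlat σ₀ σ₁ F d) {H : ℝ} (hH : IsHeight σ₁ d H)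
    {s : ℂ} (hs : H ≤ |s.im|) (h0 : F s = 0) : s ∈ nontrivialZeros σ₁ d F := by
  have ha := analyticAt_completed hF (hH.regular hs)
  have hz : completed σ₁ d F s = 0 := by rw [completed_eq, h0, zero_mul]
  change 0 < meromorphicOrderAt (completed σ₁ d F) s
  refine lt_of_le_of_ne ha.meromorphicOrderAt_nonneg fun h => ?_
  rw [ha.meromorphicOrderAt_eq] at h
  have h2 : analyticOrderAt (completed σ₁ d F) s ≠ 0 := by
    rw [Ne, ha.analyticOrderAt_eq_zero]; simpa using hz
  cases h3 : analyticOrderAt (completed σ₁ d F) s with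
  | top => rw [h3] at h; simp at h
  | coe n => rw [h3] at h h2; simp at h h2; exact h2 (by exact_mod_cast h.symm)

/-- The mean of `log |ξ|` over a large circle in the upper half-plane centred on the critical line
nearly equals that over the complex conjugate circle. -/
lemma IsHeight.exists_abs_circleAverage_sub_le (hσ : σ₁ ≤ σ₀) (hσ₁ : 0 < σ₁)
    (hF : IsSharpFlat σ₀ σ₁ F d) {H : ℝ} (hH : IsHeight σ₁ d H) :
    ∃ C T₀ : ℝ, 0 ≤ C ∧ H + 1 ≤ T₀ ∧ ∀ h R : ℝ, T₀ ≤ R → T₀ ≤ h - R →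
      |circleAverage (fun s => Real.log ‖completed σ₁ d F s‖)
          (((σ₁ / 2 : ℝ) : ℂ) + h * Complex.I) R -
        circleAverage (fun s => Real.log ‖completed σ₁ d F s‖)
          (((σ₁ / 2 : ℝ) : ℂ) + (-h : ℝ) * Complex.I) R| ≤ C * Real.log (h + R) ^ 2 := by
  classical
  obtain ⟨C, T₀, hC, hT₀, harc⟩ := hH.exists_abs_log_norm_le_of_mem_sphere hσ hσ₁ hF
  obtain ⟨C₁, hC₁, hin⟩ := hH.exists_abs_log_completed_sub_conj_le hF |σ₀ + 1|
  obtain ⟨C₂, hC₂, hout⟩ := hH.exists_abs_log_completed_sub_conj_le_of_strip_lt hσ₁ hF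
  refine ⟨3 * (C₁ + C₂) + 2 * C + 8 * C, T₀ + σ₁ + 3, by linarith, by linarith,
    fun h R hR hh => ?_⟩
  have hH1 := hH.1
  have hh0 : 0 < h := by linarith
  have hR0 : 0 < R := by linarith
  have habs : |h| = h := abs_of_pos hh0
  obtain ⟨S₁, a1, a2, a3⟩ := harc h R (by linarith) (by rw [habs]; linarith)
  obtain ⟨S₂, b1, b2, b3⟩ := harc (-h) R (by linarith) (by rw [abs_neg, habs]; linarith)
  rw [abs_neg, habs] at b2 b3
  rw [habs] at a2 a3
  set z : ℂ := ((σ₁ / 2 : ℝ) : ℂ) + h * Complex.I with hz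
  have hzc : ((σ₁ / 2 : ℝ) : ℂ) + (-h : ℝ) * Complex.I = conj z := by
    rw [hz, map_add, map_mul, Complex.conj_ofReal, Complex.conj_ofReal, Complex.conj_I]
    push_cast
    ring
  rw [hzc] at b1 b3 ⊢
  set l := Real.log (h + R) with hl
  have hl1 : 1 ≤ l := by
    rw [hl, Real.le_log_iff_exp_le (by linarith)]
    linarith [Real.exp_one_lt_d9]
  have hlog3 : Real.log (3 * R) ≤ 2 * l := by
    have : Real.log ((h + R) ^ 2) = 2 * l := by rw [Real.log_pow]; push_cast; rfl
    rw [← this]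
    exact Real.log_le_log (by linarith) (by nlinarith)
  have hsph : ∀ s ∈ sphere z R, H ≤ |s.im| ∧ Real.log (1 + ‖s‖) ≤ 2 * l := by
    intro s hs
    rw [mem_sphere_iff_norm] at hs
    have h1 := Complex.abs_im_le_norm (s - z)
    have e : (s - z).im = s.im - h := by simp [hz]
    rw [e, hs] at h1
    have h2 := (abs_le.1 h1).1
    have h3 : ‖z‖ ≤ σ₁ / 2 + h := by
      rw [hz]
      refine (norm_add_le _ _).trans ?_
      rw [norm_mul, Complex.norm_I, mul_one, Complex.norm_real, Complex.norm_real,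
        Real.norm_of_nonneg (by linarith), Real.norm_of_nonneg hh0.le]
    have h4 : ‖s‖ ≤ R + (σ₁ / 2 + h) := by
      have := norm_add_le (s - z) z
      rw [sub_add_cancel, hs] at this
      linarith
    refine ⟨(by linarith : H ≤ s.im).trans (le_abs_self _), ?_⟩
    have : Real.log ((h + R) ^ 2) = 2 * l := by rw [Real.log_pow]; push_cast; rfl
    rw [← this]
    exact Real.log_le_log (by positivity) (by nlinarith)
  set w : ℂ → ℝ := fun u => (analyticOrderNatAt F u : ℝ) with hw
  have hw0 : ∀ u, 0 ≤ w u := fun u => Nat.cast_nonneg _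
  set Φ₁ : ℂ → ℝ := fun s => ∑ u ∈ S₁, w u * |Real.log ‖s - u‖| with hΦ₁
  set Φ₂ : ℂ → ℝ := fun s => ∑ u ∈ S₂, w u * |Real.log ‖s - conj u‖| with hΦ₂
  have hΦ₁0 : ∀ s, 0 ≤ Φ₁ s := fun s =>
    Finset.sum_nonneg fun u _ => mul_nonneg (hw0 u) (abs_nonneg _)
  have hΦ₂0 : ∀ s, 0 ≤ Φ₂ s := fun s =>
    Finset.sum_nonneg fun u _ => mul_nonneg (hw0 u) (abs_nonneg _)
  set v : ℂ → ℝ := fun s => Real.log ‖completed σ₁ d F s‖ -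
    Real.log ‖completed σ₁ d F (conj s)‖ with hv
  -- the pointwise estimate off the zeros
  have hpt : ∀ s ∈ sphere z R, F s ≠ 0 → F (conj s) ≠ 0 →
      |v s| ≤ (3 * (C₁ + C₂) + 2 * C) * l + (Φ₁ s + Φ₂ s) := by
    intro s hs h1 h2
    obtain ⟨hsH, hsl⟩ := hsph s hs
    have p1 := hΦ₁0 s
    have p2 := hΦ₂0 s
    have q1 : C₁ * (1 + Real.log (1 + ‖s‖)) ≤ C₁ * (3 * l) := by gcongr; linarith
    have q2 : C₂ * (1 + Real.log (1 + ‖s‖)) ≤ C₂ * (3 * l) := by gcongr; linarith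
    have q3 : 0 ≤ C₁ * l := by positivity
    have q4 : 0 ≤ C₂ * l := by positivity
    have q5 : 0 ≤ C * l := by positivity
    rcases le_or_gt |s.re - σ₁ / 2| (σ₀ + 1 - σ₁ / 2) with hre | hre
    · have hs' : conj s ∈ sphere (conj z) R := by
        rw [mem_sphere_iff_norm] at hs ⊢
        rw [← map_sub, RCLike.norm_conj, hs]
      have k1 := a3 s hs hre h1
      have k2 := b3 (conj s) hs' (by simpa using hre) h2
      have e : ∑ u ∈ S₂, (analyticOrderNatAt F u : ℝ) * |Real.log ‖conj s - u‖| = Φ₂ s := by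
        refine Finset.sum_congr rfl fun u _ => ?_
        rw [← RCLike.norm_conj (conj s - u), map_sub, Complex.conj_conj]
      rw [e] at k2
      have k3 := hin s (by
        have := (abs_le.1 hre).1
        linarith [le_abs_self (σ₀ + 1)]) hsH h1 h2
      linarith
    · have k3 := hout s hsH hre
      linarith
  -- the exceptional points are finite in number
  have hRabs : |R| = R := abs_of_pos hR0
  have hfin : {s | s ∈ sphere z R ∧ (F s = 0 ∨ F (conj s) = 0)}.Finite := by
    have hZ := finite_zerosUpTo hF (h + R)
    refine (hZ.union (hZ.image conj)).subset fun s hs => ?_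
    have hsH := (hsph s hs.1).1
    have him : |s.im| ≤ h + R := by
      have h1 := hs.1
      rw [mem_sphere_iff_norm] at h1
      have h2 := Complex.abs_im_le_norm (s - z)
      have e : (s - z).im = s.im - h := by simp [hz]
      rw [e, h1] at h2
      rw [abs_le] at h2 ⊢
      constructor <;> linarith
    rcases hs.2 with h1 | h1
    · exact Or.inl ⟨hH.mem_nontrivialZeros hF hsH h1, him⟩
    · exact Or.inr ⟨conj s, ⟨hH.mem_nontrivialZeros hF (by simpa using hsH) h1,
        by simpa using him⟩, Complex.conj_conj s⟩
  have hint1 : CircleIntegrable (fun s => Real.log ‖completed σ₁ d F s‖) z R :=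
    MeromorphicOn.circleIntegrable_log_norm fun s _ => meromorphic_completed hF s
  have hint2 : CircleIntegrable (fun s => Real.log ‖completed σ₁ d F (σ₁ - s)‖) z R := by
    refine MeromorphicOn.circleIntegrable_log_norm (f := fun s => completed σ₁ d F (σ₁ - s))
      fun s _ => ?_
    exact (meromorphic_completed hF (σ₁ - s)).comp_analyticAt (f := completed σ₁ d F)
      (g := fun s : ℂ => (σ₁ : ℂ) - s) (by fun_prop)
  have hrefl : Set.EqOn (fun s => Real.log ‖completed σ₁ d F (conj s)‖)
      (fun s => Real.log ‖completed σ₁ d F (σ₁ - s)‖) (sphere z |R|) := by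
    intro s hs
    rw [hRabs] at hs
    have := hH.functional_equation hF (s := conj s) (by simpa using (hsph s hs).1)
    rw [Complex.conj_conj] at this
    simp only [this]
  have hveq : Set.EqOn v (fun s => Real.log ‖completed σ₁ d F s‖ -
      Real.log ‖completed σ₁ d F (σ₁ - s)‖) (sphere z |R|) := fun s hs => by
    have := hrefl hs
    simp only at this
    simp only [hv, this]
  have hvint : CircleIntegrable (fun s => Real.log ‖completed σ₁ d F s‖ -
      Real.log ‖completed σ₁ d F (σ₁ - s)‖) z R := hint1.sub hint2
  rw [circleAverage_conj, circleAverage_congr_sphere hrefl, ← circleAverage_fun_sub hint1 hint2]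
  refine abs_circleAverage_le_circleAverage_abs.trans ?_
  set Φ : ℂ → ℝ := fun s => (3 * (C₁ + C₂) + 2 * C) * l + (Φ₁ s + Φ₂ s) with hΦ
  have i1 : CircleIntegrable Φ₁ z R := circleIntegrable_sum_abs_log S₁ w (fun u => u) z R
  have i2 : CircleIntegrable Φ₂ z R := circleIntegrable_sum_abs_log S₂ w (fun u => conj u) z R
  have i12 : CircleIntegrable (fun s => Φ₁ s + Φ₂ s) z R := i1.add i2
  have i0 : CircleIntegrable (fun _ : ℂ => (3 * (C₁ + C₂) + 2 * C) * l) z R :=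
    circleIntegrable_const _ _ _
  have hcd : (|fun s => Real.log ‖completed σ₁ d F s‖ - Real.log ‖completed σ₁ d F (σ₁ - s)‖|)
      =ᶠ[codiscreteWithin (sphere z |R|)] fun s => min |Real.log ‖completed σ₁ d F s‖ -
        Real.log ‖completed σ₁ d F (σ₁ - s)‖| (Φ s) := by
    filter_upwards [compl_finite_mem_codiscreteWithin hfin,
      self_mem_codiscreteWithin (sphere z |R|)] with s hs hsS
    have e := hveq hsS
    simp only at e
    rw [hRabs] at hsS
    have hs' : ¬ (F s = 0 ∨ F (conj s) = 0) := fun h => hs ⟨hsS, h⟩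
    push Not at hs'
    have := hpt s hsS hs'.1 hs'.2
    rw [e] at this
    exact (min_eq_left this).symm
  have hav : circleAverage Φ z R ≤ (3 * (C₁ + C₂) + 2 * C + 8 * C) * l ^ 2 := by
    rw [hΦ, circleAverage_fun_add i0 i12, circleAverage_const, circleAverage_fun_add i1 i2]
    have k1 := circleAverage_sum_abs_log_le (S := S₁) hw0 (g := fun u => u) (z := z)
      (by linarith : 1 ≤ R) a1
    have k2 := circleAverage_sum_abs_log_le (S := S₂) hw0 (g := fun u => conj u) (z := z)
      (by linarith : 1 ≤ R) (fun u hu => by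
        rw [← RCLike.norm_conj, map_sub, Complex.conj_conj]; exact b1 u hu)
    have hlR : 0 ≤ Real.log (3 * R) := Real.log_nonneg (by linarith)
    have k3 : (∑ u ∈ S₁, w u) * (2 * Real.log (3 * R)) ≤ C * l * (2 * (2 * l)) := by gcongr
    have k4 : (∑ u ∈ S₂, w u) * (2 * Real.log (3 * R)) ≤ C * l * (2 * (2 * l)) := by gcongr
    have k5 : (3 * (C₁ + C₂) + 2 * C) * l ≤ (3 * (C₁ + C₂) + 2 * C) * l ^ 2 := by
      gcongr
      nlinarith
    linarith
  rw [circleAverage_congr_codiscreteWithin hcd hR0.ne']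
  refine le_trans (circleAverage_mono ?_ (i0.add i12) fun s _ => min_le_right _ _) hav
  exact CircleIntegrable.congr_codiscreteWithin hcd hvint.abs

end

end

/-! ### Zeros in the upper and in the lower half-plane -/

section

open Metric Real

lemma mem_closedBall_iff_sq {c h R : ℝ} (hR : 0 ≤ R) {ρ : ℂ} :
    ρ ∈ closedBall ((c : ℂ) + h * Complex.I) R ↔ (ρ.re - c) ^ 2 + (ρ.im - h) ^ 2 ≤ R ^ 2 := by
  rw [mem_closedBall, dist_eq_norm, ← sq_le_sq₀ (norm_nonneg _) hR, Complex.sq_norm,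
    Complex.normSq_apply]
  simp [sq]

/-- The zeros at height between `0` and `T` are, up to a thin set, those in a disc whose vertical
diameter falls short of the segment from `T₀` to `T` by `√T` at either end. The sign `ε` selects
the upper or the lower half-plane. -/
lemma FiniteInStrips.massOn_le_massOn_closedBall_add {m : ℂ → ℕ} (hm : FiniteInStrips m) {C : ℝ}
    (hC : 0 ≤ C)
    (hwin : ∀ a : ℝ, massOn m {ρ | a ≤ ρ.im ∧ ρ.im ≤ a + 1} ≤ C * Real.log (|a| + 2))
    {X : ℝ} (hX : ∀ ρ, m ρ ≠ 0 → |ρ.re| ≤ X) {ε : ℝ} (hε : ε = 1 ∨ ε = -1) {c T₀ T δ R : ℝ}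
    (hT₀ : 0 ≤ T₀) (hδ : 0 ≤ δ) (hRdef : R = (T - T₀) / 2 - δ)
    (hR : (X + |c|) ^ 2 + 1 ≤ R) :
    massOn m {ρ | 0 < ε * ρ.im ∧ ε * ρ.im ≤ T} ≤
      massOn m (closedBall ((c : ℂ) + (ε * ((T + T₀) / 2) : ℝ) * Complex.I) R) +
        (T₀ + 2 * δ + 4) * (C * Real.log (T + 3)) := by
  have hR1 : 1 ≤ R := by nlinarith [sq_nonneg (X + |c|)]
  have hεsq : ε * ε = 1 := by rcases hε with rfl | rfl <;> norm_num
  have hfinε : ∀ a b : ℝ, {ρ : ℂ | ρ ∈ {ρ : ℂ | a ≤ ε * ρ.im ∧ ε * ρ.im ≤ b} ∧ m ρ ≠ 0}.Finite := by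
    intro a b
    refine hm.finite (|a| + |b|) fun ρ hρ => ?_
    have : |ρ.im| = |ε * ρ.im| := by rcases hε with rfl | rfl <;> simp
    rw [this, abs_le]
    constructor <;>
      linarith [hρ.1, hρ.2, neg_abs_le a, le_abs_self b, abs_nonneg a, abs_nonneg b]
  have hIcc : ∀ a b : ℝ, 0 ≤ a → a ≤ b → b ≤ T →
      massOn m {ρ | a ≤ ε * ρ.im ∧ ε * ρ.im ≤ b} ≤ (b - a + 1) * (C * Real.log (T + 3)) := by
    intro a b ha hab hb
    rcases hε with rfl | rfl
    · simp only [one_mul]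
      exact hm.massOn_Icc_le hC hwin hab (by rw [abs_of_nonneg ha]; linarith)
        (by rw [abs_of_nonneg (by linarith)]; exact hb)
    · have := hm.massOn_Icc_le hC hwin (neg_le_neg hab)
        (by rw [abs_neg, abs_of_nonneg (by linarith)]; exact hb)
        (by rw [abs_neg, abs_of_nonneg ha]; linarith : |-a| ≤ T)
      refine (massOn_mono (hm.finite_Icc _ _) fun ρ hρ _ => ?_).trans (this.trans (le_of_eq ?_))
      · exact ⟨by linarith [hρ.2], by linarith [hρ.1]⟩
      · ring
  have h1 := hIcc 0 (T₀ + δ + 1) le_rfl (by linarith) (by linarith)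
  have h2 := hIcc (T - δ - 1) T (by linarith) (by linarith) le_rfl
  have hball : {ρ : ℂ | ρ ∈ closedBall ((c : ℂ) + (ε * ((T + T₀) / 2) : ℝ) * Complex.I) R ∧
      m ρ ≠ 0}.Finite := by
    refine hm.finite (R + |ε * ((T + T₀) / 2)|) fun ρ hρ => ?_
    rw [mem_closedBall, dist_eq_norm] at hρ
    have h3 := (Complex.abs_im_le_norm _).trans hρ
    have e : (ρ - ((c : ℂ) + (ε * ((T + T₀) / 2) : ℝ) * Complex.I)).im =
      ρ.im - ε * ((T + T₀) / 2) := by simp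
    rw [e] at h3
    have := abs_sub_abs_le_abs_sub ρ.im (ε * ((T + T₀) / 2))
    linarith
  have key : massOn m {ρ | 0 < ε * ρ.im ∧ ε * ρ.im ≤ T} ≤
      massOn m (closedBall ((c : ℂ) + (ε * ((T + T₀) / 2) : ℝ) * Complex.I) R ∪
        {ρ | 0 ≤ ε * ρ.im ∧ ε * ρ.im ≤ T₀ + δ + 1}) +
      massOn m {ρ | T - δ - 1 ≤ ε * ρ.im ∧ ε * ρ.im ≤ T} := by
    refine massOn_le_add ?_ (hfinε _ _) fun ρ hρ h0 => ?_
    · refine (hball.union (hfinε 0 (T₀ + δ + 1))).subset fun ρ hρ => ?_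
      rcases hρ.1 with h | h
      · exact Or.inl ⟨h, hρ.2⟩
      · exact Or.inr ⟨h, hρ.2⟩
    · rcases le_or_gt (ε * ρ.im) (T₀ + δ + 1) with h3 | h3
      · exact Or.inl (Or.inr ⟨hρ.1.le, h3⟩)
      rcases le_or_gt (T - δ - 1) (ε * ρ.im) with h4 | h4
      · exact Or.inr ⟨h4, hρ.2⟩
      refine Or.inl (Or.inl ?_)
      rw [mem_closedBall_iff_sq (by linarith)]
      have e1 : (ρ.im - ε * ((T + T₀) / 2)) ^ 2 = (ε * ρ.im - (T + T₀) / 2) ^ 2 := by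
        linear_combination (-(ρ.im ^ 2) + ((T + T₀) / 2) ^ 2) * hεsq
      have e2 : (ε * ρ.im - (T + T₀) / 2) ^ 2 ≤ (R - 1) ^ 2 := by
        rw [sq_le_sq, abs_of_nonneg (by linarith : 0 ≤ R - 1), abs_le]
        constructor <;> linarith
      have e3 : (ρ.re - c) ^ 2 ≤ (X + |c|) ^ 2 := by
        have := abs_sub ρ.re c
        have := hX ρ h0
        rw [sq_le_sq, abs_of_nonneg (by linarith [abs_nonneg ρ.re, abs_nonneg c] : 0 ≤ X + |c|)]
        linarith
      rw [e1]
      nlinarith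
  have key2 : massOn m (closedBall ((c : ℂ) + (ε * ((T + T₀) / 2) : ℝ) * Complex.I) R ∪
      {ρ | 0 ≤ ε * ρ.im ∧ ε * ρ.im ≤ T₀ + δ + 1}) ≤
      massOn m (closedBall ((c : ℂ) + (ε * ((T + T₀) / 2) : ℝ) * Complex.I) R) +
      massOn m {ρ | 0 ≤ ε * ρ.im ∧ ε * ρ.im ≤ T₀ + δ + 1} :=
    massOn_le_add hball (hfinε _ _) fun ρ hρ _ => hρ
  have hlog : 0 ≤ C * Real.log (T + 3) := mul_nonneg hC (Real.log_nonneg (by linarith))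
  linarith

section

variable {σ₀ σ₁ : ℝ} {F : ℂ → ℂ} {d : CompletionData}

lemma mul_sqrt_mul_log_sq_le {K T : ℝ} (hK : 0 ≤ K) (hT : 0 ≤ T) :
    K * (√(T + 3) * Real.log (T + 3) ^ 2) ≤ (192 * K) * (1 + T) ^ (3 / 4 : ℝ) := by
  have h0 : 0 < T + 3 := by linarith
  have h1 : Real.log (T + 3) ≤ 8 * (T + 3) ^ (1 / 8 : ℝ) := by
    have := Real.log_le_rpow_div h0.le (by norm_num : (0 : ℝ) < 1 / 8)
    linarith
  have h2 : Real.log (T + 3) ^ 2 ≤ 64 * (T + 3) ^ (1 / 4 : ℝ) := by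
    calc Real.log (T + 3) ^ 2 ≤ (8 * (T + 3) ^ (1 / 8 : ℝ)) ^ 2 :=
          pow_le_pow_left₀ (Real.log_nonneg (by linarith)) h1 2
      _ = _ := by
        rw [mul_pow, ← Real.rpow_natCast ((T + 3) ^ (1 / 8 : ℝ)), ← Real.rpow_mul h0.le]
        norm_num
  have h3 : √(T + 3) * (T + 3) ^ (1 / 4 : ℝ) = (T + 3) ^ (3 / 4 : ℝ) := by
    rw [Real.sqrt_eq_rpow, ← Real.rpow_add h0]
    norm_num
  have h4 : (T + 3) ^ (3 / 4 : ℝ) ≤ 3 * (1 + T) ^ (3 / 4 : ℝ) := by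
    calc (T + 3) ^ (3 / 4 : ℝ) ≤ (3 * (1 + T)) ^ (3 / 4 : ℝ) := by
          gcongr
          linarith
      _ = 3 ^ (3 / 4 : ℝ) * (1 + T) ^ (3 / 4 : ℝ) :=
          Real.mul_rpow (by norm_num) (by linarith)
      _ ≤ _ := by
        gcongr
        calc (3 : ℝ) ^ (3 / 4 : ℝ) ≤ 3 ^ (1 : ℝ) :=
              Real.rpow_le_rpow_of_exponent_le (by norm_num) (by norm_num)
          _ = 3 := Real.rpow_one 3
  calc K * (√(T + 3) * Real.log (T + 3) ^ 2)
      ≤ K * (√(T + 3) * (64 * (T + 3) ^ (1 / 4 : ℝ))) := by gcongr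
    _ = 64 * K * (T + 3) ^ (3 / 4 : ℝ) := by rw [← h3]; ring
    _ ≤ 64 * K * (3 * (1 + T) ^ (3 / 4 : ℝ)) := by gcongr
    _ = _ := by ring

/-- Jensen's formula for `ξ` on two concentric circles in either half-plane, where `ε` selects the
half-plane, in terms of the number of zeros at height between `0` and `T`. -/
lemma IsHeight.mul_massOn_bounds (hF : IsSharpFlat σ₀ σ₁ F d) {H : ℝ} (hH : IsHeight σ₁ d H)
    {C : ℝ} (hC : 0 ≤ C) (hwin : ∀ a : ℝ, massOn (zeroMultiplicity σ₁ d F)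
      {ρ | a ≤ ρ.im ∧ ρ.im ≤ a + 1} ≤ C * Real.log (|a| + 2))
    {X : ℝ} (hX : ∀ ρ, zeroMultiplicity σ₁ d F ρ ≠ 0 → |ρ.re| ≤ X) {ε : ℝ} (hε : ε = 1 ∨ ε = -1)
    {c T₀ T δ R₁ R₂ h : ℝ} (hT₀ : H + 1 ≤ T₀) (hδ : 0 ≤ δ) (hh : h = (T + T₀) / 2)
    (hR₂ : R₂ = (T - T₀) / 2) (hR₁ : R₁ = R₂ - δ) (hR : (X + |c|) ^ 2 + 1 ≤ R₁) :
    Real.log (R₂ / R₁) * massOn (zeroMultiplicity σ₁ d F) {ρ | 0 < ε * ρ.im ∧ ε * ρ.im ≤ T} ≤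
      circleAverage (fun s => Real.log ‖completed σ₁ d F s‖)
          ((c : ℂ) + (ε * h : ℝ) * Complex.I) R₂ -
        circleAverage (fun s => Real.log ‖completed σ₁ d F s‖)
          ((c : ℂ) + (ε * h : ℝ) * Complex.I) R₁ +
        Real.log (R₂ / R₁) * ((T₀ + 2 * δ + 4) * (C * Real.log (T + 3))) ∧
    circleAverage (fun s => Real.log ‖completed σ₁ d F s‖)
        ((c : ℂ) + (ε * h : ℝ) * Complex.I) R₂ -
      circleAverage (fun s => Real.log ‖completed σ₁ d F s‖)
        ((c : ℂ) + (ε * h : ℝ) * Complex.I) R₁ ≤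
      Real.log (R₂ / R₁) *
        massOn (zeroMultiplicity σ₁ d F) {ρ | 0 < ε * ρ.im ∧ ε * ρ.im ≤ T} := by
  have hm := finiteInStrips_zeroMultiplicity hF
  set m := zeroMultiplicity σ₁ d F with hmdef
  have hH1 := hH.1
  have hR₁0 : 0 < R₁ := by nlinarith [sq_nonneg (X + |c|)]
  have hR₁₂ : R₁ ≤ R₂ := by linarith
  have hl0 : 0 ≤ Real.log (R₂ / R₁) := Real.log_nonneg ((one_le_div hR₁0).2 hR₁₂)
  have him : ∀ ρ ∈ closedBall ((c : ℂ) + (ε * h : ℝ) * Complex.I) R₂,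
      T₀ ≤ ε * ρ.im ∧ ε * ρ.im ≤ T := by
    intro ρ hρ
    rw [mem_closedBall, dist_eq_norm] at hρ
    have h3 := (Complex.abs_im_le_norm _).trans hρ
    have e : (ρ - ((c : ℂ) + (ε * h : ℝ) * Complex.I)).im = ρ.im - ε * h := by simp
    have e2 : |ρ.im - ε * h| = |ε * ρ.im - h| := by
      rcases hε with rfl | rfl
      · simp
      · rw [← abs_neg]
        congr 1
        ring
    rw [e, e2, abs_le] at h3
    constructor <;> linarith [h3.1, h3.2]
  have habs : ∀ ρ : ℂ, |ρ.im| = |ε * ρ.im| := by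
    intro ρ
    rcases hε with rfl | rfl <;> simp
  have hfin2 : {ρ | ρ ∈ closedBall ((c : ℂ) + (ε * h : ℝ) * Complex.I) R₂ ∧ m ρ ≠ 0}.Finite :=
    hm.finite T fun ρ hρ => by
      have := him ρ hρ
      rw [habs, abs_le]
      constructor <;> linarith
  have hfin3 : {ρ : ℂ | ρ ∈ {ρ : ℂ | 0 < ε * ρ.im ∧ ε * ρ.im ≤ T} ∧ m ρ ≠ 0}.Finite :=
    hm.finite T fun ρ hρ => by
      rw [habs, abs_le]
      constructor <;> linarith [hρ.1, hρ.2]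
  obtain ⟨j1, j2⟩ := circleAverage_sub_circleAverage_bounds (f := completed σ₁ d F) (m := m)
    (z := (c : ℂ) + (ε * h : ℝ) * Complex.I) hR₁0 hR₁₂
    (fun s _ => meromorphic_completed hF s)
    (fun R hR ρ hρ => hH.divisor_eq hF hρ (by
      rw [habs]
      have := (him ρ (closedBall_subset_closedBall hR hρ)).1
      exact le_trans (by linarith) (le_abs_self _))) hfin2
  constructor
  · have k := hm.massOn_le_massOn_closedBall_add hC hwin hX hε (c := c) (T₀ := T₀) (T := T)
      (δ := δ) (R := R₁) (by linarith) hδ (by rw [hR₁, hR₂]) (by linarith)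
    rw [← hh] at k
    have k2 := mul_le_mul_of_nonneg_left k hl0
    rw [mul_add] at k2
    linarith
  · refine j2.trans (mul_le_mul_of_nonneg_left ?_ hl0)
    exact massOn_mono hfin3 fun ρ hρ _ => ⟨by linarith [(him ρ hρ).1], (him ρ hρ).2⟩

/-- If `l a` and `l b` are determined by `p₂ - p₁` and `q₂ - q₁` up to `l W`, and `l ≥ 2 / δ`, then
`a - b` is controlled by the differences `pᵢ - qᵢ`. -/
lemma abs_sub_le_of_mul_bounds {l δ a b W E p₁ p₂ q₁ q₂ : ℝ} (hl : 0 < l) (hδ : 2 ≤ l * δ)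
    (hE : 0 ≤ E) (ha : l * a ≤ p₂ - p₁ + l * W) (ha' : p₂ - p₁ ≤ l * a)
    (hb : l * b ≤ q₂ - q₁ + l * W) (hb' : q₂ - q₁ ≤ l * b) (h₂ : |p₂ - q₂| ≤ E)
    (h₁ : |p₁ - q₁| ≤ E) : |a - b| ≤ W + δ * E := by
  obtain ⟨b1, b2⟩ := abs_le.1 h₁
  obtain ⟨b3, b4⟩ := abs_le.1 h₂
  have hδE : 2 * E ≤ l * δ * E := mul_le_mul_of_nonneg_right hδ hE
  refine le_of_mul_le_mul_left ?_ hl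
  rw [← abs_of_pos hl, ← abs_mul, abs_of_pos hl, abs_le]
  constructor <;> linarith

/-- The two half-planes are described uniformly by the signs `1` and `-1`. -/
lemma discrepancy_eq_sub (m : ℂ → ℕ) (T : ℝ) : discrepancy m T =
    massOn m {ρ | 0 < 1 * ρ.im ∧ 1 * ρ.im ≤ T} - massOn m {ρ | 0 < -1 * ρ.im ∧ -1 * ρ.im ≤ T} := by
  rw [discrepancy]
  congr 2
  · ext ρ; simp
  · ext ρ
    simp only [Set.mem_ofPred_eq]
    constructor <;> rintro ⟨h1, h2⟩ <;> constructor <;> linarith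

/-- Jensen's formula on circles of radii about `T / 2` and `T / 2 - √T` counts the zeros in either
half-plane, and conjugating the circles changes the means involved by `O(log² T)` only. -/
lemma IsHeight.exists_abs_discrepancy_le_of_le (hσ : σ₁ ≤ σ₀) (hσ₁ : 0 < σ₁)
    (hF : IsSharpFlat σ₀ σ₁ F d) {H : ℝ} (hH : IsHeight σ₁ d H) :
    ∃ C C' T₀ T₁ : ℝ, 0 ≤ C ∧ 0 ≤ C' ∧ 0 ≤ T₀ ∧ 64 ≤ T₁ ∧ ∀ T : ℝ, T₁ ≤ T →
      |discrepancy (zeroMultiplicity σ₁ d F) T| ≤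
        (T₀ + 2 * √T + 4) * (C * Real.log (T + 3)) + √T * (C' * Real.log (T + 3) ^ 2) := by
  obtain ⟨X, hX⟩ := exists_abs_re_le_of_mem_nontrivialZeros hF
  obtain ⟨C, hC, hwin⟩ := exists_massOn_window_le hF
  obtain ⟨C', T₀, hC', hT₀, havg⟩ := hH.exists_abs_circleAverage_sub_le hσ hσ₁ hF
  have hXm : ∀ ρ, zeroMultiplicity σ₁ d F ρ ≠ 0 → |ρ.re| ≤ X :=
    fun ρ h => hX ρ ((mem_nontrivialZeros_iff hF).2 h)
  have hH1 := hH.1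
  obtain ⟨c, hc⟩ : ∃ c : ℝ, c = σ₁ / 2 := ⟨_, rfl⟩
  rw [← hc] at havg
  obtain ⟨B, hB⟩ : ∃ B : ℝ, B = (X + |c|) ^ 2 + 1 := ⟨_, rfl⟩
  have hB1 : 1 ≤ B := by nlinarith [sq_nonneg (X + |c|)]
  refine ⟨C, C', T₀, 4 * T₀ + 4 * B + 64, hC, hC', by linarith, by linarith, fun T hTT => ?_⟩
  have hT : 0 ≤ T := by linarith
  obtain ⟨δ, hδ⟩ : ∃ δ, δ = √T := ⟨_, rfl⟩
  rw [← hδ]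
  have hδsq : δ ^ 2 = T := by rw [hδ, Real.sq_sqrt hT]
  have hδ0 : 0 ≤ δ := hδ ▸ Real.sqrt_nonneg T
  have hδ8 : 8 ≤ δ := by nlinarith
  obtain ⟨R₂, hR₂⟩ : ∃ R₂, R₂ = (T - T₀) / 2 := ⟨_, rfl⟩
  obtain ⟨R₁, hR₁⟩ : ∃ R₁, R₁ = R₂ - δ := ⟨_, rfl⟩
  obtain ⟨h, hh⟩ : ∃ h, h = (T + T₀) / 2 := ⟨_, rfl⟩
  have hR₁B : B + T₀ ≤ R₁ := by nlinarith
  have hR₁0 : 0 < R₁ := by linarith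
  have hR₁₂ : R₁ ≤ R₂ := by linarith
  have hR₂0 : 0 < R₂ := by linarith
  -- `log (R₂ / R₁) ≥ 1 - R₁ / R₂ = √T / R₂ ≥ 2 / √T`
  have hlge : 2 ≤ Real.log (R₂ / R₁) * δ := by
    have h1 := Real.one_sub_inv_le_log_of_pos (div_pos hR₂0 hR₁0)
    rw [inv_div] at h1
    have h2 : 1 - R₁ / R₂ = δ / R₂ := by
      field_simp
      linarith
    rw [h2] at h1
    have h3 : 2 ≤ δ / R₂ * δ := by
      rw [div_mul_eq_mul_div, le_div_iff₀ hR₂0]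
      nlinarith
    exact h3.trans (mul_le_mul_of_nonneg_right h1 hδ0)
  have hl0 : 0 < Real.log (R₂ / R₁) := by
    by_contra! hcon
    nlinarith
  have hjen := fun ε hε => hH.mul_massOn_bounds hF hC hwin hXm (ε := ε) hε (c := c) (T₀ := T₀)
    (T := T) hT₀ hδ0 hh hR₂ hR₁ (by linarith)
  obtain ⟨p1, p2⟩ := hjen 1 (Or.inl rfl)
  obtain ⟨n1, n2⟩ := hjen (-1) (Or.inr rfl)
  have hlogle : ∀ R, 0 < R → R ≤ R₂ → C' * Real.log (h + R) ^ 2 ≤ C' * Real.log (T + 3) ^ 2 := by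
    intro R h0 hR
    have : 0 ≤ Real.log (h + R) := Real.log_nonneg (by linarith)
    have h2 := Real.log_le_log (by linarith) (by linarith : h + R ≤ T + 3)
    gcongr
  have a1 := (havg h R₁ (by linarith) (by linarith)).trans (hlogle R₁ hR₁0 hR₁₂)
  have a2 := (havg h R₂ (by linarith) (by linarith)).trans (hlogle R₂ hR₂0 le_rfl)
  rw [one_mul] at p1 p2
  rw [neg_one_mul] at n1 n2
  rw [discrepancy_eq_sub]
  exact abs_sub_le_of_mul_bounds hl0 hlge (by positivity) p1 p2 n1 n2 a2 a1

/-- The non-trivial zeros are nearly equidistributed between the two half-planes. -/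
lemma exists_abs_discrepancy_le (hσ : σ₁ ≤ σ₀) (hσ₁ : 0 < σ₁) (hF : IsSharpFlat σ₀ σ₁ F d) :
    ∃ C : ℝ, ∀ T : ℝ, 0 ≤ T →
      |discrepancy (zeroMultiplicity σ₁ d F) T| ≤ C * (1 + T) ^ (3 / 4 : ℝ) := by
  obtain ⟨H, hH⟩ := exists_height hF
  obtain ⟨C, C', T₀, T₁, hC, hC', hT₀, hT₁, hbig⟩ :=
    hH.exists_abs_discrepancy_le_of_le hσ hσ₁ hF
  have hm := finiteInStrips_zeroMultiplicity hF
  set m := zeroMultiplicity σ₁ d F with hmdef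
  obtain ⟨M, hM⟩ : ∃ M, M = massOn m {ρ | -T₁ ≤ ρ.im ∧ ρ.im ≤ T₁} := ⟨_, rfl⟩
  have hM0 : 0 ≤ M := hM ▸ massOn_nonneg _
  obtain ⟨K, hK⟩ : ∃ K, K = (T₀ + 6) * C + C' := ⟨_, rfl⟩
  have hK0 : 0 ≤ K := by rw [hK]; positivity
  refine ⟨M + 192 * K, fun T hT => ?_⟩
  have hpow : 1 ≤ (1 + T) ^ (3 / 4 : ℝ) := Real.one_le_rpow (by linarith) (by norm_num)
  rcases le_total T T₁ with hTT | hTT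
  · have h1 : massOn m {ρ | 0 < 1 * ρ.im ∧ 1 * ρ.im ≤ T} ≤ M := by
      rw [hM]
      exact massOn_mono (hm.finite_Icc _ _) fun ρ hρ _ => by
        constructor <;> linarith [hρ.1, hρ.2]
    have h2 : massOn m {ρ | 0 < -1 * ρ.im ∧ -1 * ρ.im ≤ T} ≤ M := by
      rw [hM]
      exact massOn_mono (hm.finite_Icc _ _) fun ρ hρ _ => by
        constructor <;> linarith [hρ.1, hρ.2]
    have h3 : |discrepancy m T| ≤ M := by
      rw [discrepancy_eq_sub, abs_le]
      constructor <;> linarith [massOn_nonneg (m := m) {ρ | 0 < 1 * ρ.im ∧ 1 * ρ.im ≤ T},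
        massOn_nonneg (m := m) {ρ | 0 < -1 * ρ.im ∧ -1 * ρ.im ≤ T}]
    calc |discrepancy m T| ≤ M * 1 + 0 := by linarith
      _ ≤ M * (1 + T) ^ (3 / 4 : ℝ) + 192 * K * (1 + T) ^ (3 / 4 : ℝ) := by gcongr; positivity
      _ = _ := by ring
  · have hmain := hbig T hTT
    have hsq : √T ≤ √(T + 3) := Real.sqrt_le_sqrt (by linarith)
    have hsq1 : 1 ≤ √(T + 3) := Real.one_le_sqrt.2 (by linarith)
    have hL1 : 1 ≤ Real.log (T + 3) := by
      rw [Real.le_log_iff_exp_le (by linarith)]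
      linarith [Real.exp_one_lt_d9]
    set L := Real.log (T + 3) with hL
    have e1 : (T₀ + 2 * √T + 4) * (C * L) ≤ ((T₀ + 6) * √(T + 3)) * (C * L ^ 2) := by
      have h1 : L ≤ L ^ 2 := by nlinarith
      have h2 : T₀ + 2 * √T + 4 ≤ (T₀ + 6) * √(T + 3) := by nlinarith
      gcongr
    have e2 : √T * (C' * L ^ 2) ≤ √(T + 3) * (C' * L ^ 2) := by gcongr
    have e3 := mul_sqrt_mul_log_sq_le hK0 hT
    have e4 : K * (√(T + 3) * L ^ 2) =
        ((T₀ + 6) * √(T + 3)) * (C * L ^ 2) + √(T + 3) * (C' * L ^ 2) := by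
      rw [hK]; ring
    have e5 : 0 ≤ M * (1 + T) ^ (3 / 4 : ℝ) := by positivity
    linarith

end

end

/-! ### The summands of the Li coefficient -/

lemma norm_one_add_pow_sub_le (n : ℕ) {x : ℂ} (hx : ‖x‖ ≤ 1) :
    ‖(1 + x) ^ n - 1 - n * x‖ ≤ 3 ^ n * ‖x‖ ^ 2 := by
  induction n with
  | zero => simp
  | succ n ih =>
    have e : (1 + x) ^ (n + 1) - 1 - ((n + 1 : ℕ) : ℂ) * x =
        (1 + x) * ((1 + x) ^ n - 1 - n * x) + n * x ^ 2 := by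
      push_cast
      ring
    have h1 : ‖1 + x‖ ≤ 2 := by
      refine (norm_add_le _ _).trans ?_
      rw [norm_one]
      linarith
    have h2 : (n : ℝ) ≤ 3 ^ n := by exact_mod_cast (Nat.lt_pow_self (by norm_num : 1 < 3)).le
    rw [e]
    refine (norm_add_le _ _).trans ?_
    rw [norm_mul, norm_mul, norm_pow, Complex.norm_natCast]
    calc ‖1 + x‖ * ‖(1 + x) ^ n - 1 - n * x‖ + n * ‖x‖ ^ 2
        ≤ 2 * (3 ^ n * ‖x‖ ^ 2) + 3 ^ n * ‖x‖ ^ 2 := by gcongr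
      _ = _ := by ring

/-- The term `sgn (Im ρ) / (1 + |Im ρ|)`, a version of `1 / Im ρ` without a singularity. -/
noncomputable def signTerm (ρ : ℂ) : ℝ := (SignType.sign ρ.im : ℝ) * (1 + |ρ.im|)⁻¹

/-- In a vertical strip `1 / (ρ - τ)` is `1 / (i Im ρ)` up to `O(|Im ρ|⁻²)`. -/
lemma norm_inv_sub_add_signTerm_le {X τ : ℝ} (hτ : 0 ≤ τ) {ρ : ℂ} (hX : |ρ.re| ≤ X)
    (hρ : 1 ≤ |ρ.im|) :
    ‖(ρ - τ)⁻¹ + Complex.I * signTerm ρ‖ ≤ (X + τ + 1) / |ρ.im| ^ 2 := by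
  have hγ0 : 0 < |ρ.im| := by linarith
  have hγ : ρ.im ≠ 0 := abs_pos.1 hγ0
  have hγC : (ρ.im : ℂ) ≠ 0 := by exact_mod_cast hγ
  have him : (ρ - τ).im = ρ.im := by simp
  have hle : |ρ.im| ≤ ‖ρ - τ‖ := by
    rw [← him]
    exact Complex.abs_im_le_norm _
  have hne : ρ - τ ≠ 0 := norm_pos_iff.1 (hγ0.trans_le hle)
  have h1 : ‖(ρ - τ)⁻¹ + Complex.I * (ρ.im : ℂ)⁻¹‖ ≤ (X + τ) / |ρ.im| ^ 2 := by
    have e : (ρ - τ)⁻¹ + Complex.I * (ρ.im : ℂ)⁻¹ =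
        Complex.I * ((ρ.re - τ : ℝ) : ℂ) / ((ρ - τ) * ρ.im) := by
      rw [eq_div_iff (mul_ne_zero hne hγC)]
      have h2 : ρ = ρ.re + ρ.im * Complex.I := (Complex.re_add_im ρ).symm
      field_simp
      push_cast
      linear_combination Complex.I * h2 + (ρ.im : ℂ) * Complex.I_sq
    rw [e, norm_div, norm_mul, norm_mul, Complex.norm_I, one_mul, Complex.norm_real,
      Complex.norm_real, Real.norm_eq_abs, Real.norm_eq_abs]
    have h3 : |ρ.re - τ| ≤ X + τ := by
      have := abs_sub ρ.re τ
      rw [abs_of_nonneg hτ] at this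
      linarith
    have h4 : |ρ.im| ^ 2 ≤ ‖ρ - τ‖ * |ρ.im| := by
      rw [sq]
      gcongr
    have h5 : 0 ≤ X + τ := (abs_nonneg _).trans h3
    gcongr
  have h2 : ‖Complex.I * ((signTerm ρ : ℂ) - (ρ.im : ℂ)⁻¹)‖ ≤ 1 / |ρ.im| ^ 2 := by
    have e : (ρ.im)⁻¹ = (SignType.sign ρ.im : ℝ) * |ρ.im|⁻¹ := by
      rcases lt_or_gt_of_ne hγ with h | h
      · rw [sign_neg h, abs_of_neg h, inv_neg]; simp
      · rw [sign_pos h, abs_of_pos h]; simp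
    rw [norm_mul, Complex.norm_I, one_mul, ← Complex.ofReal_inv, ← Complex.ofReal_sub,
      Complex.norm_real, signTerm, e, ← mul_sub, norm_mul]
    have hs : ‖(SignType.sign ρ.im : ℝ)‖ = 1 := by
      rcases lt_or_gt_of_ne hγ with h | h
      · rw [sign_neg h]; simp
      · rw [sign_pos h]; simp
    rw [hs, one_mul, Real.norm_eq_abs]
    have e2 : (1 + |ρ.im|)⁻¹ - |ρ.im|⁻¹ = -(1 / ((1 + |ρ.im|) * |ρ.im|)) := by
      field_simp
      ring
    rw [e2, abs_neg, abs_of_pos (by positivity), sq]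
    gcongr
    linarith
  calc ‖(ρ - τ)⁻¹ + Complex.I * signTerm ρ‖
      = ‖((ρ - τ)⁻¹ + Complex.I * (ρ.im : ℂ)⁻¹) +
          Complex.I * ((signTerm ρ : ℂ) - (ρ.im : ℂ)⁻¹)‖ := by ring_nf
    _ ≤ (X + τ) / |ρ.im| ^ 2 + 1 / |ρ.im| ^ 2 := (norm_add_le _ _).trans (add_le_add h1 h2)
    _ = _ := by rw [← add_div]

/-- The summand of the Li coefficient is, to first order, purely imaginary and odd in `Im ρ`. -/
lemma norm_liTerm_sub_le (n : ℕ) {X τ : ℝ} (hτ : 0 ≤ τ) {ρ : ℂ} (hX : |ρ.re| ≤ X)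
    (hρ : 1 ≤ |ρ.im|) (hρτ : τ ≤ |ρ.im|) :
    ‖liTerm n τ ρ - Complex.I * ((n * τ * signTerm ρ : ℝ) : ℂ)‖ ≤
      4 * (n * τ * (X + τ + 1) + 3 ^ n * τ ^ 2) * ((1 + |ρ.im|) ^ 2)⁻¹ := by
  have hγ0 : 0 < |ρ.im| := by linarith
  have hle : |ρ.im| ≤ ‖ρ - τ‖ := by
    have := Complex.abs_im_le_norm (ρ - τ)
    simpa using this
  have hn0 : 0 < ‖ρ - τ‖ := hγ0.trans_le hle
  have hne : ρ - τ ≠ 0 := norm_pos_iff.1 hn0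
  set x : ℂ := τ * (ρ - τ)⁻¹ with hx
  have hxn : ‖x‖ ≤ τ / |ρ.im| := by
    rw [hx, norm_mul, norm_inv, Complex.norm_real, Real.norm_of_nonneg hτ, div_eq_mul_inv]
    gcongr
  have hx1 : ‖x‖ ≤ 1 := hxn.trans ((div_le_one hγ0).2 hρτ)
  have h1 := norm_one_add_pow_sub_le n hx1
  have h2 := norm_inv_sub_add_signTerm_le hτ hX hρ
  have hX0 : 0 ≤ X := (abs_nonneg _).trans hX
  have e0 : ρ / (ρ - τ) = 1 + x := by
    rw [hx]
    field_simp
    ring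
  have e : liTerm n τ ρ - Complex.I * ((n * τ * signTerm ρ : ℝ) : ℂ) =
      -((1 + x) ^ n - 1 - n * x) - ((n * τ : ℝ) : ℂ) * ((ρ - τ)⁻¹ + Complex.I * signTerm ρ) := by
    rw [liTerm, e0, hx]
    push_cast
    ring
  have h3 : ‖((n * τ : ℝ) : ℂ) * ((ρ - τ)⁻¹ + Complex.I * signTerm ρ)‖ ≤
      n * τ * ((X + τ + 1) / |ρ.im| ^ 2) := by
    rw [norm_mul, Complex.norm_real, Real.norm_of_nonneg (by positivity)]
    gcongr
  have h4 : 3 ^ n * ‖x‖ ^ 2 ≤ 3 ^ n * (τ / |ρ.im|) ^ 2 := by gcongr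
  have h5 : (|ρ.im| ^ 2)⁻¹ ≤ 4 * ((1 + |ρ.im|) ^ 2)⁻¹ := by
    rw [← div_eq_mul_inv, inv_eq_one_div, div_le_div_iff₀ (by positivity) (by positivity)]
    nlinarith
  rw [e]
  calc _ ≤ 3 ^ n * (τ / |ρ.im|) ^ 2 + n * τ * ((X + τ + 1) / |ρ.im| ^ 2) := by
        refine (norm_sub_le _ _).trans ?_
        rw [norm_neg]
        linarith
    _ = (n * τ * (X + τ + 1) + 3 ^ n * τ ^ 2) * (|ρ.im| ^ 2)⁻¹ := by
        rw [div_pow, div_eq_mul_inv, div_eq_mul_inv]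
        ring
    _ ≤ (n * τ * (X + τ + 1) + 3 ^ n * τ ^ 2) * (4 * ((1 + |ρ.im|) ^ 2)⁻¹) := by gcongr
    _ = _ := by ring

lemma FiniteInStrips.tendsto_sum {m : ℂ → ℕ} (hm : FiniteInStrips m) {g : ℂ → ℂ}
    (hg : Summable fun ρ => (m ρ : ℝ) * ‖g ρ‖) :
    Tendsto (fun T : ℝ => ∑ ρ ∈ (hm T).toFinset, (m ρ : ℂ) * g ρ) atTop
      (𝓝 (∑' ρ, (m ρ : ℂ) * g ρ)) := by
  classical
  have e : ∀ T : ℝ, ∑ ρ ∈ (hm T).toFinset, (m ρ : ℂ) * g ρ =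
      ∑' ρ : ℂ, if |ρ.im| ≤ T then (m ρ : ℂ) * g ρ else 0 := by
    intro T
    rw [tsum_eq_sum (s := (hm T).toFinset)]
    · refine Finset.sum_congr rfl fun ρ hρ => ?_
      rw [if_pos]
      simp at hρ
      exact hρ.2
    · intro ρ hρ
      split_ifs with h
      · have : m ρ = 0 := by
          by_contra h0
          exact hρ (by simp [h0, h])
        simp [this]
      · rfl
  simp_rw [e]
  refine tendsto_tsum_of_dominated_convergence hg (fun ρ => ?_) (Eventually.of_forall fun T ρ => ?_)
  · refine tendsto_const_nhds.congr' ?_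
    filter_upwards [eventually_ge_atTop |ρ.im|] with T hT
    rw [if_pos hT]
  · split_ifs
    · rw [norm_mul, Complex.norm_natCast]
    · rw [norm_zero]
      positivity

section

variable {σ₀ σ₁ : ℝ} {F : ℂ → ℂ} {d : CompletionData}

lemma partialSum_eq_sum (hF : IsSharpFlat σ₀ σ₁ F d) (f : ℂ → ℂ) (T : ℝ) :
    partialSum σ₁ d F f T = ∑ ρ ∈ (finiteInStrips_zeroMultiplicity hF T).toFinset,
      (zeroMultiplicity σ₁ d F ρ : ℂ) * f ρ := by
  refine finsum_mem_eq_sum_of_inter_support_eq _ ?_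
  ext ρ
  simp [zerosUpTo, mem_nontrivialZeros_iff hF]

/-- What remains of the summand without its leading term is absolutely summable. -/
lemma summable_zeroMultiplicity_mul_norm (hσ₁ : 0 < σ₁) (hF : IsSharpFlat σ₀ σ₁ F d) (n : ℕ)
    {τ : ℝ} (hτ : σ₁ ≤ τ) : Summable fun ρ : ℂ => (zeroMultiplicity σ₁ d F ρ : ℝ) *
      ‖liTerm n τ ρ - Complex.I * ((n * τ * signTerm ρ : ℝ) : ℂ)‖ := by
  obtain ⟨X, hX⟩ := exists_abs_re_le_of_mem_nontrivialZeros hF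
  obtain ⟨C, -, hwin⟩ := exists_massOn_window_le hF
  have hm := finiteInStrips_zeroMultiplicity hF
  refine Summable.of_norm_bounded_eventually
    ((hm.summable_inv_sq hwin).mul_left (4 * (n * τ * (X + τ + 1) + 3 ^ n * τ ^ 2))) ?_
  rw [eventually_cofinite]
  refine (hm (1 + τ)).subset fun ρ hρ => ?_
  rw [Set.mem_ofPred_eq] at hρ ⊢
  by_contra hcon
  apply hρ
  rcases eq_or_ne (zeroMultiplicity σ₁ d F ρ) 0 with h | h
  · simp [h]
  · have h1 : 1 + τ < |ρ.im| := by
      by_contra! h2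
      exact hcon ⟨h, h2⟩
    have h2 := norm_liTerm_sub_le n (by linarith : 0 ≤ τ)
      (hX ρ ((mem_nontrivialZeros_iff hF).2 h)) (by linarith : 1 ≤ |ρ.im|) (by linarith)
    rw [norm_mul, norm_norm, Real.norm_natCast, mul_left_comm]
    gcongr

end

end TauLi

theorem mainTheorem5 (σ₀ σ₁ : ℝ) (hσ₁ : 0 < σ₁) (hσ : σ₁ ≤ σ₀)
    (F : ℂ → ℂ) (d : TauLi.CompletionData) (hF : TauLi.IsSharpFlat σ₀ σ₁ F d)
    (τ : ℝ) (hτ : σ₁ ≤ τ)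
    (h0 : (0 : ℂ) ∉ TauLi.nontrivialZeros σ₁ d F)
    (hτZ : (τ : ℂ) ∉ TauLi.nontrivialZeros σ₁ d F) :
    ∀ n : ℕ, 1 ≤ n →
      TauLi.StarConvergent σ₁ d F (TauLi.liTerm n τ) ∧
      Summable (fun ρ : TauLi.nontrivialZeros σ₁ d F =>
        (TauLi.zeroMultiplicity σ₁ d F ρ : ℝ) * |(TauLi.liTerm n τ ρ).re|) ∧
      HasSum (fun ρ : TauLi.nontrivialZeros σ₁ d F =>
        (TauLi.zeroMultiplicity σ₁ d F ρ : ℝ) * (TauLi.liTerm n τ ρ).re)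
        (TauLi.liCoeff σ₁ d F n τ).re := by
  intro n _
  have hm := TauLi.finiteInStrips_zeroMultiplicity hF
  set m := TauLi.zeroMultiplicity σ₁ d F with hmdef
  obtain ⟨C, hC⟩ := TauLi.exists_abs_discrepancy_le hσ hσ₁ hF
  obtain ⟨l, hl⟩ := hm.exists_tendsto_sum_sign hC
  -- the summand without its purely imaginary leading term
  set r : ℂ → ℂ := fun ρ =>
    TauLi.liTerm n τ ρ - Complex.I * ((n * τ * TauLi.signTerm ρ : ℝ) : ℂ) with hr
  have hsum : Summable fun ρ => (m ρ : ℝ) * ‖r ρ‖ :=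
    TauLi.summable_zeroMultiplicity_mul_norm hσ₁ hF n hτ
  have hre : ∀ ρ, (r ρ).re = (TauLi.liTerm n τ ρ).re := by
    intro ρ
    simp only [hr, Complex.sub_re, Complex.I_mul_re, Complex.ofReal_im, neg_zero, sub_zero]
  have hsumC : Summable fun ρ => (m ρ : ℂ) * r ρ := by
    refine Summable.of_norm ?_
    simpa only [norm_mul, Complex.norm_natCast] using hsum
  have hlim : Tendsto (TauLi.partialSum σ₁ d F (TauLi.liTerm n τ)) atTop
      (𝓝 ((∑' ρ, (m ρ : ℂ) * r ρ) + Complex.I * ((n * τ * l : ℝ) : ℂ))) := by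
    have h1 := hm.tendsto_sum hsum
    have h2 := ((Complex.continuous_ofReal.tendsto _).comp (hl.const_mul (n * τ))).const_mul
      Complex.I
    refine (h1.add h2).congr fun T => ?_
    rw [TauLi.partialSum_eq_sum hF, Function.comp_apply, Finset.mul_sum, Complex.ofReal_sum,
      Finset.mul_sum, ← Finset.sum_add_distrib]
    refine Finset.sum_congr rfl fun ρ _ => ?_
    simp only [hr, TauLi.signTerm]
    push_cast
    ring
  have hsupp : ∀ f : ℂ → ℝ, Function.support (fun ρ => (m ρ : ℝ) * f ρ) ⊆
      TauLi.nontrivialZeros σ₁ d F := by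
    intro f ρ hρ
    rw [TauLi.mem_nontrivialZeros_iff hF]
    intro h
    apply hρ
    simp [hmdef, h]
  refine ⟨⟨TauLi.finite_zerosUpTo hF, _, hlim⟩, ?_, ?_⟩
  · have h1 : Summable fun ρ : ℂ => (m ρ : ℝ) * |(TauLi.liTerm n τ ρ).re| := by
      refine Summable.of_nonneg_of_le (fun ρ => by positivity) (fun ρ => ?_) hsum
      rw [← hre]
      gcongr
      exact Complex.abs_re_le_norm _
    exact h1.subtype _
  · have h2 : (TauLi.liCoeff σ₁ d F n τ).re = (∑' ρ, (m ρ : ℂ) * r ρ).re := by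
      rw [TauLi.liCoeff, TauLi.starSum, hlim.limUnder_eq, Complex.add_re, Complex.I_mul_re,
        Complex.ofReal_im, neg_zero, add_zero]
    rw [h2]
    have h3 : HasSum (fun ρ : ℂ => (m ρ : ℝ) * (TauLi.liTerm n τ ρ).re)
        (∑' ρ, (m ρ : ℂ) * r ρ).re := by
      refine (Complex.hasSum_re hsumC.hasSum).congr_fun fun ρ => ?_
      rw [← hre, ← Complex.ofReal_natCast, Complex.re_ofReal_mul]
    exact (hasSum_subtype_iff_of_support_subset (hsupp fun ρ => (TauLi.liTerm n τ ρ).re)).2 h3
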